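/- **Setting.** A pseudotopology on a set $X$ assigns to every ultrafilter $\mathcal U$ on $X$ a set $\lim\mathcal U\subseteq X$ of limits such that each $x\in X$ is a limit of the principal ultrafilter at $x$. For a filter $\mathcal F$ put $\lim\mathcal F=\bigcap_{\mathcal U\supseteq\mathcal F}\lim\mathcal U$. A map $f$ is continuous if $f(\lim\mathcal F)\subseteq\lim f_*\mathcal F$ for all filters $\mathcal F$. Let $\mathsf{PsTop}$ be the (bicomplete) category of pseudotopological spaces and continuous maps; topological spaces embed in it by usual convergence of ultrafilters. Let $I=[0,1]$, let $\Box$ be the full subcategory of topological spaces on the cubes $I^n$ and their boundaries $\partial I^n$ ($n\ge 0$, $I^0=*$, $\partial I^0=\emptyset$), let $\Box_{\le 2}$ be its full subcategory on the objects with $n\le 2$, and let $\iota:\Box\to\mathsf{PsTop}$ be the canonical embedding. Let $e_0,e_1$ be the endpoint inclusions $*\to I$ (or $*\to\partial I$), $\mathcal I=\{i_n:\partial I^n\hookrightarrow I^n\}_{n\ge0}$ and $\mathcal J=\{j_n: I^n\times\{0\}\hookrightarrow I^n\times I\}_{n\ge0}$. For a class $\mathcal K$ of maps, $cell(\mathcal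 K)$ is the class of transfinite compositions of pushouts of coproducts of maps in $\mathcal K$, $cof(\mathcal K)$ the class of retracts of maps in $cell(\mathcal K)$, and $rlp(\mathcal K)$ the class of maps with the right lifting property against $\mathcal K$. Write $\hat\times$ for the pushout product. A fully faithful functor $\iota:\Box_{\le2}\to\mathcal C$ into a bicomplete category makes $\mathcal C$ a *category with intervals* if: (S1) $\iota\emptyset$ is initial and $\iota *$ is terminal; (S2) $I^2$ is the product $I\times I$ in $\mathcal C$; (S3) there are $a,b:I\to I$ in $\Box_{\le2}$ with $a(0)=0$, $b(1)=1$ such that the square $a e_1=b e_0$ is a pushout in $\Box_{\le 2}$, in $\mathcal C$, and in $\mathcal C$ after applying $X\times-$ for any $X\in\mathcal C$; (S4) $\emptyset\times X\cong\emptyset$ for all $X$. A fully faithful functor $\iota:\Box\to\mathcal C$ into a bicomplete category is a *Q-structure* if: (Q1) its restriction to $\Box_{\le2}$ makes $\mathcal C$ a category with intervals; (Q2) $X\times\partial I$ is a coproduct $X\sqcup X$ with inclusions $\mathrm{id}_X\times e_k$, for all $X$; (Q3) $\mathcal I\hat\times\mathcal I\subseteq cof(\mathcal I)$ and $\mathcal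 I\hat\times\mathcal J\subseteq cof(\mathcal J)$; (Q4) $\mathcal J\subseteq cof(\mathcal I)$ and $(\emptyset\to\partial I^n)\in cof(\mathcal I)$ for all $n$; (Q5) all $I^n$ and $\partial I^n$ are exponentiable; (Q6) $\partial I^n$ is small relative to $cell(\mathcal I)$ and $I^n$ is small relative to $cell(\mathcal J)$, for all $n$. It is *good* if moreover: (Q7) $I^n$ is the $n$-fold product of $I$ in $\mathcal C$ for $n\ge1$; (Q8) for all $n\ge 0$ there are pushout squares that exhibit $I^n$ as the pushout of $*\leftarrow\partial I^n\xrightarrow{e_1}\partial I^n\times I$, with a map $\rho:\partial I^n\times I\to I^n$ such that $\rho e_0=i_n$, and $\partial I^{n+1}$ as the pushout of $*\leftarrow\partial I^n\xrightarrow{i_n} I^n$, where $*\to\partial I^{n+1}$ is the vertex $(1,\dots,1)$. Homotopies are maps $H: X\times I\to Y$; a homotopy is relative to $a:A\to X$ if its restriction along $a\times\mathrm{id}_I$ is constant. A map $f:X\to Y$ has the *weak right lifting property* against $a:A\to B$ if for all $p:A\to X$, $q:B\to Y$ with $fp=qa$ there is $h:B\to X$ with $ha=p$ and $fh$ homotopic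 to $q$ relative to $a$. For a point $x$ of $X$, $\pi_n(X,x)$ is the set of maps $I^n\to X$ that are constant at $x$ on $\partial I^n$, modulo homotopy relative to $\partial I^n$, with the usual composition in the last coordinate for $n\ge1$. **Theorem.** The pair $(\mathsf{PsTop},\iota)$ is a good Q-structure. There is a model structure on $\mathsf{PsTop}$ whose cofibrations are the maps in $cof(\mathcal I)$, whose fibrations are the maps in $rlp(\mathcal J)$, and whose weak equivalences are the maps with the weak right lifting property against $\mathcal I$. Equivalently, a map $f:X\to Y$ with $X\neq\emptyset$ is a weak equivalence if and only if $\pi_n(f):\pi_n(X,x)\to\pi_n(Y,f(x))$ is an isomorphism (a bijection for $n=0$) for all $n\ge0$ and all points $x$ of $X$, and a map $f:\emptyset\to Y$ is a weak equivalence if and only if $Y=\emptyset$. -/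

import Mathlib

open CategoryTheory Limits

universe v u

/-! ## Pseudotopological spaces -/

/-- A pseudotopology on `X`: a limit set for every ultrafilter, such that the principal ultrafilter
at `x` converges to `x`. -/
class Pseudotopology (X : Type u) where
  /-- The set of limits of an ultrafilter. -/
  ulim : Ultrafilter X → Set X
  mem_ulim_pure : ∀ x : X, x ∈ ulim (pure x)

namespace Pseudotopology

/-- The set of limits of an arbitrary filter: the intersection of the limit sets of all finer
ultrafilters. For the improper filter this is all of `X`. -/
def flim {X : Type u} [Pseudotopology X] (F : Filter X) : Set X :=
  {x | ∀ U : Ultrafilter X, (U : Filter X) ≤ F → x ∈ ulim U}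

/-- `f` is continuous if `f (lim F) ⊆ lim (f_* F)` for every filter `F`. -/
def Cont {X Y : Type u} [Pseudotopology X] [Pseudotopology Y] (f : X → Y) : Prop :=
  ∀ F : Filter X, f '' flim F ⊆ flim (F.map f)

theorem flim_ultrafilter {X : Type u} [Pseudotopology X] (U : Ultrafilter X) :
    flim (U : Filter X) = ulim U := by
  ext x
  constructor
  · intro h
    exact h U le_rfl
  · intro h V hV
    rwa [Ultrafilter.coe_le_coe.1 hV]

theorem cont_iff {X Y : Type u} [Pseudotopology X] [Pseudotopology Y] (f : X → Y) :
    Cont f ↔ ∀ (U : Ultrafilter X) (x : X), x ∈ ulim U → f x ∈ ulim (U.map f) := by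
  constructor
  · intro h U x hx
    have h1 : f x ∈ flim ((U : Filter X).map f) :=
      h U ⟨x, by rwa [flim_ultrafilter], rfl⟩
    rw [← Ultrafilter.coe_map] at h1
    rwa [flim_ultrafilter] at h1
  · rintro h F _ ⟨x, hx, rfl⟩ V hV
    obtain ⟨U, hU, rfl⟩ : ∃ U : Ultrafilter X, (U : Filter X) ≤ F ∧ U.map f = V := by
      have hne : Filter.NeBot (F ⊓ Filter.comap f V) := by
        refine Filter.inf_neBot_iff.2 ?_
        rintro s hs t ⟨w, hw, hwt⟩
        have h1 : f '' s ∈ V := hV (Filter.image_mem_map hs)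
        obtain ⟨_, ⟨a, ha, rfl⟩, hb⟩ := V.nonempty_of_mem (Filter.inter_mem h1 hw)
        exact ⟨a, ha, hwt hb⟩
      refine ⟨Ultrafilter.of (F ⊓ Filter.comap f V),
        (Ultrafilter.of_le _).trans inf_le_left, ?_⟩
      refine Ultrafilter.coe_le_coe.1 ?_
      rw [Ultrafilter.coe_map]
      exact Filter.map_le_iff_le_comap.2 ((Ultrafilter.of_le _).trans inf_le_right)
    exact h U x (hx U hU)

/-- The pseudotopology of a topological space: an ultrafilter converges to `x` iff it contains
all neighbourhoods of `x`. -/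
@[reducible] def ofTopology (X : Type u) [TopologicalSpace X] : Pseudotopology X where
  ulim U := {x | (U : Filter X) ≤ nhds x}
  mem_ulim_pure x := pure_le_nhds x

theorem cont_ofTopology {X Y : Type u} [TopologicalSpace X] [TopologicalSpace Y] {f : X → Y}
    (hf : Continuous f) :
    @Cont X Y (ofTopology X) (ofTopology Y) f := by
  let _ := ofTopology X
  let _ := ofTopology Y
  rw [cont_iff]
  intro U x hx
  have hx' : (U : Filter X) ≤ nhds x := hx
  change ((U.map f : Ultrafilter Y) : Filter Y) ≤ nhds (f x)
  rw [Ultrafilter.coe_map]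
  exact (Filter.map_mono hx').trans hf.continuousAt

end Pseudotopology

/-- The type of (small) pseudotopological spaces. -/
structure PsTop : Type (u + 1) where
  /-- The underlying set. -/
  carrier : Type u
  [str : Pseudotopology carrier]

namespace PsTop

open Pseudotopology

instance : CoeSort PsTop.{u} (Type u) := ⟨PsTop.carrier⟩

attribute [instance] PsTop.str

/-- Continuous maps of pseudotopological spaces. -/
@[ext]
structure Map (X Y : PsTop.{u}) where
  /-- The underlying function. -/
  toFun : X → Y
  cont : Cont toFun

instance (X Y : PsTop.{u}) : FunLike (Map X Y) X Y where
  coe := Map.toFun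
  coe_injective _ _ h := Map.ext h

/-- The category of pseudotopological spaces and continuous maps. -/
instance : Category PsTop.{u} where
  Hom X Y := Map X Y
  id X := ⟨id, (cont_iff _).2 fun U x hx => by simpa using hx⟩
  comp {X Y Z} f g := ⟨g.toFun ∘ f.toFun, (cont_iff _).2 fun U x hx => by
    have := (cont_iff _).1 g.cont _ _ ((cont_iff _).1 f.cont U x hx)
    rwa [Ultrafilter.map_map] at this⟩

instance : ConcreteCategory PsTop.{u} Map where
  hom f := f
  ofHom f := f

@[simp] theorem comp_toFun {X Y Z : PsTop.{u}} (f : X ⟶ Y) (g : Y ⟶ Z) :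
    Map.toFun (f ≫ g) = Map.toFun g ∘ Map.toFun f := rfl

@[simp] theorem id_toFun (X : PsTop.{u}) : Map.toFun (𝟙 X) = id := rfl

theorem hom_ext {X Y : PsTop.{u}} {f g : X ⟶ Y} (h : ∀ x, Map.toFun f x = Map.toFun g x) :
    f = g := Map.ext (funext h)

/-- Limits are formed on underlying sets, with the initial pseudotopology. -/
instance : HasLimits PsTop.{u} where
  has_limits_of_shape J _ :=
    { has_limit := fun F => by
        let S : Type u := {s : ∀ j, F.obj j // ∀ {i j} (f : i ⟶ j), (F.map f).toFun (s i) = s j}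
        let _ : Pseudotopology S :=
          { ulim := fun U => {s | ∀ j, s.1 j ∈ ulim (U.map fun t : S => t.1 j)}
            mem_ulim_pure := fun s j => by
              rw [Ultrafilter.map_pure]
              exact mem_ulim_pure _ }
        refine ⟨⟨⟨
          { pt := ⟨S⟩
            π :=
              { app := fun j => (⟨fun s : S => s.1 j, (cont_iff _).2 fun U s hs => hs j⟩ :
                  Map ⟨S⟩ (F.obj j))
                naturality := fun i j f => hom_ext fun s : S => (s.2 f).symm } },
          { lift := fun c => (⟨fun x => (⟨fun j => (c.π.app j).toFun x, fun f =>
                congrFun (congrArg Map.toFun (c.w f)) x⟩ : S), (cont_iff _).2 fun U x hx j =>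
                  (cont_iff _).1 (c.π.app j).cont U x hx⟩ : Map c.pt ⟨S⟩)
            fac := fun c j => rfl
            uniq := fun c m hm => hom_ext fun x => Subtype.ext (funext fun j =>
              congrFun (congrArg Map.toFun (hm j)) x) }⟩⟩⟩ }

/-- Colimits are formed on underlying sets, with the final pseudotopology. -/
instance : HasColimits PsTop.{u} where
  has_colimits_of_shape J _ :=
    { has_colimit := fun F => by
        let G : J ⥤ Type u := F ⋙ forget PsTop.{u}
        let S : Type u := colimit G
        let inj : ∀ j, F.obj j → S := fun j x => colimit.ι G j x
        have hsurj : ∀ s : S, ∃ j, ∃ x : F.obj j, inj j x = s := fun s =>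
          Types.jointly_surjective' (F := G) s
        have hw : ∀ {i j} (f : i ⟶ j) (x : F.obj i), inj j ((F.map f).toFun x) = inj i x :=
          fun f x => ConcreteCategory.congr_hom (colimit.w G f) x
        let _ : Pseudotopology S :=
          { ulim := fun U => {s | ∃ (j : J) (V : Ultrafilter (F.obj j)) (x : F.obj j),
              x ∈ ulim V ∧ V.map (inj j) = U ∧ inj j x = s}
            mem_ulim_pure := fun s => by
              obtain ⟨j, x, rfl⟩ := hsurj s
              exact ⟨j, pure x, x, mem_ulim_pure x, Ultrafilter.map_pure _ _, rfl⟩ }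
        let d : ∀ c : Cocone F, S → c.pt := fun c =>
          colimit.desc G ((forget PsTop.{u}).mapCocone c)
        have hd : ∀ (c : Cocone F) (j : J) (x : F.obj j),
            d c (inj j x) = (c.ι.app j).toFun x := fun c j x =>
          ConcreteCategory.congr_hom (colimit.ι_desc ((forget PsTop.{u}).mapCocone c) j) x
        refine ⟨⟨⟨
          { pt := ⟨S⟩
            ι :=
              { app := fun j => (⟨inj j, (cont_iff _).2 fun U x hx => ⟨j, U, x, hx, rfl, rfl⟩⟩ :
                  Map (F.obj j) ⟨S⟩)
                naturality := fun i j f => hom_ext fun x => hw f x } },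
          { desc := fun c => (⟨d c, (cont_iff _).2 (by
              rintro _ _ ⟨j, V, x, hx, rfl, rfl⟩
              rw [hd, Ultrafilter.map_map]
              have : d c ∘ inj j = (c.ι.app j).toFun := funext fun x => hd c j x
              rw [this]
              exact (cont_iff _).1 (c.ι.app j).cont V x hx)⟩ : Map ⟨S⟩ c.pt)
            fac := fun c j => hom_ext fun x => hd c j x
            uniq := fun c m hm => hom_ext fun s => by
              obtain ⟨j, x, rfl⟩ := hsurj s
              exact (congrFun (congrArg Map.toFun (hm j)) x).trans (hd c j x).symm }⟩⟩⟩ }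

/-- The embedding of topological spaces into pseudotopological spaces. -/
def ofTop : TopCat.{u} ⥤ PsTop.{u} where
  obj X := @PsTop.mk X (ofTopology X)
  map {X Y} f :=
    (@Map.mk (@PsTop.mk X (ofTopology X)) (@PsTop.mk Y (ofTopology Y)) f
      (cont_ofTopology f.hom.continuous))

end PsTop

/-! ## The category of cubes and their boundaries -/

/-- Names of the cubes `I^n` and their boundaries `∂I^n`, for `n ≥ 0`. -/
inductive BoxShape : Type
  | cube (n : ℕ) : BoxShape
  | boundary (n : ℕ) : BoxShape

/-- The topological spaces `I^n` and `∂I^n`. Here `I^0` is a point and `∂I^0` is empty. -/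
def BoxShape.toTop : BoxShape → TopCat.{0}
  | .cube n => TopCat.of (Fin n → unitInterval)
  | .boundary n => TopCat.of {x : Fin n → unitInterval // ∃ i, x i = 0 ∨ x i = 1}

/-- The dimension `n` of the cube underlying `I^n` or `∂I^n`. -/
def BoxShape.dim : BoxShape → ℕ
  | .cube n => n
  | .boundary n => n

/-- The full subcategory of topological spaces on the cubes and their boundaries. -/
abbrev Box : Type := InducedCategory TopCat.{0} BoxShape.toTop

namespace Box

/-- `I^n` -/
abbrev cube (n : ℕ) : Box := BoxShape.cube n

/-- `∂I^n` -/
abbrev bd (n : ℕ) : Box := BoxShape.boundary n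

/-- A continuous map of cubes as a morphism. -/
def cubeMap {m n : ℕ} (f : C(Fin m → unitInterval, Fin n → unitInterval)) :
    cube m ⟶ cube n :=
  InducedCategory.homMk (TopCat.ofHom f)

/-- The boundary inclusion `i_n : ∂I^n → I^n`. -/
def i (n : ℕ) : bd n ⟶ cube n :=
  InducedCategory.homMk (TopCat.ofHom ⟨Subtype.val, continuous_subtype_val⟩)

/-- The inclusion `j_n : I^n × {0} → I^n × I`, as the map `I^n → I^(n+1)` that appends the last
coordinate `0`. -/
def j (n : ℕ) : cube n ⟶ cube (n + 1) :=
  cubeMap ⟨fun x => Fin.snoc (α := fun _ => unitInterval) x 0, by fun_prop⟩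

/-- The point `t` of `I`, as a map `* → I`. -/
def e (t : unitInterval) : cube 0 ⟶ cube 1 :=
  cubeMap ⟨fun _ _ => t, continuous_const⟩

/-- The endpoint `t ∈ {0, 1}` of `I`, as a map `* → ∂I`. -/
def eBd (t : unitInterval) (ht : t = 0 ∨ t = 1) : cube 0 ⟶ bd 1 :=
  InducedCategory.homMk (TopCat.ofHom ⟨fun _ => ⟨fun _ => t, 0, ht⟩, continuous_const⟩)

/-- The `k`-th coordinate `I^n → I`. -/
def proj (n : ℕ) (k : Fin n) : cube n ⟶ cube 1 :=
  cubeMap ⟨fun x _ => x k, by fun_prop⟩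

/-- The unique map `∅ → ∂I^n`. -/
noncomputable def fromEmpty (n : ℕ) : bd 0 ⟶ bd n :=
  InducedCategory.homMk (TopCat.ofHom ⟨fun x => (x.2.choose.elim0), by
    have : IsEmpty {x : Fin 0 → unitInterval // ∃ i, x i = 0 ∨ x i = 1} :=
      ⟨fun x => x.2.choose.elim0⟩
    exact continuous_of_const fun x => isEmptyElim x⟩)

/-- The unique map `∂I^n → *`. -/
def toPt (n : ℕ) : bd n ⟶ cube 0 :=
  InducedCategory.homMk (TopCat.ofHom ⟨fun _ => Fin.elim0, continuous_const⟩)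

/-- The vertex `(1, …, 1)` of `∂I^(n+1)`, as a map `* → ∂I^(n+1)`. -/
def vertex (n : ℕ) : cube 0 ⟶ bd (n + 1) :=
  InducedCategory.homMk (TopCat.ofHom ⟨fun _ => ⟨fun _ => 1, 0, Or.inr rfl⟩, continuous_const⟩)

/-- `t ↦ t / 2` -/
noncomputable def lowerHalf : C(unitInterval, unitInterval) where
  toFun t := ⟨t / 2, by have := t.2.1; positivity, by have := t.2.2; linarith⟩
  continuous_toFun := by fun_prop

/-- `t ↦ (1 + t) / 2` -/
noncomputable def upperHalf : C(unitInterval, unitInterval) where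
  toFun t := ⟨(1 + t) / 2, by have := t.2.1; positivity, by have := t.2.2; linarith⟩
  continuous_toFun := by fun_prop

/-- The map `id × a : I^n × I → I^n × I`, for `a : I → I`. -/
def onLast (n : ℕ) (a : C(unitInterval, unitInterval)) : cube (n + 1) ⟶ cube (n + 1) :=
  cubeMap ⟨fun x => Function.update x (Fin.last n) (a (x (Fin.last n))), by fun_prop⟩

end Box

/-- The full subcategory of `Box` on `∅ = ∂I^0`, `* = I^0`, `∂I`, `I`, `∂I^2`, `I^2`. -/
abbrev BoxLE2 : Type :=
  ObjectProperty.FullSubcategory (C := Box) (fun b => BoxShape.dim b ≤ 2)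

namespace BoxLE2

/-- The inclusion into `Box`. -/
abbrev incl : BoxLE2 ⥤ Box :=
  ObjectProperty.ι (C := Box) (fun b => BoxShape.dim b ≤ 2)

/-- `I^n` for `n ≤ 2` -/
abbrev cube (n : ℕ) (hn : n ≤ 2 := by decide) : BoxLE2 := ⟨Box.cube n, hn⟩

/-- `∅` -/
abbrev empty : BoxLE2 := ⟨Box.bd 0, Nat.zero_le 2⟩

/-- The point `t` of `I`, as a map `* → I`. -/
abbrev e (t : unitInterval) : cube 0 ⟶ cube 1 := ObjectProperty.homMk (Box.e t)

/-- The `k`-th coordinate `I^2 → I`. -/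
abbrev proj (k : Fin 2) : cube 2 ⟶ cube 1 := ObjectProperty.homMk (Box.proj 2 k)

end BoxLE2

/-! ## Categories with intervals -/

section General

variable {C : Type u} [Category.{v} C] [HasLimits C] [HasColimits C]

/-- A category with intervals: a bicomplete category `C` with an embedding of `BoxLE2`
subject to the axioms below. -/
structure IsCategoryWithIntervals (ι : BoxLE2 ⥤ C) : Prop where
  full : ι.Full
  faithful : ι.Faithful
  /-- `∅` is sent to an initial object and `*` to a terminal one. -/
  s1_empty : Nonempty (IsInitial (ι.obj BoxLE2.empty))
  s1_point : Nonempty (IsTerminal (ι.obj (BoxLE2.cube 0)))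
  /-- `I^2` is sent to the product of two copies of `I`. -/
  s2 : Nonempty (IsLimit (BinaryFan.mk (ι.map (BoxLE2.proj 0)) (ι.map (BoxLE2.proj 1))))
  /-- `ι`, and also every `X × ι(-)`, preserves a pushout that glues two intervals to an
  interval. -/
  s3 : ∃ a b : BoxLE2.cube 1 ⟶ BoxLE2.cube 1,
    BoxLE2.e 0 ≫ a = BoxLE2.e 0 ∧ BoxLE2.e 1 ≫ b = BoxLE2.e 1 ∧
    IsPushout (BoxLE2.e 0) (BoxLE2.e 1) b a ∧
    IsPushout (ι.map (BoxLE2.e 0)) (ι.map (BoxLE2.e 1)) (ι.map b) (ι.map a) ∧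
    ∀ X : C, IsPushout (prod.map (𝟙 X) (ι.map (BoxLE2.e 0))) (prod.map (𝟙 X) (ι.map (BoxLE2.e 1)))
      (prod.map (𝟙 X) (ι.map b)) (prod.map (𝟙 X) (ι.map a))
  /-- `∅ × X` is initial. -/
  s4 : ∀ X : C, Nonempty (IsInitial (ι.obj BoxLE2.empty ⨯ X))

/-! ## Cell complexes, pushout products, smallness -/

/-- Relative cell complexes: transfinite compositions of pushouts of coproducts of maps in `W`. -/
def cell (W : MorphismProperty C) : MorphismProperty C :=
  MorphismProperty.transfiniteCompositions.{v} (MorphismProperty.coproducts.{v} W).pushouts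

/-- Retracts of relative cell complexes. -/
def cof (W : MorphismProperty C) : MorphismProperty C := (cell W).retracts

/-- The pushout product `f ×̂ g : (Y × A) ⨿_{X × A} (X × B) ⟶ Y × B`. -/
noncomputable def pushoutProduct {X Y A B : C} (f : X ⟶ Y) (g : A ⟶ B) :
    pushout (prod.map f (𝟙 A)) (prod.map (𝟙 X) g) ⟶ Y ⨯ B :=
  pushout.desc (prod.map (𝟙 Y) g) (prod.map f (𝟙 B)) (by simp)

/-- `A` is small relative to `D`: there is a cardinal `μ` such that `Hom(A, -)` preserves colimits
of all (continuous) transfinite sequences of maps in `D` whose index has the property that every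
subset with at most `μ` elements is bounded above. -/
def IsSmallRelativeTo (A : C) (D : MorphismProperty C) : Prop :=
  ∃ μ : Cardinal.{v}, ∀ (J : Type v) [LinearOrder J] [SuccOrder J] [OrderBot J] [WellFoundedLT J],
    (∀ S : Set J, Cardinal.mk S ≤ μ → BddAbove S) →
    ∀ (F : J ⥤ C) [F.IsWellOrderContinuous],
      (∀ j : J, ¬ IsMax j → D (F.map (homOfLE (Order.le_succ j)))) →
      PreservesColimit F (coyoneda.obj (Opposite.op A))

/-! ## Q-structures -/

variable (ι : Box ⥤ C)

/-- The class `{i_n : ∂I^n → I^n}`. -/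
def genI : MorphismProperty C := MorphismProperty.ofHoms fun n => ι.map (Box.i n)

/-- The class `{j_n : I^n × {0} → I^n × I}`. -/
def genJ : MorphismProperty C := MorphismProperty.ofHoms fun n => ι.map (Box.j n)

/-- A Q-structure: an embedding of `Box` into a bicomplete category subject to the axioms below. -/
structure IsQStructure : Prop where
  full : ι.Full
  faithful : ι.Faithful
  q1 : IsCategoryWithIntervals (BoxLE2.incl ⋙ ι)
  /-- `X × ∂I` is a coproduct of two copies of `X` (written `X × *`), via the endpoints. -/
  q2 : ∀ X : C, Nonempty (IsColimit (BinaryCofan.mk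
    (prod.map (𝟙 X) (ι.map (Box.eBd 0 (Or.inl rfl))))
    (prod.map (𝟙 X) (ι.map (Box.eBd 1 (Or.inr rfl))))))
  q3_I : ∀ m n, cof (genI ι) (pushoutProduct (ι.map (Box.i m)) (ι.map (Box.i n)))
  q3_J : ∀ m n, cof (genJ ι) (pushoutProduct (ι.map (Box.i m)) (ι.map (Box.j n)))
  q4_J : genJ ι ≤ cof (genI ι)
  q4_bd : ∀ n, cof (genI ι) (ι.map (Box.fromEmpty n))
  /-- `- × ∂I^n` and `- × I^n` have right adjoints. -/
  q5_bd : ∀ n, (prod.functor.flip.obj (ι.obj (Box.bd n))).IsLeftAdjoint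
  q5_cube : ∀ n, (prod.functor.flip.obj (ι.obj (Box.cube n))).IsLeftAdjoint
  q6_bd : ∀ n, IsSmallRelativeTo (ι.obj (Box.bd n)) (cell (genI ι))
  q6_cube : ∀ n, IsSmallRelativeTo (ι.obj (Box.cube n)) (cell (genJ ι))

/-- A good Q-structure: a Q-structure in which moreover cubes are powers of the interval and spheres and cones are the
expected quotients. -/
structure IsGoodQStructure : Prop extends IsQStructure ι where
  /-- `I^n` is the product of `n` copies of `I`. -/
  q7 : ∀ n, 0 < n → Nonempty (IsLimit (Fan.mk (ι.obj (Box.cube n))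
    fun k : Fin n => ι.map (Box.proj n k)))
  /-- First quotient square: `I^n` is the cone `(∂I^n × I) / (∂I^n × {1})`, and the base of the cone
  is included by `i_n`. -/
  q8_cone : ∀ n, ∃ (c : ι.obj (Box.cube 0) ⟶ ι.obj (Box.cube n))
    (ρ : ι.obj (Box.bd n) ⨯ ι.obj (Box.cube 1) ⟶ ι.obj (Box.cube n)),
    IsPushout (prod.map (𝟙 (ι.obj (Box.bd n))) (ι.map (Box.e 1)))
      (prod.fst ≫ ι.map (Box.toPt n)) ρ c ∧
    prod.map (𝟙 (ι.obj (Box.bd n))) (ι.map (Box.e 0)) ≫ ρ = prod.fst ≫ ι.map (Box.i n)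
  /-- Second quotient square: `∂I^(n+1)` is the quotient `I^n / ∂I^n`, with `∂I^n` collapsed to the
  vertex `(1)`. -/
  q8_sphere : ∀ n, ∃ σ : ι.obj (Box.cube n) ⟶ ι.obj (Box.bd (n + 1)),
    IsPushout (ι.map (Box.i n)) (ι.map (Box.toPt n)) σ (ι.map (Box.vertex n))

end General

/-! ## Homotopies and homotopy groups -/

section Homotopy

variable {C : Type u} [Category.{v} C] [HasLimits C] (ι : Box ⥤ C)

/-- `f` is homotopic to `g` relative to `a : A ⟶ X`: there is `H : X × I ⟶ Y` from `f` to `g` which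
is constant on `A`. The ends of `X × I` are written as `X × * ⟶ X × I`. -/
def HomotopicRel {A X Y : C} (a : A ⟶ X) (f g : X ⟶ Y) : Prop :=
  ∃ H : X ⨯ ι.obj (Box.cube 1) ⟶ Y,
    prod.map (𝟙 X) (ι.map (Box.e 0)) ≫ H = prod.fst ≫ f ∧
    prod.map (𝟙 X) (ι.map (Box.e 1)) ≫ H = prod.fst ≫ g ∧
    prod.map a (𝟙 (ι.obj (Box.cube 1))) ≫ H = prod.fst ≫ a ≫ f

/-- `f` has the weak right lifting property against `a`: every commutative square from `a` to `f`
has a filler for which the upper triangle commutes and the lower one commutes up to a homotopy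
relative to `a`. -/
def HasWeakRLP {A B X Y : C} (f : X ⟶ Y) (a : A ⟶ B) : Prop :=
  ∀ (p : A ⟶ X) (q : B ⟶ Y), p ≫ f = a ≫ q →
    ∃ h : B ⟶ X, a ≫ h = p ∧ HomotopicRel ι a (h ≫ f) q

/-- The maps with the weak right lifting property against all `i_n : ∂I^n → I^n`. -/
def weakRLP : MorphismProperty C := fun _ _ f => ∀ n, HasWeakRLP ι f (ι.map (Box.i n))

/-- Maps `I^n ⟶ X` that are constant at the point `x` on `∂I^n`. -/
def Spheroid (n : ℕ) {X : C} (x : ι.obj (Box.cube 0) ⟶ X) : Type v :=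
  {α : ι.obj (Box.cube n) ⟶ X // ι.map (Box.i n) ≫ α = ι.map (Box.toPt n) ≫ x}

/-- `π_n(X, x)`: maps `I^n ⟶ X` that are constant at `x` on `∂I^n`, up to homotopy relative to
`∂I^n`. -/
def HomotopyPi (n : ℕ) {X : C} (x : ι.obj (Box.cube 0) ⟶ X) : Type v :=
  Quot fun α β : Spheroid ι n x => HomotopicRel ι (ι.map (Box.i n)) α.1 β.1

theorem HomotopicRel.comp {A X Y Z : C} {a : A ⟶ X} {p q : X ⟶ Y}
    (h : HomotopicRel ι a p q) (f : Y ⟶ Z) : HomotopicRel ι a (p ≫ f) (q ≫ f) := by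
  obtain ⟨H, h0, h1, h2⟩ := h
  refine ⟨H ≫ f, ?_, ?_, ?_⟩
  · rw [← Category.assoc, h0, Category.assoc]
  · rw [← Category.assoc, h1, Category.assoc]
  · rw [← Category.assoc, h2, Category.assoc, Category.assoc]

/-- The map `π_n(X, x) → π_n(Y, f x)` induced by `f`. -/
def HomotopyPi.map (n : ℕ) {X Y : C} (f : X ⟶ Y) (x : ι.obj (Box.cube 0) ⟶ X) :
    HomotopyPi ι n x → HomotopyPi ι n (x ≫ f) :=
  Quot.map
    (fun α => ⟨α.1 ≫ f, by rw [← Category.assoc, α.2, Category.assoc]⟩)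
    (fun _ _ h => h.comp ι f)

/-- `r = p · q` in `π_(n+1)(X, x)`: there are representatives `α`, `β`, `γ` of `p`, `q`, `r` such
that `γ` is the track composite of `α` and `β`, that is, `γ` is `α` on the lower half and `β` on the
upper half of the last coordinate. -/
def HomotopyPi.IsProduct (n : ℕ) {X : C} {x : ι.obj (Box.cube 0) ⟶ X}
    (p q r : HomotopyPi ι (n + 1) x) : Prop :=
  ∃ α β γ : Spheroid ι (n + 1) x, Quot.mk _ α = p ∧ Quot.mk _ β = q ∧ Quot.mk _ γ = r ∧
    ι.map (Box.onLast n Box.lowerHalf) ≫ γ.1 = α.1 ∧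
    ι.map (Box.onLast n Box.upperHalf) ≫ γ.1 = β.1

/-- The maps `f : X ⟶ Y` that induce bijections on all `π_n`, compatible with the group operations
for `n ≥ 1`, at all points of `X`. If `X` has no point this would hold for all `Y`; in that case `Y`
is required to have no point either. -/
def isoOnHomotopyGroups : MorphismProperty C := fun X Y f =>
  (Nonempty (ι.obj (Box.cube 0) ⟶ Y) → Nonempty (ι.obj (Box.cube 0) ⟶ X)) ∧
  ∀ x : ι.obj (Box.cube 0) ⟶ X,
    (∀ n, Function.Bijective (HomotopyPi.map ι n f x)) ∧
    (∀ n p q r, HomotopyPi.IsProduct ι n p q r →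
      HomotopyPi.IsProduct ι n (HomotopyPi.map ι (n + 1) f x p) (HomotopyPi.map ι (n + 1) f x q)
        (HomotopyPi.map ι (n + 1) f x r))

end Homotopy

/-- The canonical embedding of the category of cubes and boundaries into pseudotopological spaces
(in any universe). -/
def PsTop.boxEmbedding : Box ⥤ PsTop.{u} :=
  inducedFunctor BoxShape.toTop ⋙ TopCat.uliftFunctor.{u, 0} ⋙ PsTop.ofTop.{u}

/-! Convergence of ultrafilters makes gluing and quotients well behaved. An ultrafilter on a union
of two sets contains one of them, so continuous maps on two closed pieces glue. In a colimit every
convergent ultrafilter comes, together with its limit, from a single leg. This lifting of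
convergence survives multiplication by an arbitrary space (`exists_lift_prod`), so the quotients
needed here remain quotients after `X × -`. For compact pieces in a Hausdorff space the lifting is
just compactness (`IsGluing.of_compact`), which settles subdivided intervals, cones and spheres `I^n
/ ∂I^n`. Continuous convergence provides function spaces for all objects.

Homotopy theory rests on one geometric fact: `I^n × I` deforms along rays onto the open box formed
by its bottom and its walls. Lifting this deformation solves box problems against every map in
`rlp(J)` (`RLPJ.exists_box_lift`). Over a point such problems are always solvable, so homotopy
extension holds in every space. A calculus of homotopies relative to the boundary follows, and from
it two out of three for the weak right lifting property and its comparison with homotopy groups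
(`wrlp_of_pi`). The harder halves of both regard a map on `∂I^(n+1)` as a map on `I^n` that is
constant on `∂I^n`, through the collapse `sph`.

Smallness is a counting argument. Cofibrations are injective, and a morphism out of `A` is governed
by the set of pairs (ultrafilter, limit) of `A`; if that set is bounded in the index of a sequence
with injective legs, the morphism factors through a stage. The small object argument then identifies
`cof` with `llp` of `rlp`, so the axioms on cofibrations become lifting problems for functions.

The model structure needs three more facts: `rlp(I) = rlp(J) ∩ W`, since lifting a relative homotopy
turns a weak lift into a strict one; `cof(J) ⊆ W`, since a lift into the mapping path space is a
strong deformation retraction; and `cof(I) ∩ W ⊆ cof(J)`, by the retract argument. -/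

namespace Pseudotopology

/-! ## Continuity across universes -/

/-- Continuity of a map between pseudotopological spaces in arbitrary universes. -/
@[fun_prop]
def PCont {A B : Type*} [Pseudotopology A] [Pseudotopology B] (f : A → B) : Prop :=
  ∀ (U : Ultrafilter A) (x : A), x ∈ ulim U → f x ∈ ulim (U.map f)

theorem pcont_iff_cont {A B : Type u} [Pseudotopology A] [Pseudotopology B] {f : A → B} :
    PCont f ↔ Cont f := (cont_iff f).symm

section Basic

variable {A B C : Type*} [Pseudotopology A] [Pseudotopology B] [Pseudotopology C]

@[fun_prop]
theorem PCont.id : PCont (fun x : A => x) := fun U x hx => by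
  change x ∈ ulim (U.map _root_.id)
  rwa [Ultrafilter.map_id]

@[fun_prop]
theorem PCont.comp {g : B → C} {f : A → B} (hg : PCont g) (hf : PCont f) :
    PCont (fun x => g (f x)) := fun U x hx => by
  have := hg _ _ (hf U x hx)
  rwa [Ultrafilter.map_map] at this

@[fun_prop]
theorem PCont.const (b : B) : PCont (fun _ : A => b) := fun U x _ => by
  have : U.map (fun _ : A => b) = pure b :=
    Ultrafilter.coe_injective (by simp [Filter.map_const])
  rw [this]
  exact mem_ulim_pure b

/-- Products carry the initial pseudotopology. -/
instance prodPseudotopology {A B : Type*} [Pseudotopology A] [Pseudotopology B] :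
    Pseudotopology (A × B) where
  ulim U := {z | z.1 ∈ ulim (U.map Prod.fst) ∧ z.2 ∈ ulim (U.map Prod.snd)}
  mem_ulim_pure z := by
    simp only [Ultrafilter.map_pure]
    exact ⟨mem_ulim_pure _, mem_ulim_pure _⟩

/-- Subtypes carry the initial pseudotopology. -/
instance subtypePseudotopology {A : Type*} [Pseudotopology A] (P : A → Prop) :
    Pseudotopology {a // P a} where
  ulim U := {z | z.1 ∈ ulim (U.map Subtype.val)}
  mem_ulim_pure z := by
    simp only [Ultrafilter.map_pure]
    exact mem_ulim_pure _

theorem mem_ulim_prod {U : Ultrafilter (A × B)} {z : A × B} :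
    z ∈ ulim U ↔ z.1 ∈ ulim (U.map Prod.fst) ∧ z.2 ∈ ulim (U.map Prod.snd) := Iff.rfl

theorem mem_ulim_subtype {P : A → Prop} {U : Ultrafilter {a // P a}} {z : {a // P a}} :
    z ∈ ulim U ↔ z.1 ∈ ulim (U.map Subtype.val) := Iff.rfl

theorem PCont.fst' : PCont (Prod.fst : A × B → A) := fun _ _ h => h.1

theorem PCont.snd' : PCont (Prod.snd : A × B → B) := fun _ _ h => h.2

@[fun_prop]
theorem PCont.fst {f : A → B × C} (hf : PCont f) : PCont (fun x => (f x).1) := PCont.fst'.comp hf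

@[fun_prop]
theorem PCont.snd {f : A → B × C} (hf : PCont f) : PCont (fun x => (f x).2) := PCont.snd'.comp hf

@[fun_prop]
theorem PCont.prodMk {f : A → B} {g : A → C} (hf : PCont f) (hg : PCont g) :
    PCont (fun x => (f x, g x)) := fun U x hx => by
  rw [mem_ulim_prod, Ultrafilter.map_map, Ultrafilter.map_map]
  exact ⟨hf U x hx, hg U x hx⟩

theorem PCont.val' {P : A → Prop} : PCont (Subtype.val : {a // P a} → A) := fun _ _ h => h

@[fun_prop]
theorem PCont.val {P : B → Prop} {f : A → {b // P b}} (hf : PCont f) :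
    PCont (fun x => (f x).1) := PCont.val'.comp hf

@[fun_prop]
theorem PCont.subtypeMk {P : B → Prop} {f : A → B} (hf : PCont f) (h : ∀ x, P (f x)) :
    PCont (fun x => (⟨f x, h x⟩ : {b // P b})) := fun U x hx => by
  rw [mem_ulim_subtype, Ultrafilter.map_map]
  exact hf U x hx

end Basic

/-! ## Topological spaces -/

/-- The pseudotopology of `A` is that of a topology. -/
class IsTopological (A : Type*) [TopologicalSpace A] [Pseudotopology A] : Prop where
  mem_ulim_iff : ∀ (U : Ultrafilter A) (x : A), x ∈ ulim U ↔ (U : Filter A) ≤ nhds x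

theorem mem_ulim_iff {A : Type*} [TopologicalSpace A] [Pseudotopology A] [IsTopological A]
    (U : Ultrafilter A) (x : A) : x ∈ ulim U ↔ (U : Filter A) ≤ nhds x :=
  IsTopological.mem_ulim_iff U x

instance intervalPseudotopology : Pseudotopology unitInterval := ofTopology _

instance : IsTopological unitInterval := ⟨fun _ _ => Iff.rfl⟩

instance piIntervalPseudotopology (n : ℕ) : Pseudotopology (Fin n → unitInterval) := ofTopology _

instance (n : ℕ) : IsTopological (Fin n → unitInterval) := ⟨fun _ _ => Iff.rfl⟩

instance {A B : Type*} [TopologicalSpace A] [Pseudotopology A] [IsTopological A]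
    [TopologicalSpace B] [Pseudotopology B] [IsTopological B] : IsTopological (A × B) where
  mem_ulim_iff U x := by
    rw [mem_ulim_prod, mem_ulim_iff, mem_ulim_iff, Ultrafilter.coe_map, Ultrafilter.coe_map,
      nhds_prod_eq, Filter.le_prod]
    rfl

instance {A : Type*} [TopologicalSpace A] [Pseudotopology A] [IsTopological A] (P : A → Prop) :
    IsTopological {a // P a} where
  mem_ulim_iff U x := by
    rw [mem_ulim_subtype, mem_ulim_iff, Ultrafilter.coe_map, nhds_subtype_eq_comap,
      Filter.map_le_iff_le_comap]

section Topological

variable {A B : Type*} [TopologicalSpace A] [Pseudotopology A] [IsTopological A]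
  [TopologicalSpace B] [Pseudotopology B] [IsTopological B]

@[fun_prop]
theorem PCont.of_continuous {f : A → B} (hf : Continuous f) : PCont f := fun U x hx => by
  rw [mem_ulim_iff] at hx ⊢
  rw [Ultrafilter.coe_map]
  exact (Filter.map_mono hx).trans hf.continuousAt

theorem pcont_iff_continuous {f : A → B} : PCont f ↔ Continuous f := by
  refine ⟨fun h => continuous_iff_ultrafilter.2 fun x U hU => ?_, PCont.of_continuous⟩
  have := h U x ((mem_ulim_iff _ _).2 hU)
  rwa [mem_ulim_iff, Ultrafilter.coe_map] at this

end Topological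

/-! ## Gluing -/

/-- Convergent ultrafilters on a closed subset converge in it. -/
def PClosed {A : Type*} [Pseudotopology A] (S : Set A) : Prop :=
  ∀ (U : Ultrafilter A) (x : A), x ∈ ulim U → S ∈ U → x ∈ S

theorem PClosed.of_isClosed {A : Type*} [TopologicalSpace A] [Pseudotopology A] [IsTopological A]
    {S : Set A} (hS : IsClosed S) : PClosed S := fun U x hx hU => by
  rw [mem_ulim_iff] at hx
  exact isClosed_iff_ultrafilter.1 hS x U hx hU

theorem PClosed.preimage {A B : Type*} [Pseudotopology A] [Pseudotopology B] {f : A → B}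
    {S : Set B} (hS : PClosed S) (hf : PCont f) : PClosed (f ⁻¹' S) := fun U x hx hU =>
  hS (U.map f) (f x) (hf U x hx) hU

theorem PClosed.union {A : Type*} [Pseudotopology A] {S T : Set A}
    (hS : PClosed S) (hT : PClosed T) : PClosed (S ∪ T) := fun U x hx hU => by
  rcases Ultrafilter.union_mem_iff.1 hU with h | h
  · exact Or.inl (hS U x hx h)
  · exact Or.inr (hT U x hx h)

/-- The pullback filter is proper because the range meets every member of `U`. Any ultrafilter finer
than it is mapped below `U`, hence onto `U` by maximality. -/
theorem exists_ultrafilter_map_eq {A B : Type*} {f : A → B} {U : Ultrafilter B}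
    (h : Set.range f ∈ U) : ∃ V : Ultrafilter A, V.map f = U := by
  have hne : Filter.NeBot (Filter.comap f (U : Filter B)) :=
    Filter.comap_neBot_iff.2 fun t ht => by
      obtain ⟨_, ha, a, rfl⟩ := U.nonempty_of_mem (Filter.inter_mem ht h)
      exact ⟨a, ha⟩
  refine ⟨Ultrafilter.of (Filter.comap f U), Ultrafilter.coe_le_coe.1 ?_⟩
  rw [Ultrafilter.coe_map]
  exact Filter.map_le_iff_le_comap.2 (Ultrafilter.of_le _)

/-- Two continuous maps on closed subsets that cover the space and agree on the overlap can be
glued. -/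
theorem exists_glue {A B : Type*} [Pseudotopology A] [Pseudotopology B] {P Q : A → Prop}
    (hP : PClosed {a | P a}) (hQ : PClosed {a | Q a}) (hPQ : ∀ a, P a ∨ Q a)
    (F : {a // P a} → B) (G : {a // Q a} → B) (hF : PCont F) (hG : PCont G)
    (h : ∀ a (p : P a) (q : Q a), F ⟨a, p⟩ = G ⟨a, q⟩) :
    ∃ H : A → B, PCont H ∧ (∀ a (p : P a), H a = F ⟨a, p⟩) ∧ ∀ a (q : Q a), H a = G ⟨a, q⟩ := by
  classical
  let H : A → B := fun a => if p : P a then F ⟨a, p⟩ else G ⟨a, (hPQ a).resolve_left p⟩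
  have h1 : ∀ a (p : P a), H a = F ⟨a, p⟩ := fun a p => dif_pos p
  have h2 : ∀ a (q : Q a), H a = G ⟨a, q⟩ := fun a q => by
    by_cases p : P a
    · rw [h1 a p, h a p q]
    · exact dif_neg p
  -- An ultrafilter that contains a closed piece is the image of one on that piece, and closedness
  -- puts its limit there too, so continuity on the piece applies.
  have aux : ∀ (R : A → Prop) (K : {a // R a} → B), PClosed {a | R a} → PCont K →
      (∀ a (r : R a), H a = K ⟨a, r⟩) → ∀ (U : Ultrafilter A) (x : A), x ∈ ulim U →
      {a | R a} ∈ U → H x ∈ ulim (U.map H) := by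
    intro R K hR hK hH U x hx hU
    obtain ⟨V, rfl⟩ : ∃ V : Ultrafilter {a // R a}, V.map Subtype.val = U :=
      exists_ultrafilter_map_eq (by rw [Subtype.range_coe_subtype]; exact hU)
    rw [hH x (hR _ x hx hU), Ultrafilter.map_map]
    have : H ∘ Subtype.val = K := funext fun a => hH a.1 a.2
    rw [this]
    exact hK V _ hx
  refine ⟨H, fun U x hx => ?_, h1, h2⟩
  have hU : {a | P a} ∪ {a | Q a} ∈ U := by
    have : {a | P a} ∪ {a | Q a} = Set.univ := Set.eq_univ_of_forall hPQ
    rw [this]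
    exact Filter.univ_mem
  rcases Ultrafilter.union_mem_iff.1 hU with hU | hU
  · exact aux P F hP hF h1 U x hx hU
  · exact aux Q G hQ hG h2 U x hx hU

/-- Every convergent ultrafilter on `P` lifts, with its limit, along `i` or along `k`. -/
def IsGluing {A B P : Type*} [Pseudotopology A] [Pseudotopology B] [Pseudotopology P]
    (i : A → P) (k : B → P) : Prop :=
  ∀ (U : Ultrafilter P) (p : P), p ∈ ulim U →
    (∃ (V : Ultrafilter A) (a : A), a ∈ ulim V ∧ V.map i = U ∧ i a = p) ∨
    (∃ (V : Ultrafilter B) (b : B), b ∈ ulim V ∧ V.map k = U ∧ k b = p)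

/-- A gluing carries the final pseudotopology of its two maps, so continuity is tested on the
pieces. -/
theorem IsGluing.pcont {A B P Z : Type*} [Pseudotopology A] [Pseudotopology B] [Pseudotopology P]
    [Pseudotopology Z] {i : A → P} {k : B → P} (h : IsGluing i k) {f : P → Z}
    (h1 : PCont (fun a => f (i a))) (h2 : PCont (fun b => f (k b))) : PCont f := by
  intro U p hp
  rcases h U p hp with ⟨V, a, ha, rfl, rfl⟩ | ⟨V, b, hb, rfl, rfl⟩
  · rw [Ultrafilter.map_map]
    exact h1 V a ha
  · rw [Ultrafilter.map_map]
    exact h2 V b hb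

theorem IsGluing.exists_eq {A B P : Type*} [Pseudotopology A] [Pseudotopology B]
    [Pseudotopology P] {i : A → P} {k : B → P} (h : IsGluing i k) (p : P) :
    (∃ a, i a = p) ∨ ∃ b, k b = p := by
  rcases h (pure p) p (mem_ulim_pure p) with ⟨_, a, _, _, h⟩ | ⟨_, a, _, _, h⟩
  · exact Or.inl ⟨a, h⟩
  · exact Or.inr ⟨a, h⟩

/-- Any lift of the ultrafilter to `A` converges by compactness; its limit is sent to a limit of
`U`, which is `p` because limits in `P` are unique. -/
theorem exists_lift_of_compact {A P : Type*} [TopologicalSpace A] [Pseudotopology A]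
    [IsTopological A] [CompactSpace A] [TopologicalSpace P] [Pseudotopology P] [IsTopological P]
    [T2Space P] {i : A → P} (hi : Continuous i) {U : Ultrafilter P} {p : P} (hp : p ∈ ulim U)
    (hU : Set.range i ∈ U) :
    ∃ (V : Ultrafilter A) (a : A), a ∈ ulim V ∧ V.map i = U ∧ i a = p := by
  rw [mem_ulim_iff] at hp
  obtain ⟨V, rfl⟩ := exists_ultrafilter_map_eq hU
  obtain ⟨a, _, ha⟩ := isCompact_univ.ultrafilter_le_nhds V (by simp)
  refine ⟨V, a, (mem_ulim_iff _ _).2 ha, rfl, ?_⟩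
  have h1 : (V.map i : Filter P) ≤ nhds (i a) := by
    rw [Ultrafilter.coe_map]
    exact (Filter.map_mono ha).trans hi.continuousAt
  exact eq_of_nhds_neBot ((V.map i).neBot.mono (le_inf h1 hp))

theorem IsGluing.of_compact {A B P : Type*} [TopologicalSpace A] [Pseudotopology A]
    [IsTopological A] [TopologicalSpace B] [Pseudotopology B] [IsTopological B]
    [TopologicalSpace P] [Pseudotopology P] [IsTopological P] [CompactSpace A] [CompactSpace B]
    [T2Space P] {i : A → P} {k : B → P} (hi : Continuous i) (hk : Continuous k)
    (h : ∀ p, (∃ a, i a = p) ∨ ∃ b, k b = p) : IsGluing i k := by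
  intro U p hp
  have hU : Set.range i ∪ Set.range k ∈ U := by
    have : Set.range i ∪ Set.range k = Set.univ := Set.eq_univ_of_forall h
    rw [this]
    exact Filter.univ_mem
  rcases Ultrafilter.union_mem_iff.1 hU with hU | hU
  · exact Or.inl (exists_lift_of_compact hi hp hU)
  · exact Or.inr (exists_lift_of_compact hk hp hU)

/-- The wanted ultrafilter on `T × A` must lie over `U` and over `V`. The two pullback filters are
compatible because `V` and `U` have the same image in `P`, so a common refinement exists. Its
convergence in `T` is inherited from `U`, in `A` from `V`. This makes gluings stable under products
with arbitrary spaces. -/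
theorem exists_lift_prod {A P T : Type*} [Pseudotopology A] [Pseudotopology P] [Pseudotopology T]
    {i : A → P} {U : Ultrafilter (T × P)} {p : T × P} (hp : p ∈ ulim U)
    (h : ∃ (V : Ultrafilter A) (a : A), a ∈ ulim V ∧ V.map i = U.map Prod.snd ∧ i a = p.2) :
    ∃ (W : Ultrafilter (T × A)) (z : T × A), z ∈ ulim W ∧
      W.map (fun z : T × A => (z.1, i z.2)) = U ∧ (z.1, i z.2) = p := by
  obtain ⟨x, p⟩ := p
  obtain ⟨V, a, ha, hV, rfl⟩ := h
  have hne : Filter.NeBot (Filter.comap (fun z : T × A => (z.1, i z.2)) (U : Filter (T × P)) ⊓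
      Filter.comap Prod.snd (V : Filter A)) := by
    refine Filter.inf_neBot_iff.2 ?_
    rintro _ ⟨s, hs, hs'⟩ _ ⟨t, ht, ht'⟩
    have h1 : Prod.snd ⁻¹' (i '' t) ∈ U := by
      have : i '' t ∈ V.map i := Filter.image_mem_map ht
      rw [hV] at this
      exact this
    obtain ⟨⟨y, _⟩, hy, b, hb, rfl⟩ := U.nonempty_of_mem (Filter.inter_mem hs h1)
    exact ⟨(y, b), hs' hy, ht' hb⟩
  let W := Ultrafilter.of (Filter.comap (fun z : T × A => (z.1, i z.2)) (U : Filter (T × P)) ⊓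
      Filter.comap Prod.snd (V : Filter A))
  have hW := Ultrafilter.of_le (Filter.comap (fun z : T × A => (z.1, i z.2))
    (U : Filter (T × P)) ⊓ Filter.comap Prod.snd (V : Filter A))
  have h1 : W.map (fun z : T × A => (z.1, i z.2)) = U := Ultrafilter.coe_le_coe.1 (by
    rw [Ultrafilter.coe_map]
    exact Filter.map_le_iff_le_comap.2 (hW.trans inf_le_left))
  have h2 : W.map Prod.snd = V := Ultrafilter.coe_le_coe.1 (by
    rw [Ultrafilter.coe_map]
    exact Filter.map_le_iff_le_comap.2 (hW.trans inf_le_right))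
  refine ⟨W, (x, a), ⟨?_, ?_⟩, h1, rfl⟩
  · have := hp.1
    rw [← h1, Ultrafilter.map_map] at this
    exact this
  · rw [h2]
    exact ha

theorem IsGluing.prod {A B P : Type*} [Pseudotopology A] [Pseudotopology B] [Pseudotopology P]
    {i : A → P} {k : B → P} (h : IsGluing i k) (T : Type*) [Pseudotopology T] :
    IsGluing (fun z : T × A => (z.1, i z.2)) (fun z : T × B => (z.1, k z.2)) := by
  intro U p hp
  rcases h _ _ hp.2 with h | h
  · exact Or.inl (exists_lift_prod hp h)
  · exact Or.inr (exists_lift_prod hp h)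

/-- Continuous maps on the two pieces of a gluing, compatible on the overlap, induce a continuous
map. -/
theorem IsGluing.exists_desc {A B P Z : Type*} [Pseudotopology A] [Pseudotopology B]
    [Pseudotopology P] [Pseudotopology Z] {i : A → P} {k : B → P} (h : IsGluing i k)
    {f : A → Z} {g : B → Z} (hf : PCont f) (hg : PCont g)
    (h1 : ∀ a a', i a = i a' → f a = f a') (h2 : ∀ a b, i a = k b → f a = g b)
    (h3 : ∀ b b', k b = k b' → g b = g b') :
    ∃ d : P → Z, PCont d ∧ (∀ a, d (i a) = f a) ∧ ∀ b, d (k b) = g b := by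
  classical
  let d : P → Z := fun p => if ha : ∃ a, i a = p then f ha.choose else
    g ((h.exists_eq p).resolve_left ha).choose
  have hd1 : ∀ a, d (i a) = f a := fun a => by
    have ha : ∃ a', i a' = i a := ⟨a, rfl⟩
    exact (dif_pos ha).trans (h1 _ _ ha.choose_spec)
  have hd2 : ∀ b, d (k b) = g b := fun b => by
    by_cases ha : ∃ a, i a = k b
    · obtain ⟨a, ha⟩ := ha
      rw [← ha, hd1, h2 a b ha]
    · exact (dif_neg ha).trans
        (h3 _ _ ((h.exists_eq (k b)).resolve_left ha).choose_spec)
  refine ⟨d, h.pcont ?_ ?_, hd1, hd2⟩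
  · simpa only [hd1] using hf
  · simpa only [hd2] using hg

end Pseudotopology

/-! ## Geometry of cubes -/

namespace CubeGeom

/-- The cube `I^n`. -/
abbrev Cube (n : ℕ) : Type := Fin n → unitInterval

/-- The boundary `∂I^n`. -/
abbrev Bd (n : ℕ) : Type := {x : Cube n // ∃ i, x i = 0 ∨ x i = 1}

/-- The nearest point of the unit interval. -/
noncomputable def clamp (r : ℝ) : unitInterval := Set.projIcc 0 1 zero_le_one r

@[fun_prop]
theorem continuous_clamp : Continuous clamp := continuous_projIcc (h := zero_le_one)

theorem coe_clamp {r : ℝ} (h0 : 0 ≤ r) (h1 : r ≤ 1) : (clamp r : ℝ) = r := by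
  rw [clamp, Set.projIcc_of_mem zero_le_one ⟨h0, h1⟩]

@[simp]
theorem clamp_coe (t : unitInterval) : clamp (t : ℝ) = t := Set.projIcc_val zero_le_one t

theorem clamp_of_one_le {r : ℝ} (h : 1 ≤ r) : clamp r = 1 := Set.projIcc_of_right_le _ h

theorem clamp_one : clamp 1 = 1 := clamp_of_one_le le_rfl

theorem clamp_zero : clamp 0 = 0 := Set.projIcc_of_le_left _ le_rfl

variable {n : ℕ}

/-- Coordinates centred at the midpoint of the cube, scaled to `[-1, 1]`. -/
def ctr (x : Cube n) : Fin n → ℝ := fun i => 2 * (x i : ℝ) - 1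

/-- The inverse of `ctr` on the unit ball of the supremum norm. -/
noncomputable def unc (w : Fin n → ℝ) : Cube n := fun i => clamp ((w i + 1) / 2)

@[fun_prop]
theorem continuous_ctr : Continuous (ctr : Cube n → Fin n → ℝ) := by
  unfold ctr; fun_prop

@[fun_prop]
theorem continuous_unc : Continuous (unc : (Fin n → ℝ) → Cube n) := by
  unfold unc; fun_prop

@[simp]
theorem unc_ctr (x : Cube n) : unc (ctr x) = x := by
  funext i
  simp [unc, ctr]

theorem norm_ctr_le (x : Cube n) : ‖ctr x‖ ≤ 1 := by
  refine (pi_norm_le_iff_of_nonneg zero_le_one).2 fun i => ?_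
  have h0 := (x i).2.1
  have h1 := (x i).2.2
  rw [Real.norm_eq_abs, abs_le, ctr]
  constructor <;> linarith

theorem ctr_unc {w : Fin n → ℝ} (h : ‖w‖ ≤ 1) : ctr (unc w) = w := by
  funext i
  have h1 := (norm_le_pi_norm w i).trans h
  rw [Real.norm_eq_abs, abs_le] at h1
  rw [ctr, unc, coe_clamp (by linarith) (by linarith)]
  ring

theorem ctr_injective : Function.Injective (ctr : Cube n → Fin n → ℝ) :=
  Function.LeftInverse.injective unc_ctr

/-- In centred coordinates the cube is the unit ball of the supremum norm and its boundary the unit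
sphere. Hence the radial constructions below need no case distinction by faces. -/
theorem mem_bd_iff (x : Cube n) : (∃ i, x i = 0 ∨ x i = 1) ↔ ‖ctr x‖ = 1 := by
  constructor
  · rintro ⟨i, hi⟩
    refine le_antisymm (norm_ctr_le x) ?_
    have : ‖ctr x i‖ = 1 := by
      rcases hi with hi | hi <;> simp [ctr, hi]
      norm_num
    exact this.symm.le.trans (norm_le_pi_norm _ i)
  · intro h
    by_contra! hne
    have : ‖ctr x‖ < 1 := by
      refine (pi_norm_lt_iff zero_lt_one).2 fun i => ?_
      obtain ⟨h0, h1⟩ := hne i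
      have h0 : (0 : ℝ) < x i := unitInterval.pos_iff_ne_zero.2 h0
      have h1 : (x i : ℝ) < 1 := unitInterval.lt_one_iff_ne_one.2 h1
      rw [Real.norm_eq_abs, abs_lt, ctr]
      constructor <;> linarith
    linarith

theorem Bd.norm_ctr (x : Bd n) : ‖ctr x.1‖ = 1 := (mem_bd_iff x.1).1 x.2

theorem isClosed_bd : IsClosed {x : Cube n | ∃ i, x i = 0 ∨ x i = 1} := by
  have : {x : Cube n | ∃ i, x i = 0 ∨ x i = 1} = {x | ‖ctr x‖ = 1} := Set.ext mem_bd_iff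
  rw [this]
  exact isClosed_eq (by fun_prop) continuous_const

instance : CompactSpace (Bd n) := isCompact_iff_compactSpace.1 (isClosed_bd (n := n)).isCompact

instance : IsEmpty (Bd 0) := ⟨fun x => x.2.choose.elim0⟩

/-! ### The box as a deformation retract -/

/-- The reciprocal of the distance ratio in the projection from a point above the cube. -/
noncomputable def boxM (z : Cube n × unitInterval) : ℝ := max ‖ctr z.1‖ (1 - z.2 / 2)

theorem boxM_pos (z : Cube n × unitInterval) : 0 < boxM z :=
  lt_of_lt_of_le (by have := z.2.2.2; linarith) (le_max_right _ _)

theorem boxM_le (z : Cube n × unitInterval) : boxM z ≤ 1 :=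
  max_le (norm_ctr_le _) (by have := z.2.2.1; linarith)

@[fun_prop]
theorem continuous_boxM : Continuous (boxM : Cube n × unitInterval → ℝ) := by
  unfold boxM; fun_prop

/-- The time at which the deformation `boxDef` reaches a given point. -/
noncomputable def boxTime (z : Cube n × unitInterval) : unitInterval := clamp (1 - boxM z)

@[fun_prop]
theorem continuous_boxTime : Continuous (boxTime : Cube n × unitInterval → unitInterval) := by
  unfold boxTime; fun_prop

/-- The deformation of the projection of `I^n × I` onto the open box to the identity, along rays. -/
noncomputable def boxDef (z : (Cube n × unitInterval) × unitInterval) : Cube n × unitInterval :=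
  (unc ((max (1 - (z.2 : ℝ)) (boxM z.1) / boxM z.1) • ctr z.1.1),
    clamp (2 - (2 - z.1.2) * (max (1 - (z.2 : ℝ)) (boxM z.1) / boxM z.1)))

@[fun_prop]
theorem continuous_boxDef :
    Continuous (boxDef : (Cube n × unitInterval) × unitInterval → Cube n × unitInterval) := by
  have h : Continuous fun z : (Cube n × unitInterval) × unitInterval =>
      max (1 - (z.2 : ℝ)) (boxM z.1) / boxM z.1 :=
    Continuous.div (by fun_prop) (by fun_prop) fun z => (boxM_pos z.1).ne'
  unfold boxDef
  fun_prop

/-- In coordinates `(ctr x, s)` the apex of the projection is `(0, 2)`, and the ray through `z` is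
`(λ • ctr x, 2 - (2 - s) λ)`. It stays in `I^n × I` for `1 ≤ λ ≤ 1 / boxM z`. At time `t` the factor
is `λ = max (1 - t) (boxM z) / boxM z`, which first equals `1` at `t = 1 - boxM z`. -/
theorem boxDef_time (z : Cube n × unitInterval) : boxDef (z, boxTime z) = z := by
  have h1 : (boxTime z : ℝ) = 1 - boxM z :=
    coe_clamp (by linarith [boxM_le z]) (by linarith [boxM_pos z])
  have h2 : max (1 - (boxTime z : ℝ)) (boxM z) / boxM z = 1 := by
    rw [h1, sub_sub_cancel, max_self, div_self (boxM_pos z).ne']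
  simp [boxDef, h2]

/-- On the open box the ray is already at its exit point: either the norm is `1` or the height is
`0`, and both force `boxM z = 1`. -/
theorem boxTime_eq_zero {z : Cube n × unitInterval} (h : (∃ i, z.1 i = 0 ∨ z.1 i = 1) ∨ z.2 = 0) :
    boxTime z = 0 := by
  have : boxM z = 1 := by
    refine le_antisymm (boxM_le z) ?_
    rcases h with h | h
    · exact ((mem_bd_iff _).1 h).symm.le.trans (le_max_left _ _)
    · exact le_trans (by simp [h]) (le_max_right _ _)
  rw [boxTime, this, sub_self, clamp_zero]

/-- At time `0` the factor is `1 / boxM z`. The ray leaves through a wall if the norm attains the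
maximum in `boxM`, and through the bottom otherwise. -/
theorem boxDef_zero_mem (z : Cube n × unitInterval) :
    (∃ i, (boxDef (z, 0)).1 i = 0 ∨ (boxDef (z, 0)).1 i = 1) ∨ (boxDef (z, 0)).2 = 0 := by
  have hM := boxM_pos z
  have h1 : max (1 - ((0 : unitInterval) : ℝ)) (boxM z) / boxM z = (boxM z)⁻¹ := by
    rw [Set.Icc.coe_zero, sub_zero, max_eq_left (boxM_le z), one_div]
  have h2 : ‖ctr z.1‖ ≤ boxM z := le_max_left _ _
  rcases max_choice ‖ctr z.1‖ (1 - (z.2 : ℝ) / 2) with h | h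
  · left
    have h3 : ‖(boxM z)⁻¹ • ctr z.1‖ = 1 := by
      rw [norm_smul, norm_inv, Real.norm_of_nonneg hM.le]
      have : ‖ctr z.1‖ = boxM z := h.symm
      rw [this, inv_mul_cancel₀ hM.ne']
    rw [mem_bd_iff]
    simp only [boxDef, h1]
    rw [ctr_unc h3.le, h3]
  · right
    have h4 : boxM z = 1 - (z.2 : ℝ) / 2 := h
    have h3 : 2 - (2 - (z.2 : ℝ)) * (boxM z)⁻¹ = 0 := by
      have : 2 - (z.2 : ℝ) = 2 * boxM z := by rw [h4]; ring
      rw [this, mul_assoc, mul_inv_cancel₀ hM.ne']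
      norm_num
    simp only [boxDef, h1, h3, clamp_zero]

/-! ### Lid and walls of a box -/

/-- The homeomorphism of the cube with the lid and the walls of the cube of the next dimension. -/
noncomputable def lidMap (c : Cube n) : Cube n × unitInterval :=
  (unc ((max ‖ctr c‖ 2⁻¹)⁻¹ • ctr c), clamp (2 - 2 * ‖ctr c‖))

@[fun_prop]
theorem continuous_lidMap : Continuous (lidMap : Cube n → Cube n × unitInterval) := by
  have h : Continuous fun c : Cube n => (max ‖ctr c‖ 2⁻¹)⁻¹ :=
    Continuous.inv₀ (by fun_prop) fun c => (lt_of_lt_of_le (by norm_num) (le_max_right _ _)).ne'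
  unfold lidMap
  fun_prop

/-- The inverse of `lidMap` on lid and walls. -/
noncomputable def lidInv (z : Cube n × unitInterval) : Cube n :=
  unc ((1 - (z.2 : ℝ) / 2) • ctr z.1)

@[fun_prop]
theorem continuous_lidInv : Continuous (lidInv : Cube n × unitInterval → Cube n) := by
  unfold lidInv; fun_prop

theorem lidInv_zero (x : Cube n) : lidInv (x, 0) = x := by simp [lidInv]

theorem lidMap_of_bd {x : Cube n} (h : ∃ i, x i = 0 ∨ x i = 1) : lidMap x = (x, 0) := by
  have h1 := (mem_bd_iff x).1 h
  have h2 : max (1 : ℝ) 2⁻¹ = 1 := max_eq_left (by norm_num)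
  simp [lidMap, h1, h2, clamp_zero]

/-- The ball of radius `1/2` is stretched over the lid; the shell outside it is folded down along
the walls, radius `r` going to height `2 - 2r`. Correspondingly `lidInv` scales by `1 - s / 2`,
which is `1/2` on the lid and recovers the radius on a wall. -/
theorem lidMap_lidInv {z : Cube n × unitInterval}
    (h : (∃ i, z.1 i = 0 ∨ z.1 i = 1) ∨ z.2 = 1) : lidMap (lidInv z) = z := by
  obtain ⟨x, s⟩ := z
  have hs0 := s.2.1
  have hs1 := s.2.2
  have hx := norm_ctr_le x
  have hk : ‖(1 - (s : ℝ) / 2) • ctr x‖ = (1 - (s : ℝ) / 2) * ‖ctr x‖ := by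
    rw [norm_smul, Real.norm_of_nonneg (by linarith)]
  have hk1 : (1 - (s : ℝ) / 2) * ‖ctr x‖ ≤ 1 :=
    mul_le_one₀ (by linarith) (norm_nonneg _) hx
  have h1 : ctr (lidInv (x, s)) = (1 - (s : ℝ) / 2) • ctr x := ctr_unc (hk.le.trans hk1)
  simp only [lidMap, h1, hk]
  rcases h with h | h
  · have h2 : ‖ctr x‖ = 1 := (mem_bd_iff x).1 h
    rw [h2, mul_one, max_eq_left (by linarith), smul_smul, inv_mul_cancel₀ (by linarith),
      one_smul, unc_ctr]
    have : 2 - 2 * (1 - (s : ℝ) / 2) = s := by ring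
    rw [this, clamp_coe]
  · have h2 : s = 1 := h
    subst h2
    have h3 : (1 - ((1 : unitInterval) : ℝ) / 2) = 2⁻¹ := by
      rw [Set.Icc.coe_one]; norm_num
    rw [h3, max_eq_right (by linarith), smul_smul, inv_mul_cancel₀ (by norm_num), one_smul,
      unc_ctr, clamp_of_one_le (by linarith)]

/-! ### The cone -/

/-- The centre of the cube. -/
noncomputable def centre (n : ℕ) : Cube n := unc 0

/-- The cube as the cone over its boundary. -/
noncomputable def cone (z : Bd n × unitInterval) : Cube n :=
  unc ((1 - (z.2 : ℝ)) • ctr z.1.1)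

@[fun_prop]
theorem continuous_cone : Continuous (cone : Bd n × unitInterval → Cube n) := by
  unfold cone; fun_prop

theorem ctr_cone (z : Bd n × unitInterval) : ctr (cone z) = (1 - (z.2 : ℝ)) • ctr z.1.1 := by
  refine ctr_unc ?_
  have h0 := z.2.2.1
  have h1 := z.2.2.2
  rw [norm_smul, z.1.norm_ctr, Real.norm_of_nonneg (by linarith)]
  linarith

theorem norm_ctr_cone (z : Bd n × unitInterval) : ‖ctr (cone z)‖ = 1 - (z.2 : ℝ) := by
  have h1 := z.2.2.2
  rw [ctr_cone, norm_smul, z.1.norm_ctr, Real.norm_of_nonneg (by linarith), mul_one]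

theorem ctr_centre : ctr (centre n) = 0 := ctr_unc (by simp)

theorem cone_zero (x : Bd n) : cone (x, 0) = x.1 := by simp [cone]

theorem cone_one (x : Bd n) : cone (x, 1) = centre n := by simp [cone, centre]

theorem cone_eq_centre {z : Bd n × unitInterval} (h : cone z = centre n) : z.2 = 1 := by
  have h1 := norm_ctr_cone z
  rw [h, ctr_centre, norm_zero] at h1
  exact Subtype.ext (by rw [Set.Icc.coe_one]; linarith)

/-- The norm of a point of the cone determines the height, and away from the tip the scaling can be
undone. -/
theorem cone_inj {z w : Bd n × unitInterval} (h : cone z = cone w) :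
    z = w ∨ z.2 = 1 ∧ w.2 = 1 := by
  have h1 := norm_ctr_cone z
  rw [h, norm_ctr_cone w] at h1
  have h2 : z.2 = w.2 := Subtype.ext (by linarith)
  by_cases h3 : z.2 = 1
  · exact Or.inr ⟨h3, h2 ▸ h3⟩
  · left
    have h4 : (z.2 : ℝ) < 1 := unitInterval.lt_one_iff_ne_one.2 h3
    have h5 := ctr_cone z
    rw [h, ctr_cone w, h2] at h5
    have h6 : (1 - (w.2 : ℝ)) ≠ 0 := by rw [← h2]; linarith
    have h7 := smul_right_injective _ h6 h5
    exact Prod.ext (Subtype.ext (ctr_injective h7.symm)) h2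

theorem exists_cone_eq (x : Cube n) : (∃ z, cone z = x) ∨ x = centre n := by
  by_cases h : ctr x = 0
  · right
    rw [← unc_ctr x, h, centre]
  · left
    have h0 : 0 < ‖ctr x‖ := norm_pos_iff.2 h
    have h1 : ‖(‖ctr x‖⁻¹) • ctr x‖ = 1 := by
      rw [norm_smul, norm_inv, norm_norm, inv_mul_cancel₀ h0.ne']
    refine ⟨(⟨unc (‖ctr x‖⁻¹ • ctr x), (mem_bd_iff _).2 (by rw [ctr_unc h1.le, h1])⟩,
      clamp (1 - ‖ctr x‖)), ?_⟩
    apply ctr_injective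
    rw [ctr_cone]
    dsimp only
    rw [ctr_unc h1.le, coe_clamp (by linarith [norm_ctr_le x]) (by linarith),
      sub_sub_cancel, smul_smul, mul_inv_cancel₀ h0.ne', one_smul]

/-! ### The sphere as a quotient of the cube -/

/-- A map from the cube to nonzero vectors; its directions exhaust all directions, and only the
boundary is mapped to the direction of `(1, …, 1)`. -/
noncomputable def sphVec (c : Cube n) : Fin (n + 1) → ℝ :=
  Fin.snoc (α := fun _ => ℝ) (fun i => (1 - ‖ctr c‖) * ctr c i + (2 * ‖ctr c‖ - 1))
    (2 * ‖ctr c‖ - 1)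

@[fun_prop]
theorem continuous_sphVec : Continuous (sphVec : Cube n → Fin (n + 1) → ℝ) := by
  unfold sphVec; fun_prop

/-- With `r = ‖ctr c‖`, the vector `sphVec c` is `(1 - r) • (ctr c, 0) + (2r - 1) • (1, …, 1)`. The
last coordinate gives the second summand, and subtracting it from the others gives the first. -/
theorem sphVec_eq_smul {c d : Cube n} {μ : ℝ} (h : sphVec d = μ • sphVec c) :
    2 * ‖ctr d‖ - 1 = μ * (2 * ‖ctr c‖ - 1) ∧
    (1 - ‖ctr d‖) • ctr d = μ • (1 - ‖ctr c‖) • ctr c ∧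
    (1 - ‖ctr d‖) * ‖ctr d‖ = |μ| * ((1 - ‖ctr c‖) * ‖ctr c‖) := by
  have h1 : 2 * ‖ctr d‖ - 1 = μ * (2 * ‖ctr c‖ - 1) := by
    have := congrFun h (Fin.last n)
    simpa [sphVec] using this
  have h2 : (1 - ‖ctr d‖) • ctr d = μ • (1 - ‖ctr c‖) • ctr c := by
    funext i
    have := congrFun h i.castSucc
    simp only [sphVec, Pi.smul_apply, Fin.snoc_castSucc, smul_eq_mul] at this ⊢
    linarith
  refine ⟨h1, h2, ?_⟩
  have h3 := congrArg norm h2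
  have hd : 0 ≤ 1 - ‖ctr d‖ := sub_nonneg.2 (norm_ctr_le d)
  have hc : 0 ≤ 1 - ‖ctr c‖ := sub_nonneg.2 (norm_ctr_le c)
  rwa [norm_smul, norm_smul, norm_smul, Real.norm_of_nonneg hd, Real.norm_of_nonneg hc,
    Real.norm_eq_abs] at h3

theorem sphVec_ne_zero (c : Cube n) : sphVec c ≠ 0 := by
  intro h
  have h1 : sphVec c = (0 : ℝ) • sphVec c := by rw [h, smul_zero]
  obtain ⟨h2, -, h3⟩ := sphVec_eq_smul h1
  have h4 : ‖ctr c‖ = 1 / 2 := by linarith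
  rw [h4] at h3
  norm_num at h3

theorem sphVec_of_bd {c : Cube n} (h : ∃ i, c i = 0 ∨ c i = 1) : sphVec c = fun _ => 1 := by
  have h1 := (mem_bd_iff c).1 h
  funext i
  induction i using Fin.lastCases with
  | last => simp [sphVec, h1]; norm_num
  | cast i => simp [sphVec, h1]; norm_num

/-- Up to a positive factor the pair `(r (1 - r), 2r - 1)` determines the radius `r`, and then the
first summand determines the point unless `r = 1`. -/
theorem sphVec_inj {c d : Cube n} {μ : ℝ} (hμ : 0 < μ) (h : sphVec d = μ • sphVec c) :
    d = c ∨ (∃ i, d i = 0 ∨ d i = 1) ∧ ∃ i, c i = 0 ∨ c i = 1 := by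
  obtain ⟨h1, h2, h3⟩ := sphVec_eq_smul h
  rw [abs_of_pos hμ] at h3
  rw [mem_bd_iff, mem_bd_iff]
  have hr0 := norm_nonneg (ctr c)
  have hs0 := norm_nonneg (ctr d)
  have hr1 := norm_ctr_le c
  have hs1 := norm_ctr_le d
  set r := ‖ctr c‖
  set s := ‖ctr d‖
  -- Eliminating `μ` leaves `(2s - 1) r (1 - r) = (2r - 1) s (1 - s)`, whose difference of sides has
  -- this factorization.
  have hrs : (s - r) * (r * s + (1 - r) * (1 - s)) = 0 := by
    have e1 : (2 * s - 1) * ((1 - r) * r) = (2 * r - 1) * ((1 - s) * s) := by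
      rw [h1, h3]; ring
    linear_combination e1
  have heq : s = r := by
    rcases mul_eq_zero.1 hrs with h | h
    · linarith
    -- The second factor is a sum of nonnegative terms. It vanishes only if one radius is `0` and
    -- the other `1`, where `2r - 1` and `2s - 1` have opposite signs, against `0 < μ`.
    · have e1 : 0 ≤ r * s := mul_nonneg hr0 hs0
      have e2 : 0 ≤ (1 - r) * (1 - s) := mul_nonneg (by linarith) (by linarith)
      have e3 : r * s = 0 := by linarith
      have e4 : (1 - r) * (1 - s) = 0 := by linarith
      rcases mul_eq_zero.1 e3 with e | e <;> rw [e] at e4 h1 <;>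
        simp only [sub_zero, one_mul, mul_one] at e4 <;> nlinarith
  by_cases hr : r = 1
  · exact Or.inr ⟨heq.trans hr, hr⟩
  · left
    -- The last coordinates give `μ = 1` unless they vanish; then `r = 1/2`, and the norms `r (1 -
    -- r) = 1/4` can be compared instead.
    have hμ1 : μ = 1 := by
      rw [heq] at h1 h3
      by_cases hr2 : 2 * r - 1 = 0
      · have : r = 1 / 2 := by linarith
        rw [this] at h3
        linarith
      · exact (mul_right_cancel₀ hr2 (by linarith : 1 * (2 * r - 1) = μ * (2 * r - 1))).symm
    rw [hμ1, one_smul, heq] at h2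
    have : (1 - r) ≠ 0 := fun h => hr (by linarith)
    exact ctr_injective (smul_right_injective _ this h2)

/-- The collapse of the boundary of the cube, onto the boundary of the next cube. -/
noncomputable def sph (c : Cube n) : Bd (n + 1) :=
  ⟨unc (‖sphVec c‖⁻¹ • sphVec c), (mem_bd_iff _).2 (by
    have h : ‖(‖sphVec c‖⁻¹) • sphVec c‖ = 1 := by
      rw [norm_smul, norm_inv, norm_norm, inv_mul_cancel₀ (norm_ne_zero_iff.2 (sphVec_ne_zero c))]
    rw [ctr_unc h.le, h])⟩

theorem ctr_sph (c : Cube n) : ctr (sph c).1 = ‖sphVec c‖⁻¹ • sphVec c := by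
  refine ctr_unc ?_
  rw [norm_smul, norm_inv, norm_norm, inv_mul_cancel₀ (norm_ne_zero_iff.2 (sphVec_ne_zero c))]

@[fun_prop]
theorem continuous_sph : Continuous (sph : Cube n → Bd (n + 1)) := by
  have h : Continuous fun c : Cube n => ‖sphVec c‖⁻¹ :=
    Continuous.inv₀ (by fun_prop) fun c => norm_ne_zero_iff.2 (sphVec_ne_zero c)
  unfold sph
  fun_prop

/-- The vertex `(1, …, 1)`. -/
def vtx (n : ℕ) : Bd (n + 1) := ⟨fun _ => 1, 0, Or.inr rfl⟩

theorem ctr_vtx : ctr (vtx n).1 = fun _ => 1 := by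
  funext i
  simp [ctr, vtx]
  norm_num

theorem sph_of_bd {c : Cube n} (h : ∃ i, c i = 0 ∨ c i = 1) : sph c = vtx n := by
  apply Subtype.ext
  apply ctr_injective
  rw [ctr_sph, sphVec_of_bd h, ctr_vtx]
  have : ‖(fun _ : Fin (n + 1) => (1 : ℝ))‖ = 1 := by simp
  rw [this]
  simp

theorem sph_inj {c d : Cube n} (h : sph c = sph d) :
    c = d ∨ (∃ i, c i = 0 ∨ c i = 1) ∧ ∃ i, d i = 0 ∨ d i = 1 := by
  have h1 := congrArg (fun z => ctr z.1) h
  simp only [ctr_sph] at h1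
  have hc := norm_pos_iff.2 (sphVec_ne_zero c)
  have hd := norm_pos_iff.2 (sphVec_ne_zero d)
  refine sphVec_inj (μ := ‖sphVec c‖ * ‖sphVec d‖⁻¹) (by positivity) ?_
  rw [← smul_smul, ← h1, smul_smul, mul_inv_cancel₀ hc.ne', one_smul]

theorem sph_eq_vtx {c : Cube n} (h : sph c = vtx n) : ∃ i, c i = 0 ∨ c i = 1 := by
  have h1 := congrArg (fun z => ctr z.1) h
  simp only [ctr_sph, ctr_vtx] at h1
  have hc := norm_pos_iff.2 (sphVec_ne_zero c)
  have hs : sphVec c = fun _ => ‖sphVec c‖ := by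
    have h2 := congrArg (fun z => ‖sphVec c‖ • z) h1
    simp only [smul_smul, mul_inv_cancel₀ hc.ne', one_smul] at h2
    rw [h2, norm_smul, norm_norm]
    funext i
    simp
  have hl := congrFun hs (Fin.last n)
  simp only [sphVec, Fin.snoc_last] at hl
  have hy : (1 - ‖ctr c‖) • ctr c = 0 := by
    funext i
    have hi := congrFun hs i.castSucc
    simp only [sphVec, Fin.snoc_castSucc] at hi
    simp only [Pi.smul_apply, smul_eq_mul, Pi.zero_apply]
    linarith
  rw [mem_bd_iff]
  rcases smul_eq_zero.1 hy with h | h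
  · linarith
  -- The centre of the cube is excluded: its last coordinate is `-1`, in the direction opposite to
  -- the vertex.
  · have hpos : 0 < 2 * ‖ctr c‖ - 1 := by
      simp only [sphVec] at hc
      rw [hl]
      exact hc
    rw [h, norm_zero] at hpos
    linarith

/-- Write the target as `(y, 0) + s • (1, …, 1)`. If `y = 0` it is the vertex or the image of the
centre. Otherwise the preimage lies in the direction of `y`, and only its radius has to be found. -/
theorem exists_sph_eq (x : Bd (n + 1)) : (∃ c, sph c = x) ∨ x = vtx n := by
  have hx := x.norm_ctr
  set V := ctr x.1 with hV
  set s := V (Fin.last n) with hs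
  set y : Fin n → ℝ := fun i => V i.castSucc - s with hy
  have key : ∀ (c : Cube n) (μ : ℝ), 0 < μ → sphVec c = μ • V → sph c = x := by
    intro c μ hμ hc
    apply Subtype.ext
    apply ctr_injective
    rw [ctr_sph, hc, norm_smul, hx, mul_one, Real.norm_of_nonneg hμ.le, smul_smul,
      inv_mul_cancel₀ hμ.ne', one_smul]
  have hVs : V = Fin.snoc (α := fun _ => ℝ) (fun i => y i + s) s := by
    funext i
    induction i using Fin.lastCases with
    | last => simp [hs]
    | cast i => simp [hy]
  by_cases hy0 : y = 0
  · have hV1 : V = fun _ => s := by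
      rw [hVs, hy0]
      funext i
      induction i using Fin.lastCases <;> simp
    have hs1 : |s| = 1 := by
      rw [hV1] at hx
      simpa using hx
    rcases (abs_eq zero_le_one).1 hs1 with h | h
    · right
      apply Subtype.ext
      apply ctr_injective
      rw [← hV, hV1, ctr_vtx, h]
    · left
      refine ⟨centre n, key _ 1 zero_lt_one ?_⟩
      rw [hV1, h]
      funext i
      induction i using Fin.lastCases <;> simp [sphVec, ctr_centre]
  · left
    have hyp : 0 < ‖y‖ := norm_pos_iff.2 hy0
    -- For a point of radius `r` in the direction of `y` the first summand is `μ • y` with `μ = r (1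
    -- - r) / ‖y‖`. The remaining condition `2r - 1 = μ s` is this equation, whose left side changes
    -- from `‖y‖` to `-‖y‖` on `[0, 1]`.
    obtain ⟨r, ⟨hr0, hr1⟩, hr⟩ : ∃ r ∈ Set.Icc (0 : ℝ) 1,
        s * (r * (1 - r)) - ‖y‖ * (2 * r - 1) = 0 := by
      have hc : ContinuousOn (fun r : ℝ => s * (r * (1 - r)) - ‖y‖ * (2 * r - 1))
          (Set.Icc 0 1) := by fun_prop
      have := intermediate_value_Icc' zero_le_one hc
      have h0 : (0 : ℝ) ∈ Set.Icc (s * (1 * (1 - 1)) - ‖y‖ * (2 * 1 - 1))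
          (s * (0 * (1 - 0)) - ‖y‖ * (2 * 0 - 1)) := by
        constructor <;> linarith
      exact this h0
    have hr0' : r ≠ 0 := by
      rintro rfl
      simp at hr
      exact hy0 hr
    have hr1' : r ≠ 1 := by
      rintro rfl
      norm_num at hr
      exact hy0 hr
    have hrpos : 0 < r := lt_of_le_of_ne hr0 (Ne.symm hr0')
    have hr1pos : 0 < 1 - r := by linarith [lt_of_le_of_ne hr1 hr1']
    have hn : ‖(r * ‖y‖⁻¹) • y‖ = r := by
      rw [norm_smul, norm_mul, norm_inv, norm_norm, Real.norm_of_nonneg hr0, mul_assoc,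
        inv_mul_cancel₀ hyp.ne', mul_one]
    have hctr : ctr (unc ((r * ‖y‖⁻¹) • y)) = (r * ‖y‖⁻¹) • y := ctr_unc (hn.le.trans hr1)
    refine ⟨unc ((r * ‖y‖⁻¹) • y), key _ (r * (1 - r) * ‖y‖⁻¹) (by positivity) ?_⟩
    have hμs : 2 * r - 1 = r * (1 - r) * ‖y‖⁻¹ * s := by
      field_simp
      linarith
    rw [hVs]
    funext i
    simp only [sphVec, hctr, hn]
    induction i using Fin.lastCases with
    | last =>
      simp only [Fin.snoc_last, Pi.smul_apply, smul_eq_mul]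
      exact hμs
    | cast i =>
      simp only [Fin.snoc_castSucc, Pi.smul_apply, smul_eq_mul]
      rw [hμs]
      ring

attribute [irreducible] boxDef boxTime sph lidMap lidInv

end CubeGeom

/-! ## Lifting properties of functions -/

namespace CubeGeom

open Pseudotopology

/-- A point lies on the boundary of the cube. -/
abbrev OnBd {n : ℕ} (x : Cube n) : Prop := ∃ i, x i = 0 ∨ x i = 1

/-- Append a coordinate. -/
def snoc {n : ℕ} (z : Cube n × unitInterval) : Cube (n + 1) :=
  Fin.snoc (α := fun _ => unitInterval) z.1 z.2

/-- Split off the last coordinate. -/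
def unsnoc {n : ℕ} (x : Cube (n + 1)) : Cube n × unitInterval :=
  (fun i => x i.castSucc, x (Fin.last n))

section Snoc

variable {n : ℕ}

@[simp]
theorem unsnoc_snoc (z : Cube n × unitInterval) : unsnoc (snoc z) = z := by
  refine Prod.ext (funext fun i => ?_) ?_ <;> simp [snoc, unsnoc]

@[simp]
theorem snoc_unsnoc (x : Cube (n + 1)) : snoc (unsnoc x) = x := by
  funext i
  induction i using Fin.lastCases <;> simp [snoc, unsnoc]

@[fun_prop]
theorem continuous_snoc : Continuous (snoc : Cube n × unitInterval → Cube (n + 1)) := by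
  unfold snoc; fun_prop

@[fun_prop]
theorem continuous_unsnoc : Continuous (unsnoc : Cube (n + 1) → Cube n × unitInterval) := by
  unfold unsnoc; fun_prop

@[fun_prop]
theorem pcont_snoc : PCont (snoc : Cube n × unitInterval → Cube (n + 1)) :=
  .of_continuous continuous_snoc

@[fun_prop]
theorem pcont_unsnoc : PCont (unsnoc : Cube (n + 1) → Cube n × unitInterval) :=
  .of_continuous continuous_unsnoc

@[fun_prop]
theorem pcont_symm : PCont unitInterval.symm := .of_continuous unitInterval.continuous_symm

theorem onBd_iff (x : Cube (n + 1)) :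
    OnBd x ↔ OnBd (unsnoc x).1 ∨ (unsnoc x).2 = 0 ∨ (unsnoc x).2 = 1 := by
  simp only [OnBd, Fin.exists_fin_succ', unsnoc]

theorem onBd_snoc (z : Cube n × unitInterval) :
    OnBd (snoc z) ↔ OnBd z.1 ∨ z.2 = 0 ∨ z.2 = 1 := by
  rw [onBd_iff, unsnoc_snoc]

theorem unsnoc_eq {x : Cube (n + 1)} {t : unitInterval} (h : (unsnoc x).2 = t) :
    ((unsnoc x).1, t) = unsnoc x := by
  rw [← h]

attribute [irreducible] snoc unsnoc

end Snoc

/-! ### Products of cubes -/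

/-- Spaces homeomorphic to a cube. -/
class IsCube (T : Type) [TopologicalSpace T] : Prop where
  exists_homeo : ∃ n, Nonempty (T ≃ₜ Cube n)

instance (n : ℕ) : IsCube (Cube n) := ⟨n, ⟨Homeomorph.refl _⟩⟩

instance : IsCube PUnit.{1} :=
  ⟨0, ⟨{ toFun := fun _ i => i.elim0
         invFun := fun _ => PUnit.unit
         left_inv := fun _ => rfl
         right_inv := fun _ => funext fun i => i.elim0 }⟩⟩

instance : IsCube unitInterval := ⟨1, ⟨(Homeomorph.funUnique (Fin 1) unitInterval).symm⟩⟩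

/-- The homeomorphism `I^m × I^n ≃ I^(m+n)`. -/
def prodHomeo (m n : ℕ) : (Cube m × Cube n) ≃ₜ Cube (m + n) :=
  Homeomorph.sumArrowHomeomorphProdArrow.symm.trans
    (Homeomorph.piCongrLeft (Y := fun _ => unitInterval) finSumFinEquiv)

theorem prodHomeo_castAdd {m n : ℕ} (z : Cube m × Cube n) (i : Fin m) :
    prodHomeo m n z (Fin.castAdd n i) = z.1 i := by
  have := Equiv.piCongrLeft_apply_apply (fun _ => unitInterval) (finSumFinEquiv (m := m) (n := n))
    (Sum.elim z.1 z.2) (Sum.inl i)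
  rw [finSumFinEquiv_apply_left] at this
  exact this

theorem prodHomeo_natAdd {m n : ℕ} (z : Cube m × Cube n) (i : Fin n) :
    prodHomeo m n z (Fin.natAdd m i) = z.2 i := by
  have := Equiv.piCongrLeft_apply_apply (fun _ => unitInterval) (finSumFinEquiv (m := m) (n := n))
    (Sum.elim z.1 z.2) (Sum.inr i)
  rw [finSumFinEquiv_apply_right] at this
  exact this

theorem onBd_prodHomeo {m n : ℕ} (z : Cube m × Cube n) :
    OnBd (prodHomeo m n z) ↔ OnBd z.1 ∨ OnBd z.2 := by
  constructor
  · rintro ⟨i, hi⟩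
    induction i using Fin.addCases with
    | left i => exact Or.inl ⟨i, by rwa [prodHomeo_castAdd] at hi⟩
    | right i => exact Or.inr ⟨i, by rwa [prodHomeo_natAdd] at hi⟩
  · rintro (⟨i, hi⟩ | ⟨i, hi⟩)
    · exact ⟨_, by rwa [← prodHomeo_castAdd z i] at hi⟩
    · exact ⟨_, by rwa [← prodHomeo_natAdd z i] at hi⟩

instance {S T : Type} [TopologicalSpace S] [TopologicalSpace T] [hS : IsCube S] [hT : IsCube T] :
    IsCube (S × T) := by
  obtain ⟨m, ⟨e⟩⟩ := hS
  obtain ⟨n, ⟨e'⟩⟩ := hT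
  exact ⟨m + n, ⟨(e.prodCongr e').trans (prodHomeo m n)⟩⟩

instance : Pseudotopology PUnit.{1} where
  ulim _ := Set.univ
  mem_ulim_pure _ := trivial

instance : IsTopological PUnit.{1} where
  mem_ulim_iff U x := by
    refine ⟨fun _ => ?_, fun _ => trivial⟩
    rw [nhds_discrete, Filter.le_pure_iff]
    have : ({x} : Set PUnit.{1}) = Set.univ := Set.eq_univ_of_forall fun y => rfl
    rw [this]
    exact Filter.univ_mem

/-! ### Lifting properties -/

section Defs

variable {X Y Z : Type*} [Pseudotopology X] [Pseudotopology Y] [Pseudotopology Z]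

/-- Right lifting property against `∂I^n → I^n`. -/
def RLPI (f : X → Y) : Prop :=
  ∀ (n : ℕ) (p : Bd n → X) (q : Cube n → Y), PCont p → PCont q → (∀ z, f (p z) = q z.1) →
    ∃ h : Cube n → X, PCont h ∧ (∀ z : Bd n, h z.1 = p z) ∧ ∀ z, f (h z) = q z

/-- Right lifting property against `I^n × 0 → I^n × I`. -/
def RLPJ (f : X → Y) : Prop :=
  ∀ (n : ℕ) (p : Cube n → X) (q : Cube n × unitInterval → Y), PCont p → PCont q →
    (∀ z, f (p z) = q (z, 0)) →
    ∃ h : Cube n × unitInterval → X, PCont h ∧ (∀ z, h (z, 0) = p z) ∧ ∀ z, f (h z) = q z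

/-- Homotopy of maps on a cube, relative to the boundary. -/
def HRel {n : ℕ} (f g : Cube n → Z) : Prop :=
  ∃ H : Cube n × unitInterval → Z, PCont H ∧ (∀ z, H (z, 0) = f z) ∧ (∀ z, H (z, 1) = g z) ∧
    ∀ z t, OnBd z → H (z, t) = f z

/-- Weak right lifting property against `∂I^n → I^n`. -/
def WRLP (f : X → Y) : Prop :=
  ∀ (n : ℕ) (p : Bd n → X) (q : Cube n → Y), PCont p → PCont q → (∀ z, f (p z) = q z.1) →
    ∃ h : Cube n → X, PCont h ∧ (∀ z : Bd n, h z.1 = p z) ∧ HRel (fun z => f (h z)) q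

end Defs

/-! ### Box lifting, homotopy extension and relative homotopy. -/

section Lifting

variable {X Y Z : Type*} [Pseudotopology X] [Pseudotopology Y] [Pseudotopology Z]
  {T : Type} [TopologicalSpace T] [Pseudotopology T] [IsTopological T]

theorem RLPJ.exists_lift [hT : IsCube T] {f : X → Y} (hf : RLPJ f) {p : T → X}
    {q : T × unitInterval → Y} (hp : PCont p) (hq : PCont q) (h : ∀ z, f (p z) = q (z, 0)) :
    ∃ h : T × unitInterval → X, PCont h ∧ (∀ z, h (z, 0) = p z) ∧ ∀ z, f (h z) = q z := by
  obtain ⟨n, ⟨e⟩⟩ := hT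
  have he : PCont e := .of_continuous e.continuous
  have he' : PCont e.symm := .of_continuous e.symm.continuous
  obtain ⟨H, hH, h1, h2⟩ := hf n (fun z => p (e.symm z)) (fun z => q (e.symm z.1, z.2))
    (by fun_prop) (by fun_prop) (fun z => h _)
  exact ⟨fun z => H (e z.1, z.2), by fun_prop, fun z => by simp [h1], fun z => by simp [h2]⟩

@[fun_prop]
theorem pcont_boxDef {n : ℕ} : PCont (boxDef (n := n)) := .of_continuous continuous_boxDef

theorem pclosed_onBd {n : ℕ} : PClosed {x : Cube n | OnBd x} := .of_isClosed isClosed_bd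

theorem pclosed_singleton (t : unitInterval) : PClosed {s : unitInterval | s = t} :=
  .of_isClosed isClosed_singleton

/-- Lifting against the inclusion of an open box, with a parameter in a cube. -/
theorem RLPJ.exists_box_lift [IsCube T] {f : X → Y} (hf : RLPJ f) {n : ℕ}
    {p : Cube n × T → X} {b : (Bd n × T) × unitInterval → X} {q : (Cube n × T) × unitInterval → Y}
    (hp : PCont p) (hb : PCont b) (hq : PCont q)
    (hbp : ∀ z τ, b ((z, τ), 0) = p (z.1, τ)) (hpq : ∀ z, f (p z) = q (z, 0))
    (hbq : ∀ z τ t, f (b ((z, τ), t)) = q ((z.1, τ), t)) :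
    ∃ h : (Cube n × T) × unitInterval → X, PCont h ∧ (∀ z, h (z, 0) = p z) ∧
      (∀ (z : Bd n) τ t, h ((z.1, τ), t) = b ((z, τ), t)) ∧ ∀ z, f (h z) = q z := by
  let R : (Cube n × T) × unitInterval → Prop := fun w => OnBd w.1.1 ∨ w.2 = 0
  let D : ((Cube n × T) × unitInterval) × unitInterval → (Cube n × T) × unitInterval := fun w =>
    (((boxDef ((w.1.1.1, w.1.2), w.2)).1, w.1.1.2), (boxDef ((w.1.1.1, w.1.2), w.2)).2)
  have hD : PCont D := by unfold D; fun_prop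
  have hR : ∀ w, R (D (w, 0)) := fun w => boxDef_zero_mem (w.1.1, w.2)
  have hDt : ∀ w : (Cube n × T) × unitInterval, D (w, boxTime (w.1.1, w.2)) = w := fun w => by
    have := boxDef_time (w.1.1, w.2)
    simp [D, this]
  obtain ⟨g, hg, g1, g2⟩ := exists_glue (A := {w // R w}) (P := fun w => OnBd w.1.1.1)
    (Q := fun w => w.1.2 = 0)
    (F := fun w => b ((⟨w.1.1.1.1, w.2⟩, w.1.1.1.2), w.1.1.2)) (G := fun w => p w.1.1.1)
    (pclosed_onBd.preimage (f := fun w : {w // R w} => w.1.1.1) (by fun_prop))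
    ((pclosed_singleton 0).preimage (f := fun w : {w // R w} => w.1.2) (by fun_prop))
    (fun w => w.2) (by fun_prop) (by fun_prop)
    (fun w h1 h2 => by
      dsimp only at h2 ⊢
      rw [h2, hbp])
  have hgq : ∀ w, f (g w) = q w.1 := by
    rintro ⟨w, h | h⟩
    · rw [g1 _ h, hbq]
    · rw [g2 _ h, hpq]
      dsimp only
      rw [← h]
  -- The open box inclusion is handled as a retract of the inclusion of one end of a cylinder. The
  -- homotopy `q ∘ D` starts inside the open box, where a lift `g` is given, so it lifts to `Q`.
  -- Restriction to the graph of `boxTime` gives a lift of `q`, since `D` is the identity there, and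
  -- recovers `g` on the open box, where the time is `0`.
  obtain ⟨Q, hQ, Q1, Q2⟩ := hf.exists_lift (p := fun w => g ⟨D (w, 0), hR w⟩)
    (q := fun w => q (D w)) (by fun_prop) (by fun_prop) (fun w => hgq _)
  have hT : PCont (fun w : (Cube n × T) × unitInterval => boxTime (w.1.1, w.2)) :=
    .of_continuous (by fun_prop)
  have key : ∀ w (hw : R w), Q (w, boxTime (w.1.1, w.2)) = g ⟨w, hw⟩ := fun w hw => by
    have h0 := boxTime_eq_zero (z := (w.1.1, w.2)) hw
    rw [h0, Q1]
    congr 1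
    have := hDt w
    rw [h0] at this
    exact Subtype.ext this
  refine ⟨fun w => Q (w, boxTime (w.1.1, w.2)), by fun_prop, fun z => ?_, fun z τ t => ?_,
    fun w => ?_⟩
  · exact (key (z, 0) (Or.inr rfl)).trans (g2 _ rfl)
  · exact (key _ (Or.inl z.2)).trans (g1 _ z.2)
  · rw [Q2, hDt]

/-- Constant homotopies serve as lifts. Thus every space is fibrant, and box lifting over a point
becomes box filling. -/
theorem rlpj_to_punit : RLPJ (fun _ : X => PUnit.unit.{1}) := fun n p q hp _ _ =>
  ⟨fun z => p z.1, by fun_prop, fun _ => rfl, fun _ => rfl⟩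

/-- The homotopy extension property of the boundary of a cube. -/
theorem exists_box_fill [IsCube T] {n : ℕ} {p : Cube n × T → X} {b : (Bd n × T) × unitInterval → X}
    (hp : PCont p) (hb : PCont b) (hbp : ∀ z τ, b ((z, τ), 0) = p (z.1, τ)) :
    ∃ h : (Cube n × T) × unitInterval → X, PCont h ∧ (∀ z, h (z, 0) = p z) ∧
      (∀ (z : Bd n) τ t, h ((z.1, τ), t) = b ((z, τ), t)) := by
  obtain ⟨h, h0, h1, h2, -⟩ := rlpj_to_punit.exists_box_lift (q := fun _ => PUnit.unit) hp hb
    (by fun_prop) hbp (fun _ => rfl) (fun _ _ _ => rfl)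
  exact ⟨h, h0, h1, h2⟩

theorem exists_homotopy_extension {n : ℕ} {p : Cube n → X} {b : Bd n × unitInterval → X}
    (hp : PCont p) (hb : PCont b) (hbp : ∀ z, b (z, 0) = p z.1) :
    ∃ h : Cube n × unitInterval → X, PCont h ∧ (∀ z, h (z, 0) = p z) ∧
      (∀ (z : Bd n) t, h (z.1, t) = b (z, t)) := by
  obtain ⟨h, h0, h1, h2⟩ := exists_box_fill (T := PUnit.{1}) (p := fun z => p z.1)
    (b := fun z => b (z.1.1, z.2)) (by fun_prop) (by fun_prop) (fun z _ => hbp z)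
  exact ⟨fun z => h ((z.1, PUnit.unit), z.2), by fun_prop, fun z => h1 _, fun z t => h2 _ _ _⟩

theorem exists_homotopy_extension' {n : ℕ} {p : Cube n → X} {b : Bd n × unitInterval → X}
    (hp : PCont p) (hb : PCont b) (hbp : ∀ z, b (z, 1) = p z.1) :
    ∃ h : Cube n × unitInterval → X, PCont h ∧ (∀ z, h (z, 1) = p z) ∧
      (∀ (z : Bd n) t, h (z.1, t) = b (z, t)) := by
  obtain ⟨h, h0, h1, h2⟩ := exists_homotopy_extension (p := p)
    (b := fun z => b (z.1, unitInterval.symm z.2)) hp (by fun_prop) (by simpa using hbp)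
  exact ⟨fun z => h (z.1, unitInterval.symm z.2), by fun_prop, fun z => by simp [h1],
    fun z t => by simp [h2]⟩

/-- Maps on the bottom, the lid and the walls of a cube can be glued to a map on its boundary. -/
theorem exists_bd_glue {S : Type*} [Pseudotopology S] {n : ℕ} {c d : Cube n × S → X}
    {b : (Bd n × unitInterval) × S → X} (hc : PCont c) (hd : PCont d) (hb : PCont b)
    (h0 : ∀ z τ, b ((z, 0), τ) = c (z.1, τ)) (h1 : ∀ z τ, b ((z, 1), τ) = d (z.1, τ)) :
    ∃ p : Bd (n + 1) × S → X, PCont p ∧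
      (∀ w τ, (unsnoc w.1).2 = 0 → p (w, τ) = c ((unsnoc w.1).1, τ)) ∧
      (∀ w τ, (unsnoc w.1).2 = 1 → p (w, τ) = d ((unsnoc w.1).1, τ)) ∧
      (∀ w τ (h : OnBd (unsnoc w.1).1), p (w, τ) = b ((⟨_, h⟩, (unsnoc w.1).2), τ)) := by
  obtain ⟨g, hg, g1, g2⟩ := exists_glue
    (A := {w : Bd (n + 1) × S // (unsnoc w.1.1).2 = 0 ∨ (unsnoc w.1.1).2 = 1})
    (P := fun w => (unsnoc w.1.1.1).2 = 0) (Q := fun w => (unsnoc w.1.1.1).2 = 1)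
    (F := fun w => c ((unsnoc w.1.1.1.1).1, w.1.1.2))
    (G := fun w => d ((unsnoc w.1.1.1.1).1, w.1.1.2))
    ((pclosed_singleton 0).preimage (f := fun w : {w : Bd (n + 1) × S //
      (unsnoc w.1.1).2 = 0 ∨ (unsnoc w.1.1).2 = 1} => (unsnoc w.1.1.1).2) (by fun_prop))
    ((pclosed_singleton 1).preimage (f := fun w : {w : Bd (n + 1) × S //
      (unsnoc w.1.1).2 = 0 ∨ (unsnoc w.1.1).2 = 1} => (unsnoc w.1.1.1).2) (by fun_prop))
    (fun w => w.2) (by fun_prop) (by fun_prop)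
    (fun w e0 e1 => absurd (e0.symm.trans e1) zero_ne_one)
  obtain ⟨p, hp, p1, p2⟩ := exists_glue (A := Bd (n + 1) × S)
    (P := fun w => (unsnoc w.1.1).2 = 0 ∨ (unsnoc w.1.1).2 = 1)
    (Q := fun w => OnBd (unsnoc w.1.1).1) (F := g)
    (G := fun w => b ((⟨_, w.2⟩, (unsnoc w.1.1.1).2), w.1.2))
    (((pclosed_singleton 0).union (pclosed_singleton 1)).preimage
      (f := fun w : Bd (n + 1) × S => (unsnoc w.1.1).2) (by fun_prop))
    (pclosed_onBd.preimage (f := fun w : Bd (n + 1) × S => (unsnoc w.1.1).1) (by fun_prop))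
    (fun w => ((onBd_iff _).1 w.1.2).symm) hg (by fun_prop)
    (by
      rintro ⟨w, τ⟩ (e | e) h
      · rw [g1 _ e]
        dsimp only at e ⊢
        rw [e, h0]
      · rw [g2 _ e]
        dsimp only at e ⊢
        rw [e, h1])
  refine ⟨p, hp, fun w τ e => ?_, fun w τ e => ?_, fun w τ h => p2 (w, τ) h⟩
  · rw [p1 (w, τ) (Or.inl e)]
    exact g1 ⟨(w, τ), _⟩ e
  · rw [p1 (w, τ) (Or.inr e)]
    exact g2 ⟨(w, τ), _⟩ e

/-- Homotopy extension for the boundary of `I^n × I`. -/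
theorem exists_cylinder_fill {n : ℕ} {a : Cube n × unitInterval → X}
    {c d : Cube n × unitInterval → X} {b : (Bd n × unitInterval) × unitInterval → X}
    (ha : PCont a) (hc : PCont c) (hd : PCont d) (hb : PCont b)
    (h0 : ∀ z t, b ((z, 0), t) = c (z.1, t)) (h1 : ∀ z t, b ((z, 1), t) = d (z.1, t))
    (hc0 : ∀ z, c (z, 0) = a (z, 0)) (hd0 : ∀ z, d (z, 0) = a (z, 1))
    (hb0 : ∀ z s, b ((z, s), 0) = a (z.1, s)) :
    ∃ h : Cube n × unitInterval → X, PCont h ∧ (∀ z, h (z, 0) = c (z, 1)) ∧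
      (∀ z, h (z, 1) = d (z, 1)) ∧ ∀ (z : Bd n) s, h (z.1, s) = b ((z, s), 1) := by
  obtain ⟨p, hp, p0, p1, pb⟩ := exists_bd_glue hc hd hb h0 h1
  obtain ⟨h, hh, e0, eb⟩ := exists_homotopy_extension (p := fun x => a (unsnoc x)) (b := p)
    (by fun_prop) hp (fun w => by
      rcases (onBd_iff _).1 w.2 with h | h | h
      · rw [pb w 0 h, hb0]
      · rw [p0 w 0 h, hc0, unsnoc_eq h]
      · rw [p1 w 0 h, hd0, unsnoc_eq h])
  refine ⟨fun z => h (snoc z, 1), by fun_prop, fun z => ?_, fun z => ?_, fun z s => ?_⟩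
  · refine (eb ⟨snoc (z, 0), (onBd_snoc _).2 (Or.inr (Or.inl rfl))⟩ 1).trans ?_
    rw [p0 _ _ (by simp)]
    simp
  · refine (eb ⟨snoc (z, 1), (onBd_snoc _).2 (Or.inr (Or.inr rfl))⟩ 1).trans ?_
    rw [p1 _ _ (by simp)]
    simp
  · refine (eb ⟨snoc (z.1, s), (onBd_snoc _).2 (Or.inl z.2)⟩ 1).trans ?_
    rw [pb _ _ (by simpa using z.2)]
    simp

/-! ### Relative homotopy -/

variable {n : ℕ}

theorem HRel.refl {f : Cube n → X} (hf : PCont f) : HRel f f :=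
  ⟨fun z => f z.1, by fun_prop, fun _ => rfl, fun _ => rfl, fun _ _ _ => rfl⟩

theorem HRel.symm {f g : Cube n → X} : HRel f g → HRel g f := by
  rintro ⟨H, hH, h0, h1, h2⟩
  refine ⟨fun z => H (z.1, unitInterval.symm z.2), by fun_prop, fun z => by simp [h1],
    fun z => by simp [h0], fun z t hz => ?_⟩
  dsimp only
  rw [h2 z _ hz, ← h1, h2 z _ hz]

theorem HRel.left {f g : Cube n → X} : HRel f g → PCont f := by
  rintro ⟨H, hH, h0, -⟩
  have : f = fun z => H (z, 0) := funext fun z => (h0 z).symm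
  rw [this]
  fun_prop

theorem HRel.right {f g : Cube n → X} (h : HRel f g) : PCont g := h.symm.left

theorem HRel.eq_of_onBd {f g : Cube n → X} : HRel f g → ∀ z, OnBd z → f z = g z := by
  rintro ⟨H, -, -, h1, h2⟩ z hz
  rw [← h1, h2 z _ hz]

theorem HRel.comp {f g : Cube n → X} (h : HRel f g) {k : X → Y} (hk : PCont k) :
    HRel (fun z => k (f z)) (fun z => k (g z)) := by
  obtain ⟨H, hH, h0, h1, h2⟩ := h
  exact ⟨fun z => k (H z), by fun_prop, fun z => by simp only [h0], fun z => by simp only [h1],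
    fun z t hz => by simp only [h2 z t hz]⟩

/-- Two homotopies that agree on the boundary: if their ends are homotopic relative to the
boundary, then so are their starts. -/
theorem hrel_start {G H : Cube n × unitInterval → X} (hG : PCont G) (hH : PCont H)
    (hGH : ∀ (z : Bd n) t, G (z.1, t) = H (z.1, t))
    (h : HRel (fun z => G (z, 1)) (fun z => H (z, 1))) :
    HRel (fun z => G (z, 0)) (fun z => H (z, 0)) := by
  obtain ⟨M, hM, h0, h1, h2⟩ := h
  -- The prism has the given homotopy `M` of the ends as base, and `G`, `H` run backwards as
  -- opposite faces. The common boundary values fill the other walls, so the top face is a homotopy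
  -- of the starts.
  obtain ⟨F, hF, F0, F1, F2⟩ := exists_cylinder_fill (a := M)
    (c := fun z => G (z.1, unitInterval.symm z.2)) (d := fun z => H (z.1, unitInterval.symm z.2))
    (b := fun z => G (z.1.1.1, unitInterval.symm z.2)) hM (by fun_prop) (by fun_prop)
    (by fun_prop) (fun _ _ => rfl) (fun _ _ => hGH _ _) (fun z => by simp [h0])
    (fun z => by simp [h1]) (fun z s => by simp [h2 _ _ z.2])
  exact ⟨F, hF, by simpa using F0, by simpa using F1, fun z t hz => by simpa using F2 ⟨z, hz⟩ t⟩

/-- No concatenation is needed: `f` is the start of a homotopy ending at `g`, and `k` is the start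
of the constant one, so `hrel_start` applies. -/
theorem HRel.trans {f g k : Cube n → X} (h1 : HRel f g) (h2 : HRel g k) : HRel f k := by
  have hk := h2.right
  obtain ⟨H, hH, e0, e1, e2⟩ := h1
  have := hrel_start (G := H) (H := fun z => k z.1) hH (by fun_prop)
    (fun z t => by
      have := (show HRel f g from ⟨H, hH, e0, e1, e2⟩).eq_of_onBd _ z.2
      rw [e2 _ _ z.2, this, h2.eq_of_onBd _ z.2])
    (by simpa only [e1] using h2)
  simpa only [e0] using this

/-- The start of a homotopy may be replaced by a map homotopic to it relative to the boundary. -/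
theorem exists_change_start {A : Cube n × unitInterval → X} {a : Cube n → X} (hA : PCont A)
    (h : HRel a (fun z => A (z, 0))) :
    ∃ B : Cube n × unitInterval → X, PCont B ∧ (∀ z, B (z, 0) = a z) ∧
      (∀ z, B (z, 1) = A (z, 1)) ∧ ∀ (z : Bd n) t, B (z.1, t) = A (z.1, t) := by
  obtain ⟨M, hM, h0, h1, h2⟩ := h.symm
  exact (exists_cylinder_fill (a := A) (c := M) (d := fun z => A (z.1, 1))
    (b := fun z => A (z.1.1.1, z.1.2)) hA hM (by fun_prop) (by fun_prop)
    (fun z t => (h2 _ _ z.2).symm) (fun _ _ => rfl) h0 (fun _ => rfl) (fun _ _ => rfl)).imp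
      fun B hB => ⟨hB.1, fun z => by rw [hB.2.1, h1], hB.2.2.1, hB.2.2.2⟩

/-- Weak lifts can be transported along homotopies of lifting problems. -/
theorem exists_weak_lift_transport {f : X → Y} (hf : PCont f) {K : Bd n × unitInterval → X}
    {L : Cube n × unitInterval → Y} (hK : PCont K) (hL : PCont L)
    (hKL : ∀ z t, f (K (z, t)) = L (z.1, t)) {h' : Cube n → X} (hh' : PCont h')
    (e : ∀ z, h' z.1 = K (z, 1)) (hr : HRel (fun z => f (h' z)) (fun z => L (z, 1))) :
    ∃ h : Cube n → X, PCont h ∧ (∀ z : Bd n, h z.1 = K (z, 0)) ∧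
      HRel (fun z => f (h z)) (fun z => L (z, 0)) := by
  obtain ⟨G, hG, G1, Gb⟩ := exists_homotopy_extension' hh' hK (fun z => (e z).symm)
  refine ⟨fun z => G (z, 0), by fun_prop, fun z => Gb z 0, ?_⟩
  refine hrel_start (G := fun z => f (G z)) (by fun_prop) hL
    (fun z t => by rw [Gb, hKL]) ?_
  simpa only [G1] using hr

end Lifting

/-! ### Weak equivalences -/

section Weak

variable {X Y Z : Type*} [Pseudotopology X] [Pseudotopology Y] [Pseudotopology Z]

/-- The homotopy from `f h` to `q` is stationary on the boundary. Lift it with start `h` and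
constant boundary values; the end of the lift is a strict solution. -/
theorem WRLP.rlpi {f : X → Y} (hf : WRLP f) (hJ : RLPJ f) : RLPI f := by
  intro n p q hp hq hpq
  obtain ⟨h, hh, h1, H, hH, H0, H1, H2⟩ := hf n p q hp hq hpq
  obtain ⟨F, hF, F0, Fb, Fq⟩ := hJ.exists_box_lift (T := PUnit.{1}) (p := fun z => h z.1)
    (b := fun z => p z.1.1) (q := fun z => H (z.1.1, z.2)) (by fun_prop) (by fun_prop)
    (by fun_prop) (fun z _ => (h1 z).symm) (fun z => (H0 z.1).symm)
    (fun z _ t => by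
      simp only [H2 _ _ z.2, h1])
  exact ⟨fun z => F ((z, PUnit.unit), 1), by fun_prop, fun z => Fb z _ _,
    fun z => by rw [Fq, H1]⟩

theorem RLPI.wrlp {f : X → Y} (h : RLPI f) : WRLP f := by
  intro n p q hp hq hpq
  obtain ⟨F, hF, h1, h2⟩ := h n p q hp hq hpq
  refine ⟨F, hF, h1, ?_⟩
  simp only [h2]
  exact HRel.refl hq

theorem pcont_lidMap {n : ℕ} : PCont (lidMap (n := n)) := .of_continuous continuous_lidMap

theorem pcont_lidInv {n : ℕ} : PCont (lidInv (n := n)) := .of_continuous continuous_lidInv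

/-- Geometrically, `I^n × I` arises from its bottom by attaching two cells: lid and walls together
form an `n`-cell glued along the rim of the bottom, and the interior is an `(n + 1)`-cell. Each is
one lifting problem. -/
theorem RLPI.rlpj {f : X → Y} (h : RLPI f) : RLPJ f := by
  intro n p q hp hq hpq
  have e1 := pcont_lidMap (n := n)
  have e2 := pcont_lidInv (n := n)
  -- First cell: the lift over lid and walls, parametrized by `lidMap`, which sends the boundary of
  -- the cube to the rim of the bottom.
  obtain ⟨k, hk, k1, k2⟩ := h n (fun z => p z.1) (fun z => q (lidMap z)) (by fun_prop)
    (by fun_prop) (fun z => by rw [hpq, lidMap_of_bd z.2])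
  obtain ⟨g, hg, g1, g2⟩ := exists_glue (A := Bd (n + 1)) (P := fun w => (unsnoc w.1).2 = 0)
    (Q := fun w => OnBd (unsnoc w.1).1 ∨ (unsnoc w.1).2 = 1)
    (F := fun w => p (unsnoc w.1.1).1) (G := fun w => k (lidInv (unsnoc w.1.1)))
    ((pclosed_singleton 0).preimage (f := fun w : Bd (n + 1) => (unsnoc w.1).2) (by fun_prop))
    ((pclosed_onBd.preimage (f := fun w : Bd (n + 1) => (unsnoc w.1).1) (by fun_prop)).union
      ((pclosed_singleton 1).preimage (f := fun w : Bd (n + 1) => (unsnoc w.1).2) (by fun_prop)))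
    (fun w => by
      rcases (onBd_iff _).1 w.2 with h | h | h
      exacts [Or.inr (Or.inl h), Or.inl h, Or.inr (Or.inr h)])
    (by fun_prop) (by fun_prop)
    (by
      rintro w h0 (h | h)
      · have : lidInv (unsnoc w.1) = (unsnoc w.1).1 := by
          rw [← unsnoc_eq h0, lidInv_zero]
        dsimp only
        rw [this]
        exact (k1 ⟨_, h⟩).symm
      · exact absurd (h0.symm.trans h) zero_ne_one)
  -- Second cell: bottom, lid and walls together prescribe the lift on the boundary of `I^(n+1)`.
  obtain ⟨F, hF, F1, F2⟩ := h (n + 1) g (fun x => q (unsnoc x)) hg (by fun_prop) (fun w => by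
    have : (unsnoc w.1).2 = 0 ∨ (OnBd (unsnoc w.1).1 ∨ (unsnoc w.1).2 = 1) := by
      rcases (onBd_iff _).1 w.2 with h | h | h
      exacts [Or.inr (Or.inl h), Or.inl h, Or.inr (Or.inr h)]
    rcases this with h | h
    · rw [g1 _ h, hpq, unsnoc_eq h]
    · rw [g2 _ h, k2, lidMap_lidInv h])
  refine ⟨fun z => F (snoc z), by fun_prop, fun z => ?_, fun z => by simp [F2]⟩
  have := F1 ⟨snoc (z, 0), (onBd_snoc _).2 (Or.inr (Or.inl rfl))⟩
  dsimp only at this ⊢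
  rw [this, g1 _ (by simp)]
  simp

theorem WRLP.comp {f : X → Y} {g : Y → Z} (hg : WRLP g) (hf : WRLP f) (cf : PCont f)
    (cg : PCont g) : WRLP (fun x => g (f x)) := by
  intro n p q hp hq hpq
  obtain ⟨h, hh, h1, h2⟩ := hg n (fun z => f (p z)) q (by fun_prop) hq hpq
  obtain ⟨k, hk, k1, k2⟩ := hf n p h hp hh (fun z => (h1 z).symm)
  exact ⟨k, hk, k1, (k2.comp cg).trans h2⟩

/-- A map with the weak right lifting property reflects relative homotopy. -/
theorem WRLP.hrel_of_comp {f : X → Y} (hf : WRLP f) {n : ℕ} {a b : Cube n → X} (ha : PCont a)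
    (hb : PCont b) (hab : ∀ z : Bd n, a z.1 = b z.1)
    (h : HRel (fun z => f (a z)) (fun z => f (b z))) : HRel a b := by
  obtain ⟨H, hH, h0, h1, h2⟩ := h
  -- A relative homotopy from `a` to `b` is a filler for the map on `∂I^(n+1)` made of `a`, `b` and
  -- their common values on the walls. Its image under `f` is filled by `H`, and only the strict
  -- upper triangle of the weak lift matters.
  obtain ⟨p, hp, p0, p1, pb⟩ := exists_bd_glue (S := PUnit.{1}) (c := fun z => a z.1)
    (d := fun z => b z.1) (b := fun z => a z.1.1.1) (by fun_prop) (by fun_prop) (by fun_prop)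
    (fun _ _ => rfl) (fun z _ => hab z)
  obtain ⟨F, hF, F1, -⟩ := hf (n + 1) (fun w => p (w, PUnit.unit)) (fun x => H (unsnoc x))
    (by fun_prop) (by fun_prop) (fun w => by
      rcases (onBd_iff _).1 w.2 with h | h | h
      · rw [pb _ _ h]
        exact (h2 _ _ h).symm
      · rw [p0 _ _ h, ← unsnoc_eq h, h0]
      · rw [p1 _ _ h, ← unsnoc_eq h, h1])
  refine ⟨fun z => F (snoc z), by fun_prop, fun z => ?_, fun z => ?_, fun z t hz => ?_⟩
  · have := F1 ⟨snoc (z, 0), (onBd_snoc _).2 (Or.inr (Or.inl rfl))⟩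
    dsimp only at this ⊢
    rw [this, p0 _ _ (by simp)]
    simp
  · have := F1 ⟨snoc (z, 1), (onBd_snoc _).2 (Or.inr (Or.inr rfl))⟩
    dsimp only at this ⊢
    rw [this, p1 _ _ (by simp)]
    simp
  · have := F1 ⟨snoc (z, t), (onBd_snoc _).2 (Or.inl hz)⟩
    dsimp only at this ⊢
    rw [this, pb _ _ (by simpa using hz)]
    simp

/-- A weak lift `k` through the composite has `f k` and `q` equal on the boundary and homotopic
after `g`; `g` reflects this homotopy. -/
theorem WRLP.of_comp {f : X → Y} {g : Y → Z} (hg : WRLP g) (hgf : WRLP (fun x => g (f x)))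
    (cf : PCont f) (cg : PCont g) : WRLP f := by
  intro n p q hp hq hpq
  obtain ⟨k, hk, k1, k2⟩ := hgf n p (fun z => g (q z)) hp (by fun_prop) (fun z => by simp only [hpq])
  exact ⟨k, hk, k1, hg.hrel_of_comp (by fun_prop) hq (fun z => by rw [k1, hpq]) k2⟩

/-! ### Spheres as collapsed cubes, and cancellation on the right. -/

@[fun_prop]
theorem pcont_sph {n : ℕ} : PCont (sph (n := n)) := .of_continuous continuous_sph

/-- A homotopy on a cube that on the boundary only depends on the parameter induces one on the
sphere obtained by collapsing the boundary. -/
theorem exists_sph_desc {S : Type*} [Pseudotopology S] {n : ℕ} {a : Cube n × S → X} {c : S → X}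
    (ha : PCont a) (hc : PCont c) (hac : ∀ (z : Bd n) τ, a (z.1, τ) = c τ) :
    ∃ p : Bd (n + 1) × S → X, PCont p ∧ (∀ z τ, p (sph z, τ) = a (z, τ)) ∧
      ∀ τ, p (vtx n, τ) = c τ := by
  -- The sphere is presented by the cube and the vertex. Stability of gluings under products allows
  -- the parameter space `S` to be arbitrary.
  have hg : IsGluing (sph (n := n)) (fun _ : PUnit.{1} => vtx n) :=
    IsGluing.of_compact continuous_sph continuous_const fun x => by
      rcases exists_sph_eq x with h | h
      exacts [Or.inl h, Or.inr ⟨PUnit.unit, h.symm⟩]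
  obtain ⟨d, hd, d1, d2⟩ := (hg.prod S).exists_desc (f := fun z => a (z.2, z.1))
    (g := fun z => c z.1) (by fun_prop) (by fun_prop)
    (by
      rintro ⟨τ, z⟩ ⟨τ', z'⟩ h
      obtain ⟨rfl, h⟩ := Prod.ext_iff.1 h
      rcases sph_inj h with h | ⟨h, h'⟩
      · dsimp only at h ⊢
        rw [h]
      · exact (hac ⟨_, h⟩ _).trans (hac ⟨_, h'⟩ _).symm)
    (by
      rintro ⟨τ, z⟩ ⟨τ', z'⟩ h
      obtain ⟨rfl, h⟩ := Prod.ext_iff.1 h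
      exact hac ⟨_, sph_eq_vtx h⟩ _)
    (by
      rintro ⟨τ, z⟩ ⟨τ', z'⟩ h
      obtain ⟨rfl, h⟩ := Prod.ext_iff.1 h
      rfl)
  exact ⟨fun z => d (z.2, z.1), by fun_prop, fun z τ => d1 (τ, z), fun τ => d2 (τ, PUnit.unit)⟩

/-- A map with the weak right lifting property also has it for spheres. -/
theorem WRLP.exists_lift_bd {f : X → Y} (hf : WRLP f) {n : ℕ} {p : Bd n → Y}
    (hp : PCont p) : ∃ (p' : Bd n → X) (K : Bd n × unitInterval → Y), PCont p' ∧ PCont K ∧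
      (∀ z, K (z, 0) = f (p' z)) ∧ ∀ z, K (z, 1) = p z := by
  cases n with
  | zero =>
    exact ⟨isEmptyElim, fun z => isEmptyElim z.1, fun _ z => isEmptyElim z,
      fun _ z => isEmptyElim z.1, isEmptyElim, isEmptyElim⟩
  | succ n =>
    -- The case `n = 0` of the hypothesis lifts the value at the vertex up to a path `γ`, which
    -- supplies a base point in `X`.
    obtain ⟨x, hx, -, γ, hγ, γ0, γ1, -⟩ := hf 0 isEmptyElim (fun _ => p (vtx n))
      (fun _ z => isEmptyElim z) (by fun_prop) isEmptyElim
    let o : Cube 0 := Fin.elim0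
    -- Drag `p ∘ sph` along `γ` to a map on the cube whose boundary value is `f` of the new base
    -- point; this map can be weakly lifted relative to its boundary.
    obtain ⟨A, hA, A1, Ab⟩ := exists_homotopy_extension' (p := fun z => p (sph z))
      (b := fun z : Bd n × unitInterval => γ (o, z.2)) (by fun_prop) (by fun_prop)
      (fun z => by rw [sph_of_bd z.2]; exact γ1 _)
    obtain ⟨β, hβ, β1, β2⟩ := hf n (fun _ => x o) (fun z => A (z, 0)) (by fun_prop)
      (by fun_prop) (fun z => by rw [Ab, γ0])
    -- The dragging homotopy is altered to start exactly at `f β`. Its boundary values still follow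
    -- `γ`, so both `β` and `B` descend to the sphere.
    obtain ⟨B, hB, B0, B1, Bb⟩ := exists_change_start hA β2
    obtain ⟨p', hp', p1, p2⟩ := exists_sph_desc (S := PUnit.{1}) (a := fun z => β z.1)
      (c := fun _ => x o) (by fun_prop) (by fun_prop) (fun z _ => β1 z)
    obtain ⟨K, hK, K1, K2⟩ := exists_sph_desc (a := B) (c := fun t => γ (o, t)) hB
      (by fun_prop) (fun z t => by rw [Bb, Ab])
    refine ⟨fun z => p' (z, PUnit.unit), K, by fun_prop, hK, fun z => ?_, fun z => ?_⟩
    · rcases exists_sph_eq z with ⟨z, rfl⟩ | rfl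
      · simp only [K1, B0, p1]
      · simp only [K2, p2, γ0]
    · rcases exists_sph_eq z with ⟨z, rfl⟩ | rfl
      · rw [K1, B1, A1]
      · rw [K2, γ1]

/-- Deform the lifting problem for `g` until its boundary map factors through `f`, which
`WRLP.exists_lift_bd` permits. Solve it through the composite and transport the weak lift back along
the deformation. -/
theorem WRLP.of_precomp {f : X → Y} {g : Y → Z} (hf : WRLP f) (hgf : WRLP (fun x => g (f x)))
    (cf : PCont f) (cg : PCont g) : WRLP g := by
  intro n p q hp hq hpq
  obtain ⟨p', K, hp', hK, K0, K1⟩ := hf.exists_lift_bd hp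
  obtain ⟨L, hL, L0, Lb⟩ := exists_homotopy_extension (p := q)
    (b := fun z => g (K (z.1, unitInterval.symm z.2))) hq (by fun_prop)
    (fun z => by simp [K1, hpq])
  obtain ⟨k, hk, k1, k2⟩ := hgf n p' (fun z => L (z, 1)) hp' (by fun_prop)
    (fun z => by simp [Lb, K0])
  obtain ⟨h, hh, h1, h2⟩ := exists_weak_lift_transport (f := g)
    (K := fun z => K (z.1, unitInterval.symm z.2)) cg (by fun_prop) hL (fun z t => (Lb z t).symm)
    (h' := fun z => f (k z)) (by fun_prop) (fun z => by simp [k1, K0]) k2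
  exact ⟨h, hh, fun z => by simp [h1, K1], by simpa only [L0] using h2⟩

/-! ### Comparison with homotopy groups. -/

/-- Surjectivity of the maps induced on homotopy groups, for representatives. -/
def PiSurj (f : X → Y) : Prop :=
  ∀ (n : ℕ) (x : X) (b : Cube n → Y), PCont b → (∀ z : Bd n, b z.1 = f x) →
    ∃ a : Cube n → X, PCont a ∧ (∀ z : Bd n, a z.1 = x) ∧ HRel (fun z => f (a z)) b

/-- Injectivity of the maps induced on homotopy groups, for representatives. -/
def PiInj (f : X → Y) : Prop :=
  ∀ (n : ℕ) (x : X) (a b : Cube n → X), PCont a → PCont b → (∀ z : Bd n, a z.1 = x) →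
    (∀ z : Bd n, b z.1 = x) → HRel (fun z => f (a z)) (fun z => f (b z)) → HRel a b

theorem WRLP.piSurj {f : X → Y} (hf : WRLP f) : PiSurj f := fun n x b hb h =>
  hf n (fun _ => x) b (by fun_prop) hb (fun z => (h z).symm)

theorem WRLP.piInj {f : X → Y} (hf : WRLP f) : PiInj f := fun _ _ _ _ ha hb h1 h2 h =>
  hf.hrel_of_comp ha hb (fun z => (h1 z).trans (h2 z).symm) h

theorem WRLP.nonempty {f : X → Y} (hf : WRLP f) : Nonempty Y → Nonempty X := by
  rintro ⟨y⟩
  obtain ⟨x, -⟩ := hf 0 isEmptyElim (fun _ => y) (fun _ z => isEmptyElim z) (by fun_prop)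
    isEmptyElim
  exact ⟨x Fin.elim0⟩

/-- The straight contraction of the cube to the vertex `(1, …, 1)`. -/
noncomputable def contract {n : ℕ} (z : Cube n × unitInterval) : Cube n :=
  fun i => clamp ((z.1 i : ℝ) + z.2 * (1 - z.1 i))

@[fun_prop]
theorem pcont_contract {n : ℕ} : PCont (contract (n := n)) :=
  .of_continuous (by unfold contract; fun_prop)

theorem contract_zero {n : ℕ} (z : Cube n) : contract (z, 0) = z := by
  funext i; simp [contract]

theorem contract_one {n : ℕ} (z : Cube n) : contract (z, 1) = fun _ => 1 := by
  funext i; simp [contract, clamp_one]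

theorem contract_vtx {n : ℕ} (t : unitInterval) : contract ((vtx n).1, t) = (vtx n).1 := by
  funext i; simp [contract, vtx, clamp_one]

attribute [irreducible] contract

/-- Given a problem on `∂I^(n+1) → I^(n+1)`, the boundary map is an element of `π_n(X)` based at its
value on the vertex. It becomes trivial in `Y` because `q` fills it, hence is trivial in `X` by
injectivity. Contracting it drags `q` to a map constant on the boundary, an element of `π_(n+1)(Y)`,
which lifts by surjectivity; the lift is transported back. -/
theorem wrlp_of_pi {f : X → Y} (cf : PCont f) (h0 : Nonempty Y → Nonempty X) (hs : PiSurj f)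
    (hi : PiInj f) : WRLP f := by
  intro n p q hp hq hpq
  cases n with
  | zero =>
    obtain ⟨x⟩ := h0 ⟨q Fin.elim0⟩
    obtain ⟨a, ha, -, h⟩ := hs 0 x q hq isEmptyElim
    exact ⟨a, ha, isEmptyElim, h⟩
  | succ n =>
    -- The null homotopy downstairs is `q` along the straight contraction of the cube. That
    -- contraction fixes the vertex, so the homotopy is relative to the collapsed boundary.
    obtain ⟨A, hA, A0, A1, Ab⟩ := hi n (p (vtx n)) (fun z => p (sph z)) (fun _ => p (vtx n))
      (by fun_prop) (by fun_prop) (fun z => by rw [sph_of_bd z.2]) (fun _ => rfl)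
      ⟨fun z => q (contract ((sph z.1).1, z.2)), by fun_prop,
        fun z => by dsimp only; rw [contract_zero, hpq],
        fun z => by dsimp only; rw [contract_one, hpq]; rfl,
        fun z t hz => by dsimp only; rw [sph_of_bd hz, contract_vtx, hpq]⟩
    obtain ⟨P, hP, P1, P2⟩ := exists_sph_desc (a := A) (c := fun _ => p (vtx n)) hA
      (by fun_prop) (fun z t => by simp only [Ab _ _ z.2, sph_of_bd z.2])
    have e0 : ∀ z, P (z, 0) = p z := fun z => by
      rcases exists_sph_eq z with ⟨z, rfl⟩ | rfl
      · rw [P1, A0]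
      · rw [P2]
    have e1 : ∀ z, P (z, 1) = p (vtx n) := fun z => by
      rcases exists_sph_eq z with ⟨z, rfl⟩ | rfl
      · rw [P1, A1]
      · rw [P2]
    obtain ⟨L, hL, L0, Lb⟩ := exists_homotopy_extension (p := q) (b := fun z => f (P z)) hq
      (by fun_prop) (fun z => by rw [e0, hpq])
    obtain ⟨k, hk, k1, k2⟩ := hs (n + 1) (p (vtx n)) (fun z => L (z, 1)) (by fun_prop)
      (fun z => by rw [Lb, e1])
    obtain ⟨h, hh, h1, h2⟩ := exists_weak_lift_transport cf hP hL (fun z t => (Lb z t).symm) hk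
      (fun z => by rw [k1, e1]) k2
    exact ⟨h, hh, fun z => by rw [h1, e0], by simpa only [L0] using h2⟩

end Weak

end CubeGeom

namespace Pseudotopology

/-! ## Function spaces -/

/-- The space of continuous maps. -/
def Exp (K Y : Type*) [Pseudotopology K] [Pseudotopology Y] : Type _ := {γ : K → Y // PCont γ}

section Exp

variable {K Y Z : Type*} [Pseudotopology K] [Pseudotopology Y] [Pseudotopology Z]

/-- Evaluation. -/
def Exp.eval (z : Exp K Y × K) : Y := z.1.1 z.2

/-- The pseudotopology of continuous convergence. -/
instance : Pseudotopology (Exp K Y) where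
  ulim Γ := {γ | ∀ (W : Ultrafilter (Exp K Y × K)) (k : K), W.map Prod.fst = Γ →
    k ∈ ulim (W.map Prod.snd) → γ.1 k ∈ ulim (W.map Exp.eval)}
  mem_ulim_pure γ W k hW hk := by
    -- Over the principal ultrafilter at `γ`, evaluation coincides `W`-almost everywhere with `γ`
    -- applied to the second coordinate.
    have h1 : W.map Exp.eval = (W.map Prod.snd).map γ.1 := by
      refine Ultrafilter.coe_injective ?_
      rw [Ultrafilter.coe_map, Ultrafilter.map_map, Ultrafilter.coe_map]
      refine Filter.map_congr ?_
      have h0 : {γ} ∈ W.map Prod.fst := by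
        rw [hW]
        exact Filter.singleton_mem_pure
      have h1 : Prod.fst ⁻¹' {γ} ∈ (W : Filter (Exp K Y × K)) := h0
      filter_upwards [h1] with z hz
      have hz : z.1 = γ := hz
      simp [Exp.eval, hz]
    rw [h1]
    exact γ.2 _ _ hk

@[fun_prop]
theorem Exp.pcont_eval : PCont (Exp.eval : Exp K Y × K → Y) := fun W z hz =>
  hz.1 W z.2 rfl hz.2

/-- The adjoint of a map on a product. -/
def Exp.curry (F : Z × K → Y) (hF : PCont F) (z : Z) : Exp K Y :=
  ⟨fun k => F (z, k), by fun_prop⟩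

theorem Exp.ext {γ δ : Exp K Y} (h : ∀ k, Exp.eval (γ, k) = Exp.eval (δ, k)) : γ = δ :=
  Subtype.ext (funext h)

-- To test continuous convergence, take an ultrafilter `W` on `Exp K Y × K` lying over the image of
-- `U`. It lifts to an ultrafilter on `Z × K` lying over `U`, and there the claim is continuity of
-- `F`.
@[fun_prop]
theorem Exp.pcont_curry (F : Z × K → Y) (hF : PCont F) : PCont (Exp.curry F hF) := by
  intro U z hz W k hW hk
  obtain ⟨V, hV1, hV2⟩ : ∃ V : Ultrafilter (Z × K),
      V.map (fun z => (Exp.curry F hF z.1, z.2)) = W ∧ V.map Prod.fst = U := by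
    have hne : Filter.NeBot (Filter.comap (fun z : Z × K => (Exp.curry F hF z.1, z.2))
        (W : Filter (Exp K Y × K)) ⊓ Filter.comap Prod.fst (U : Filter Z)) := by
      refine Filter.inf_neBot_iff.2 ?_
      rintro _ ⟨s, hs, hs'⟩ _ ⟨t, ht, ht'⟩
      have h1 : Prod.fst ⁻¹' (Exp.curry F hF '' t) ∈ W := by
        have : Exp.curry F hF '' t ∈ U.map (Exp.curry F hF) := Filter.image_mem_map ht
        rw [← hW] at this
        exact this
      obtain ⟨⟨_, k⟩, hy, b, hb, rfl⟩ := W.nonempty_of_mem (Filter.inter_mem hs h1)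
      exact ⟨(b, k), hs' hy, ht' hb⟩
    have h := Ultrafilter.of_le (Filter.comap (fun z : Z × K => (Exp.curry F hF z.1, z.2))
        (W : Filter (Exp K Y × K)) ⊓ Filter.comap Prod.fst (U : Filter Z))
    refine ⟨Ultrafilter.of (Filter.comap (fun z : Z × K => (Exp.curry F hF z.1, z.2))
        (W : Filter (Exp K Y × K)) ⊓ Filter.comap Prod.fst (U : Filter Z)),
      Ultrafilter.coe_le_coe.1 ?_, Ultrafilter.coe_le_coe.1 ?_⟩
    · rw [Ultrafilter.coe_map]
      exact Filter.map_le_iff_le_comap.2 (h.trans inf_le_left)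
    · rw [Ultrafilter.coe_map]
      exact Filter.map_le_iff_le_comap.2 (h.trans inf_le_right)
  subst hV1
  rw [Ultrafilter.map_map] at hk ⊢
  refine hF V (z, k) ⟨?_, hk⟩
  rw [hV2]
  exact hz

end Exp

end Pseudotopology

/-! ### Mapping path spaces. -/

namespace CubeGeom

open Pseudotopology

variable {A B : Type*} [Pseudotopology A] [Pseudotopology B]

/-- The mapping path space of a map. -/
abbrev PathSpace (j : A → B) : Type _ :=
  {z : A × Exp unitInterval B // Exp.eval (z.2, 0) = j z.1}

/-- When the end of a path moves, the path is extended with its start held fixed. In adjoint form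
this is a box filling in `B`, with the path coordinate as a 1-cube: the bottom is the given family
of paths, one wall is constant and the other follows `q`. The component in `A` does not move. -/
theorem rlpj_path_end {j : A → B} (hj : PCont j) :
    RLPJ (fun z : PathSpace j => Exp.eval (z.1.2, 1)) := by
  intro n p q hp hq hpq
  have hC : ∀ z : Cube 0, z = Fin.elim0 := fun z => Subsingleton.elim _ _
  -- Prescribed motions of the two ends of the path; the walls over `∂I^0` are empty.
  obtain ⟨b, hb, b0, b1, -⟩ := exists_bd_glue (n := 0) (S := Cube n × unitInterval)
    (c := fun z => j (p z.2.1).1.1) (d := fun z => q z.2)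
    (b := fun z => isEmptyElim z.1.1) (by fun_prop) (by fun_prop)
    (fun _ z => isEmptyElim z.1.1) (fun z => isEmptyElim z) (fun z => isEmptyElim z)
  obtain ⟨h, hh, h0, h1⟩ := exists_box_fill (n := 1) (T := Cube n)
    (p := fun z => Exp.eval ((p z.2).1.2, (unsnoc z.1).2))
    (b := fun z => b (z.1.1, (z.1.2, z.2))) (by fun_prop) (by fun_prop)
    (fun z τ => by
      rcases (onBd_iff z.1).1 z.2 with e | e | e
      · exact e.choose.elim0
      · dsimp only
        rw [b0 _ _ e, e, (p τ).2]
      · dsimp only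
        rw [b1 _ _ e, e, ← hpq])
  have ho : ∀ t : unitInterval, OnBd (snoc ((Fin.elim0 : Cube 0), t)) ↔ t = 0 ∨ t = 1 := fun t => by
    rw [onBd_snoc]
    exact or_iff_right fun e => e.choose.elim0
  let F : (Cube n × unitInterval) × unitInterval → B := fun z =>
    h ((snoc ((Fin.elim0 : Cube 0), z.2), z.1.1), z.1.2)
  have hF : PCont F := by unfold F; fun_prop
  have hF0 : ∀ z, Exp.eval (Exp.curry F hF z, 0) = j (p z.1).1.1 := fun z => by
    refine (h1 ⟨_, (ho 0).2 (Or.inl rfl)⟩ z.1 z.2).trans ?_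
    dsimp only
    rw [b0 _ _ (by simp)]
  refine ⟨fun z => ⟨((p z.1).1.1, Exp.curry F hF z), hF0 z⟩,
    PCont.subtypeMk (f := fun z : Cube n × unitInterval => ((p z.1).1.1, Exp.curry F hF z))
      (by fun_prop) hF0, fun z => ?_, fun z => ?_⟩
  · refine Subtype.ext (Prod.ext rfl (Exp.ext fun t => ?_))
    refine (h0 _).trans ?_
    simp
  · refine (h1 ⟨_, (ho 1).2 (Or.inr rfl)⟩ z.1 z.2).trans ?_
    dsimp only
    rw [b1 _ _ (by simp)]

end CubeGeom

namespace PsTop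

open Pseudotopology CubeGeom

/-! ## Morphisms of pseudotopological spaces -/

/-- A continuous function as a morphism. -/
def mkHom {X Y : PsTop.{u}} (f : X → Y) (hf : PCont f) : X ⟶ Y :=
  (⟨f, pcont_iff_cont.1 hf⟩ : Map X Y)

/-- A pseudotopological space as an object. -/
abbrev of (A : Type u) [Pseudotopology A] : PsTop.{u} := ⟨A⟩

@[simp]
theorem mkHom_toFun {X Y : PsTop.{u}} (f : X → Y) (hf : PCont f) : Map.toFun (mkHom f hf) = f :=
  rfl

@[fun_prop]
theorem pcont_toFun {X Y : PsTop.{u}} (f : X ⟶ Y) : PCont (Map.toFun f) :=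
  pcont_iff_cont.2 (Map.cont f)

theorem comp_apply' {X Y Z : PsTop.{u}} (f : X ⟶ Y) (g : Y ⟶ Z) (x : X) :
    Map.toFun (f ≫ g) x = Map.toFun g (Map.toFun f x) := rfl

theorem congr_toFun {X Y : PsTop.{u}} {f g : X ⟶ Y} (h : f = g) (x : X) :
    Map.toFun f x = Map.toFun g x := by rw [h]

/-! ### Products -/

section Prod

variable {X Y Z W : PsTop.{u}}

/-- Pairs as points of the categorical product. -/
noncomputable def pmk (z : X × Y) : (X ⨯ Y : PsTop.{u}) :=
  Map.toFun (prod.lift (mkHom (X := of (X × Y)) Prod.fst PCont.fst')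
    (mkHom (X := of (X × Y)) Prod.snd PCont.snd')) z

@[fun_prop]
theorem pcont_pmk : PCont (pmk : X × Y → (X ⨯ Y : PsTop.{u})) :=
  pcont_toFun (X := of (X × Y)) _

@[simp]
theorem fst_pmk (z : X × Y) : Map.toFun (prod.fst : X ⨯ Y ⟶ X) (pmk z) = z.1 :=
  congr_toFun (prod.lift_fst (mkHom (X := of (X × Y)) Prod.fst PCont.fst')
    (mkHom (X := of (X × Y)) Prod.snd PCont.snd')) z

@[simp]
theorem snd_pmk (z : X × Y) : Map.toFun (prod.snd : X ⨯ Y ⟶ Y) (pmk z) = z.2 :=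
  congr_toFun (prod.lift_snd (mkHom (X := of (X × Y)) Prod.fst PCont.fst')
    (mkHom (X := of (X × Y)) Prod.snd PCont.snd')) z

@[simp]
theorem pmk_eta (w : (X ⨯ Y : PsTop.{u})) :
    pmk (Map.toFun (prod.fst : X ⨯ Y ⟶ X) w, Map.toFun (prod.snd : X ⨯ Y ⟶ Y) w) = w := by
  have h : mkHom (X := (X ⨯ Y : PsTop.{u})) (Y := of (X × Y))
      (fun w => (Map.toFun (prod.fst : X ⨯ Y ⟶ X) w, Map.toFun (prod.snd : X ⨯ Y ⟶ Y) w))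
      (by fun_prop) ≫ prod.lift (mkHom (X := of (X × Y)) Prod.fst PCont.fst')
        (mkHom (X := of (X × Y)) Prod.snd PCont.snd') = 𝟙 _ := by
    refine Limits.prod.hom_ext ?_ ?_
    · rw [Category.assoc, prod.lift_fst]
      rfl
    · rw [Category.assoc, prod.lift_snd]
      rfl
  exact congr_toFun h w

theorem exists_pmk (w : (X ⨯ Y : PsTop.{u})) : ∃ x y, pmk (x, y) = w :=
  ⟨_, _, pmk_eta w⟩

theorem pmk_inj {z w : X × Y} : (pmk z : (X ⨯ Y : PsTop.{u})) = pmk w ↔ z = w := by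
  refine ⟨fun h => Prod.ext ?_ ?_, fun h => by rw [h]⟩
  · rw [← fst_pmk z, h, fst_pmk]
  · rw [← snd_pmk z, h, snd_pmk]

@[simp]
theorem map_pmk (f : X ⟶ Z) (g : Y ⟶ W) (z : X × Y) :
    Map.toFun (prod.map f g) (pmk z) = pmk (Map.toFun f z.1, Map.toFun g z.2) := by
  rw [← pmk_eta (Map.toFun (prod.map f g) (pmk z)), ← comp_apply', ← comp_apply',
    prod.map_fst, prod.map_snd, comp_apply', comp_apply', fst_pmk, snd_pmk]

theorem prod_hom_ext {f g : X ⨯ Y ⟶ Z}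
    (h : ∀ x y, Map.toFun f (pmk (x, y)) = Map.toFun g (pmk (x, y))) : f = g :=
  hom_ext fun w => by
    obtain ⟨x, y, rfl⟩ := exists_pmk w
    exact h x y

/-- A continuous function of two variables as a morphism from the product. -/
noncomputable def prodHom (f : X × Y → Z) (hf : PCont f) : X ⨯ Y ⟶ Z :=
  mkHom (fun w => f (Map.toFun (prod.fst : X ⨯ Y ⟶ X) w, Map.toFun (prod.snd : X ⨯ Y ⟶ Y) w))
    (by fun_prop)

@[simp]
theorem prodHom_pmk (f : X × Y → Z) (hf : PCont f) (z : X × Y) :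
    Map.toFun (prodHom f hf) (pmk z) = f z := by
  simp [prodHom]

end Prod

/-! ### Cubes -/

instance (b : Box) : TopologicalSpace (boxEmbedding.{u}.obj b) :=
  inferInstanceAs (TopologicalSpace (ULift.{u} (BoxShape.toTop b)))

instance (b : Box) : IsTopological (boxEmbedding.{u}.obj b) := ⟨fun _ _ => Iff.rfl⟩

/-- Points of the cube. -/
def up {n : ℕ} (z : Cube n) : boxEmbedding.{u}.obj (Box.cube n) := ULift.up z

/-- Points of the cube. -/
def down {n : ℕ} (z : boxEmbedding.{u}.obj (Box.cube n)) : Cube n := ULift.down z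

/-- Points of the boundary of the cube. -/
def upBd {n : ℕ} (z : Bd n) : boxEmbedding.{u}.obj (Box.bd n) := ULift.up z

/-- Points of the boundary of the cube. -/
def downBd {n : ℕ} (z : boxEmbedding.{u}.obj (Box.bd n)) : Bd n := ULift.down z

section Cube

variable {n : ℕ}

@[simp] theorem down_up (z : Cube n) : down (up.{u} z) = z := rfl
@[simp] theorem up_down (z : boxEmbedding.{u}.obj (Box.cube n)) : up (down z) = z := rfl

theorem up_inj {z w : Cube n} : up.{u} z = up w ↔ z = w :=
  ⟨fun h => congrArg down h, fun h => by rw [h]⟩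

theorem upBd_inj {z w : Bd n} : upBd.{u} z = upBd w ↔ z = w :=
  ⟨fun h => congrArg downBd h, fun h => by rw [h]⟩

@[fun_prop] theorem continuous_up : Continuous (up.{u} : Cube n → _) := continuous_uliftUp
@[fun_prop] theorem continuous_down : Continuous (down.{u} : _ → Cube n) := continuous_uliftDown
@[fun_prop] theorem continuous_upBd : Continuous (upBd.{u} : Bd n → _) := continuous_uliftUp
@[fun_prop] theorem continuous_downBd : Continuous (downBd.{u} : _ → Bd n) := continuous_uliftDown

@[fun_prop] theorem pcont_up : PCont (up.{u} : Cube n → _) := .of_continuous continuous_up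
@[fun_prop] theorem pcont_down : PCont (down.{u} : _ → Cube n) := .of_continuous continuous_down
@[fun_prop] theorem pcont_upBd : PCont (upBd.{u} : Bd n → _) := .of_continuous continuous_upBd
@[fun_prop] theorem pcont_downBd : PCont (downBd.{u} : _ → Bd n) :=
  .of_continuous continuous_downBd

theorem map_i (z : Bd n) : Map.toFun (boxEmbedding.{u}.map (Box.i n)) (upBd z) = up z.1 := rfl

theorem map_j (z : Cube n) :
    Map.toFun (boxEmbedding.{u}.map (Box.j n)) (up z) = up (snoc (z, 0)) := by
  rw [snoc]
  rfl

/-- Points of the interval. -/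
def upI (t : unitInterval) : boxEmbedding.{u}.obj (Box.cube 1) := up fun _ => t

/-- Points of the interval. -/
def downI (t : boxEmbedding.{u}.obj (Box.cube 1)) : unitInterval := down t 0

theorem map_e (t : unitInterval) (z : Cube 0) :
    Map.toFun (boxEmbedding.{u}.map (Box.e t)) (up z) = upI t := rfl

@[simp] theorem downI_upI (t : unitInterval) : downI (upI.{u} t) = t := rfl
@[simp] theorem upI_downI (t : boxEmbedding.{u}.obj (Box.cube 1)) : upI (downI t) = t :=
  congrArg up (funext fun i => by rw [Subsingleton.elim i 0]; rfl)

@[fun_prop] theorem continuous_upI : Continuous upI.{u} := by unfold upI; fun_prop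
@[fun_prop] theorem continuous_downI : Continuous downI.{u} := by unfold downI; fun_prop
@[fun_prop] theorem pcont_upI : PCont upI.{u} := .of_continuous continuous_upI
@[fun_prop] theorem pcont_downI : PCont downI.{u} := .of_continuous continuous_downI

theorem up_zero (z w : Cube 0) : up.{u} z = up w := by rw [Subsingleton.elim z w]

theorem cube_zero_eq (z : boxEmbedding.{u}.obj (Box.cube 0)) : z = up Fin.elim0 := up_zero (down z) _

/-- A continuous function on a cube as a morphism. -/
def ofCube {X : PsTop.{u}} (f : Cube n → X) (hf : PCont f) :
    boxEmbedding.{u}.obj (Box.cube n) ⟶ X :=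
  mkHom (fun z => f (down z)) (by fun_prop)

/-- A continuous function on the boundary of a cube as a morphism. -/
def ofBd {X : PsTop.{u}} (f : Bd n → X) (hf : PCont f) : boxEmbedding.{u}.obj (Box.bd n) ⟶ X :=
  mkHom (fun z => f (downBd z)) (by fun_prop)

@[simp] theorem ofCube_up {X : PsTop.{u}} (f : Cube n → X) (hf : PCont f) (z : Cube n) :
    Map.toFun (ofCube f hf) (up z) = f z := rfl

theorem cube_hom_ext {X : PsTop.{u}} {f g : boxEmbedding.{u}.obj (Box.cube n) ⟶ X}
    (h : ∀ z, Map.toFun f (up z) = Map.toFun g (up z)) : f = g := hom_ext fun z => h (down z)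

theorem bd_hom_ext {X : PsTop.{u}} {f g : boxEmbedding.{u}.obj (Box.bd n) ⟶ X}
    (h : ∀ z, Map.toFun f (upBd z) = Map.toFun g (upBd z)) : f = g := hom_ext fun z => h (downBd z)

end Cube

/-! ### Lifting properties of morphisms -/

section Lifting

variable {X Y : PsTop.{u}} (f : X ⟶ Y)

theorem rlp_genI_iff : (genI boxEmbedding.{u}).rlp f ↔ RLPI (Map.toFun f) := by
  constructor
  · intro h n p q hp hq hpq
    have := h _ ⟨n⟩
    have sq : CommSq (ofBd p hp) (boxEmbedding.{u}.map (Box.i n)) f (ofCube q hq) :=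
      ⟨bd_hom_ext fun z => hpq z⟩
    exact ⟨fun z => Map.toFun sq.lift (up z), by fun_prop,
      fun z => congr_toFun sq.fac_left (upBd z), fun z => congr_toFun sq.fac_right (up z)⟩
  · rintro h _ _ _ ⟨n⟩
    refine ⟨fun {p q} sq => ?_⟩
    obtain ⟨h, hh, h1, h2⟩ := h n (fun z => Map.toFun p (upBd z)) (fun z => Map.toFun q (up z))
      (by fun_prop) (by fun_prop) (fun z => congr_toFun sq.w (upBd z))
    exact ⟨⟨⟨ofCube h hh, bd_hom_ext h1, cube_hom_ext h2⟩⟩⟩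

theorem rlp_genJ_iff : (genJ boxEmbedding.{u}).rlp f ↔ RLPJ (Map.toFun f) := by
  constructor
  · intro h n p q hp hq hpq
    have := h _ ⟨n⟩
    have sq : CommSq (ofCube p hp) (boxEmbedding.{u}.map (Box.j n)) f
        (ofCube (fun z => q (unsnoc z)) (by fun_prop)) :=
      ⟨cube_hom_ext fun z => by
        rw [comp_apply', comp_apply', map_j, ofCube_up, ofCube_up, unsnoc_snoc, hpq]⟩
    refine ⟨fun z => Map.toFun sq.lift (up (snoc z)), by fun_prop, fun z => ?_, fun z => ?_⟩
    · dsimp only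
      rw [← map_j]
      exact congr_toFun sq.fac_left (up z)
    · refine (congr_toFun sq.fac_right (up (snoc z))).trans ?_
      rw [ofCube_up, unsnoc_snoc]
  · rintro h _ _ _ ⟨n⟩
    refine ⟨fun {p q} sq => ?_⟩
    obtain ⟨h, hh, h1, h2⟩ := h n (fun z => Map.toFun p (up z))
      (fun z => Map.toFun q (up (snoc z))) (by fun_prop) (by fun_prop)
      (fun z => by rw [← map_j]; exact congr_toFun sq.w (up z))
    refine ⟨⟨⟨ofCube (fun z => h (unsnoc z)) (by fun_prop), cube_hom_ext fun z => ?_,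
      cube_hom_ext fun z => ?_⟩⟩⟩
    · rw [comp_apply', map_j, ofCube_up, unsnoc_snoc, h1]
    · rw [comp_apply', ofCube_up, h2, snoc_unsnoc]

theorem homotopicRel_iff {n : ℕ} (p q : boxEmbedding.{u}.obj (Box.cube n) ⟶ Y) :
    HomotopicRel boxEmbedding.{u} (boxEmbedding.{u}.map (Box.i n)) p q ↔
      HRel (fun z => Map.toFun p (up z)) (fun z => Map.toFun q (up z)) := by
  constructor
  · rintro ⟨H, h0, h1, h2⟩
    refine ⟨fun z => Map.toFun H (pmk (up z.1, upI z.2)), by fun_prop, fun z => ?_, fun z => ?_,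
      fun z t hz => ?_⟩
    · have := congr_toFun h0 (pmk (up z, up Fin.elim0))
      simpa [map_e] using this
    · have := congr_toFun h1 (pmk (up z, up Fin.elim0))
      simpa [map_e] using this
    · have := congr_toFun h2 (pmk (upBd ⟨z, hz⟩, upI t))
      simpa [map_i] using this
  · rintro ⟨H, hH, h0, h1, h2⟩
    refine ⟨prodHom (fun z => H (down z.1, downI z.2)) (by fun_prop), prod_hom_ext fun x y => ?_,
      prod_hom_ext fun x y => ?_, prod_hom_ext fun x y => ?_⟩
    · rw [cube_zero_eq y]
      simpa [map_e] using h0 (down x)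
    · rw [cube_zero_eq y]
      simpa [map_e] using h1 (down x)
    · obtain ⟨x, rfl⟩ : ∃ x', upBd x' = x := ⟨downBd x, rfl⟩
      have := h2 _ (downI y) x.2
      simpa [map_i] using this

theorem weakRLP_iff : weakRLP boxEmbedding.{u} f ↔ WRLP (Map.toFun f) := by
  constructor
  · intro h n p q hp hq hpq
    obtain ⟨h, h1, h2⟩ := h n (ofBd p hp) (ofCube q hq) (bd_hom_ext fun z => hpq z)
    exact ⟨fun z => Map.toFun h (up z), by fun_prop, fun z => congr_toFun h1 (upBd z),
      (homotopicRel_iff _ _).1 h2⟩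
  · intro h n p q hpq
    obtain ⟨h, hh, h1, h2⟩ := h n (fun z => Map.toFun p (upBd z)) (fun z => Map.toFun q (up z))
      (by fun_prop) (by fun_prop) (fun z => congr_toFun hpq (upBd z))
    exact ⟨ofCube h hh, bd_hom_ext h1, (homotopicRel_iff _ _).2 h2⟩

/-! ### Homotopy groups -/

/-- Relative homotopy is already an equivalence relation, so passing to the quotient generates no
further identifications. -/
theorem homotopyPi_mk_eq_iff {n : ℕ} {x : boxEmbedding.{u}.obj (Box.cube 0) ⟶ X}
    (a b : Spheroid boxEmbedding.{u} n x) :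
    (Quot.mk _ a : HomotopyPi boxEmbedding.{u} n x) = Quot.mk _ b ↔
      HRel (fun z => Map.toFun a.1 (up z)) (fun z => Map.toFun b.1 (up z)) := by
  constructor
  · intro h
    have := Quot.eqvGen_exact h
    clear h
    induction this with
    | rel a b h => exact (homotopicRel_iff _ _).1 h
    | refl a => exact HRel.refl (by fun_prop)
    | symm a b _ h => exact h.symm
    | trans a b c _ _ h1 h2 => exact h1.trans h2
  · exact fun h => Quot.sound ((homotopicRel_iff _ _).2 h)

/-- A spheroid from a function on the cube. -/
def mkSpheroid {n : ℕ} {x : boxEmbedding.{u}.obj (Box.cube 0) ⟶ X} (a : Cube n → X)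
    (ha : PCont a) (h : ∀ z : Bd n, a z.1 = Map.toFun x (up Fin.elim0)) :
    Spheroid boxEmbedding.{u} n x :=
  ⟨ofCube a ha, bd_hom_ext h⟩

theorem spheroid_apply {n : ℕ} {x : boxEmbedding.{u}.obj (Box.cube 0) ⟶ X}
    (a : Spheroid boxEmbedding.{u} n x) (z : Bd n) :
    Map.toFun a.1 (up z.1) = Map.toFun x (up Fin.elim0) :=
  congr_toFun a.2 (upBd z)

/-- The content is `wrlp_of_pi` and its converses on representatives. Compatibility with products is
automatic, since postcomposition commutes with restriction to halves of the cube. -/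
theorem isoOnHomotopyGroups_iff :
    isoOnHomotopyGroups boxEmbedding.{u} f ↔ WRLP (Map.toFun f) := by
  constructor
  · rintro ⟨h0, h⟩
    refine wrlp_of_pi (by fun_prop) ?_ ?_ ?_
    · rintro ⟨y⟩
      obtain ⟨x⟩ := h0 ⟨ofCube (fun _ => y) (by fun_prop)⟩
      exact ⟨Map.toFun x (up Fin.elim0)⟩
    · intro n x b hb hbx
      obtain ⟨a, ha⟩ := ((h (ofCube (fun _ => x) (by fun_prop))).1 n).2
        (Quot.mk _ (mkSpheroid b hb hbx))
      induction a using Quot.ind with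
      | mk a =>
        exact ⟨fun z => Map.toFun a.1 (up z), by fun_prop, spheroid_apply a,
          (homotopyPi_mk_eq_iff _ _).1 ha⟩
    · intro n x a b ha hb hax hbx hab
      have := ((h (ofCube (fun _ => x) (by fun_prop))).1 n).1
        (a₁ := Quot.mk _ (mkSpheroid a ha hax)) (a₂ := Quot.mk _ (mkSpheroid b hb hbx))
        ((homotopyPi_mk_eq_iff _ _).2 hab)
      exact (homotopyPi_mk_eq_iff _ _).1 this
  · intro h
    refine ⟨?_, fun x => ⟨fun n => ⟨?_, ?_⟩, ?_⟩⟩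
    · rintro ⟨y⟩
      obtain ⟨x⟩ := h.nonempty ⟨Map.toFun y (up Fin.elim0)⟩
      exact ⟨ofCube (fun _ => x) (by fun_prop)⟩
    · rintro ⟨a⟩ ⟨b⟩ hab
      exact (homotopyPi_mk_eq_iff _ _).2 (h.piInj n _ _ _ (by fun_prop) (by fun_prop)
        (spheroid_apply a) (spheroid_apply b) ((homotopyPi_mk_eq_iff _ _).1 hab))
    · rintro ⟨b⟩
      obtain ⟨a, ha, h1, h2⟩ := h.piSurj n (Map.toFun x (up Fin.elim0))
        (fun z => Map.toFun b.1 (up z)) (by fun_prop) (spheroid_apply b)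
      exact ⟨Quot.mk _ (mkSpheroid a ha h1), (homotopyPi_mk_eq_iff _ _).2 h2⟩
    · rintro n p q r ⟨α, β, γ, rfl, rfl, rfl, h1, h2⟩
      refine ⟨⟨α.1 ≫ f, by rw [← Category.assoc, α.2, Category.assoc]⟩,
        ⟨β.1 ≫ f, by rw [← Category.assoc, β.2, Category.assoc]⟩,
        ⟨γ.1 ≫ f, by rw [← Category.assoc, γ.2, Category.assoc]⟩, rfl, rfl, rfl, ?_, ?_⟩
      · exact (Category.assoc _ _ _).symm.trans (congrArg (· ≫ f) h1)
      · exact (Category.assoc _ _ _).symm.trans (congrArg (· ≫ f) h2)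

theorem weakRLP_eq_isoOnHomotopyGroups :
    weakRLP boxEmbedding.{u} = isoOnHomotopyGroups boxEmbedding.{u} := by
  ext X Y f
  rw [weakRLP_iff, isoOnHomotopyGroups_iff]

end Lifting

end PsTop

namespace PsTop

open Pseudotopology CubeGeom

/-! ## Colimits -/

/-- The indiscrete pseudotopological space. -/
def indiscrete (A : Type u) : PsTop.{u} :=
  @PsTop.mk A ⟨fun _ => Set.univ, fun _ => trivial⟩

theorem pcont_indiscrete {X : Type*} [Pseudotopology X] {A : Type u} (f : X → indiscrete A) :
    PCont f := fun _ _ _ => trivial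

section Colimit

variable {J : Type*} [Category* J] {F : J ⥤ PsTop.{u}} {c : Cocone F} (hc : IsColimit c)

include hc

/-- Every function to an indiscrete space is continuous. The indicator of the union of the images
and the constant indicator agree on all legs, hence are equal. -/
theorem exists_leg_eq (s : c.pt) : ∃ (j : J) (x : F.obj j), Map.toFun (c.ι.app j) x = s := by
  classical
  let f : c.pt ⟶ indiscrete (ULift.{u} Prop) :=
    mkHom (fun s => ULift.up (∃ (j : J) (x : F.obj j), Map.toFun (c.ι.app j) x = s))
      (pcont_indiscrete _)
  let g : c.pt ⟶ indiscrete (ULift.{u} Prop) := mkHom (fun s => ULift.up True)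
    (pcont_indiscrete _)
  have : f = g := hc.hom_ext fun j => hom_ext fun x => by
    change ULift.up _ = ULift.up _
    congr 1
    exact eq_true ⟨j, x, rfl⟩
  have h := congr_toFun this s
  have h' : (∃ (j : J) (x : F.obj j), Map.toFun (c.ι.app j) x = s) = True :=
    congrArg ULift.down h
  exact of_eq_true h'

/-- Give the underlying set of the colimit only the limits that come from the legs. This is again a
cocone, the map induced from the colimit is the identity function, and its continuity is the claim.
-/
theorem exists_leg_of_mem_ulim (U : Ultrafilter c.pt) (s : c.pt) (hs : s ∈ ulim U) :
    ∃ (j : J) (V : Ultrafilter (F.obj j)) (x : F.obj j), x ∈ ulim V ∧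
      V.map (Map.toFun (c.ι.app j)) = U ∧ Map.toFun (c.ι.app j) x = s := by
  let X : PsTop.{u} := @PsTop.mk c.pt
    { ulim := fun U => {s | ∃ (j : J) (V : Ultrafilter (F.obj j)) (x : F.obj j), x ∈ ulim V ∧
        V.map (Map.toFun (c.ι.app j)) = U ∧ Map.toFun (c.ι.app j) x = s}
      mem_ulim_pure := fun s => by
        obtain ⟨j, x, rfl⟩ := exists_leg_eq hc s
        exact ⟨j, pure x, x, mem_ulim_pure x, Ultrafilter.map_pure _ _, rfl⟩ }
  let d : Cocone F :=
    { pt := X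
      ι :=
        { app := fun j => mkHom (Y := X) (Map.toFun (X := F.obj j) (Y := c.pt) (c.ι.app j))
            fun U x hx => ⟨j, U, x, hx, rfl, rfl⟩
          naturality := fun i j f => hom_ext fun x => congr_toFun (c.ι.naturality f) x } }
  let k : X ⟶ c.pt := mkHom (X := X) (fun s => s) (by
    rintro _ _ ⟨j, V, x, hx, rfl, rfl⟩
    exact pcont_toFun (c.ι.app j) V x hx)
  have h : hc.desc d ≫ k = 𝟙 _ := hc.hom_ext fun j => hom_ext fun x => by
    exact congr_toFun (hc.fac d j) x
  have h' : Map.toFun (hc.desc d) = fun s => s := funext fun s => congr_toFun h s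
  have := pcont_toFun (hc.desc d) U s hs
  rw [h'] at this
  have e : Ultrafilter.map (fun s : c.pt => s) U = U := Ultrafilter.map_id' U
  rw [e] at this
  exact this

end Colimit

/-! ## Smallness -/

/-- The convergence relation of a pseudotopological space, as a type. -/
abbrev Conv (A : PsTop.{u}) : Type u := {p : Ultrafilter A × A // p.2 ∈ ulim p.1}

section Small

variable {J : Type u} [LinearOrder J]

/-- Each convergence `(U, a)` in `A` is sent to one that comes from some stage, and the size
hypothesis bounds all these stages by one `k`. Principal ultrafilters show that every point lifts to
stage `k`. Injectivity of the leg forces the lifted convergences to be the images under this lift,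
which is therefore continuous. -/
theorem exists_lift_of_isColimit {F : J ⥤ PsTop.{u}} {c : Cocone F} (hc : IsColimit c)
    (hinj : ∀ j, Function.Injective (Map.toFun (c.ι.app j))) {A : PsTop.{u}}
    (hJ : ∀ S : Set J, Cardinal.mk S ≤ Cardinal.mk (Conv A) → BddAbove S) (q : A ⟶ c.pt) :
    ∃ (j : J) (p : A ⟶ F.obj j), p ≫ c.ι.app j = q := by
  choose j V x hx hV hxq using fun p : Conv A => exists_leg_of_mem_ulim hc _ _
    (pcont_toFun q p.1.1 p.1.2 p.2)
  obtain ⟨k, hk⟩ := hJ (Set.range j) Cardinal.mk_range_le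
  have hk' : ∀ p, j p ≤ k := fun p => hk ⟨p, rfl⟩
  have hw : ∀ p y, Map.toFun (c.ι.app k) (Map.toFun (F.map (homOfLE (hk' p))) y) =
      Map.toFun (c.ι.app (j p)) y := fun p y => congr_toFun (c.w (homOfLE (hk' p))) y
  have hr : ∀ a : A, ∃ y, Map.toFun (c.ι.app k) y = Map.toFun q a := fun a =>
    ⟨_, (hw ⟨(pure a, a), mem_ulim_pure a⟩ _).trans (hxq ⟨(pure a, a), mem_ulim_pure a⟩)⟩
  choose r hr using hr
  refine ⟨k, mkHom r fun U a ha => ?_, hom_ext hr⟩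
  let p : Conv A := ⟨(U, a), ha⟩
  have h := pcont_toFun (F.map (homOfLE (hk' p))) (V p) (x p) (hx p)
  have h1 : Map.toFun (F.map (homOfLE (hk' p))) (x p) = r a :=
    hinj k ((hw p _).trans ((hxq p).trans (hr a).symm))
  have h2 : (V p).map (Map.toFun (F.map (homOfLE (hk' p)))) = U.map r := by
    have hi : Function.Injective (Ultrafilter.map (Map.toFun (c.ι.app k))) := by
      intro V W h
      refine Ultrafilter.coe_injective (Filter.map_injective (hinj k) ?_)
      exact congrArg Ultrafilter.toFilter h
    refine hi ?_
    rw [Ultrafilter.map_map, Ultrafilter.map_map]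
    have e1 : Map.toFun (c.ι.app k) ∘ Map.toFun (F.map (homOfLE (hk' p))) =
      Map.toFun (c.ι.app (j p)) := funext (hw p)
    have e2 : Map.toFun (c.ι.app k) ∘ r = Map.toFun q := funext hr
    rw [e1, e2]
    exact hV p
  rwa [h1, h2] at h

theorem preservesColimit_coyoneda {F : J ⥤ PsTop.{u}}
    (hinj : ∀ (c : Cocone F), IsColimit c → ∀ j, Function.Injective (Map.toFun (c.ι.app j)))
    (A : PsTop.{u})
    (hJ : ∀ S : Set J, Cardinal.mk S ≤ Cardinal.mk (Conv A) → BddAbove S) :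
    PreservesColimit F (coyoneda.obj (Opposite.op A)) where
  preserves {c} hc := ⟨Types.FilteredColimit.isColimitOf _ _ (fun q => by
      obtain ⟨j, p, h⟩ := exists_lift_of_isColimit hc (hinj c hc) hJ q
      exact ⟨j, p, h.symm⟩) (fun i j p q h => by
      have h' : p ≫ c.ι.app i = q ≫ c.ι.app j := h
      refine ⟨max i j, homOfLE (le_max_left _ _), homOfLE (le_max_right _ _), ?_⟩
      change p ≫ F.map _ = q ≫ F.map _
      refine hom_ext fun a => hinj c hc _ ?_
      have := congr_toFun h' a
      rw [← c.w (homOfLE (le_max_left i j)), ← c.w (homOfLE (le_max_right i j))] at this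
      exact this)⟩

variable [SuccOrder J] [OrderBot J] [WellFoundedLT J]

/-- The leg from `F j` is itself a transfinite composition of maps with the left lifting property,
hence has that property and is injective. -/
theorem preservesColimit_coyoneda_of_llp {W : MorphismProperty PsTop.{u}}
    (hW : ∀ ⦃X Y : PsTop.{u}⦄ (f : X ⟶ Y), W.llp f → Function.Injective (Map.toFun f))
    (F : J ⥤ PsTop.{u}) [F.IsWellOrderContinuous]
    (hF : ∀ j : J, ¬ IsMax j → W.llp (F.map (homOfLE (Order.le_succ j)))) (A : PsTop.{u})
    (hJ : ∀ S : Set J, Cardinal.mk S ≤ Cardinal.mk (Conv A) → BddAbove S) :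
    PreservesColimit F (coyoneda.obj (Opposite.op A)) := by
  refine preservesColimit_coyoneda (fun c hc j => hW _ ?_) A hJ
  let h : W.llp.TransfiniteCompositionOfShape J (c.ι.app ⊥) :=
    { F := F
      isoBot := Iso.refl _
      incl := c.ι
      isColimit := hc
      fac := Category.id_comp _
      map_mem := hF }
  exact h.mem_incl_app j

end Small

/-! ## The generating classes -/

theorem rlp_genI_le_rlp_genJ :
    (genI boxEmbedding.{u}).rlp ≤ (genJ boxEmbedding.{u}).rlp := fun _ _ f hf =>
  (rlp_genJ_iff f).2 ((rlp_genI_iff f).1 hf).rlpj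

/-- The map from the indiscrete space on `A` to a point lifts against every boundary inclusion,
since continuity into it is no condition. Lifting the identity function of `A` against `f` then
gives a retraction of `f` on underlying sets. -/
theorem injective_of_llp_rlp_genI ⦃A B : PsTop.{u}⦄ (f : A ⟶ B)
    (hf : (genI boxEmbedding.{u}).rlp.llp f) : Function.Injective (Map.toFun f) := by
  intro x y hxy
  have h : (genI boxEmbedding.{u}).rlp
      (mkHom (X := indiscrete A) (Y := indiscrete PUnit.{u + 1}) (fun _ => PUnit.unit)
        (pcont_indiscrete _)) := by
    rw [rlp_genI_iff]
    intro n p q hp hq hpq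
    classical
    -- The value `x` off the boundary is arbitrary.
    refine ⟨fun z => if h : OnBd z then p ⟨z, h⟩ else x, pcont_indiscrete _, fun z => ?_,
      fun z => rfl⟩
    exact dif_pos z.2
  have := hf _ h
  have sq : CommSq (mkHom (X := A) (Y := indiscrete A) (fun a => a) (pcont_indiscrete _)) f
      (mkHom (X := indiscrete A) (Y := indiscrete PUnit.{u + 1}) (fun _ => PUnit.unit)
        (pcont_indiscrete _)) (mkHom (fun _ => PUnit.unit) (pcont_indiscrete _)) :=
    ⟨hom_ext fun a => rfl⟩
  have hl := fun a => congr_toFun sq.fac_left a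
  have h1 := hl x
  have h2 := hl y
  rw [comp_apply'] at h1 h2
  rw [hxy] at h1
  exact h1.symm.trans h2

theorem injective_of_llp_rlp_genJ ⦃A B : PsTop.{u}⦄ (f : A ⟶ B)
    (hf : (genJ boxEmbedding.{u}).rlp.llp f) : Function.Injective (Map.toFun f) :=
  injective_of_llp_rlp_genI f (MorphismProperty.antitone_llp rlp_genI_le_rlp_genJ _ hf)

theorem isSmallRelativeTo_cell {W : MorphismProperty PsTop.{u}}
    (hW : ∀ ⦃X Y : PsTop.{u}⦄ (f : X ⟶ Y), W.rlp.llp f → Function.Injective (Map.toFun f))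
    (A : PsTop.{u}) : IsSmallRelativeTo A (cell W) :=
  ⟨Cardinal.mk (Conv A), fun _ _ _ _ _ hJ F _ hF =>
    preservesColimit_coyoneda_of_llp hW F
      (fun j hj => MorphismProperty.transfiniteCompositions_pushouts_coproducts_le_llp_rlp W _
        (hF j hj)) A hJ⟩

theorem hasSmallObjectArgument {A B : ℕ → PsTop.{u}} (g : ∀ n, A n ⟶ B n)
    (hg : ∀ ⦃X Y : PsTop.{u}⦄ (f : X ⟶ Y), (MorphismProperty.ofHoms g).rlp.llp f →
      Function.Injective (Map.toFun f)) :
    MorphismProperty.HasSmallObjectArgument.{u} (MorphismProperty.ofHoms g) := by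
  -- A bound for the convergence relations of all domains at once, and infinite so that its
  -- successor is regular.
  let μ : Cardinal.{u} := max Cardinal.aleph0 (Cardinal.sum fun n : ULift.{u} ℕ =>
    Cardinal.mk (Conv (A n.down)))
  have hμ : ∀ n, Cardinal.mk (Conv (A n)) ≤ μ := fun n =>
    (Cardinal.le_sum (fun n : ULift.{u} ℕ => Cardinal.mk (Conv (A n.down))) ⟨n⟩).trans
      (le_max_right _ _)
  have hreg : Fact (Order.succ μ).IsRegular := ⟨Cardinal.isRegular_succ (le_max_left _ _)⟩
  have hne : Nonempty (Order.succ μ).ord.ToType := by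
    rw [Ordinal.nonempty_toType_iff]
    simp
  let hbot : OrderBot (Order.succ μ).ord.ToType := WellFoundedLT.toOrderBot _
  refine ⟨Order.succ μ, hreg, hbot,
    { isSmall := MorphismProperty.isSmall_ofHoms.{u} g, preservesColimit := ?_ }⟩
  rintro _ _ X Y _ ⟨n⟩ f hf
  refine preservesColimit_coyoneda_of_llp hg hf.F (fun j hj => ?_) _ fun S hS => ?_
  · have h := (hf.attachCells j hj).pushouts_coproducts
    rw [MorphismProperty.ofHoms_homFamily] at h
    simpa using MorphismProperty.pushouts_le_llp_rlp _ _ h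
  -- A set with at most `μ` elements is bounded in the initial ordinal of the regular cardinal `succ
  -- μ`.
  · have hS' : HasCardinalLT S (Order.succ μ) := by
      rw [hasCardinalLT_iff_cardinal_mk_lt, Order.lt_succ_iff]
      exact hS.trans (hμ n)
    exact ⟨IsCardinalFiltered.max (Subtype.val : S → _) hS', fun s hs =>
      leOfHom (IsCardinalFiltered.toMax (Subtype.val : S → _) hS' ⟨s, hs⟩)⟩

instance : MorphismProperty.HasSmallObjectArgument.{u} (genI boxEmbedding.{u}) :=
  hasSmallObjectArgument _ injective_of_llp_rlp_genI

instance : MorphismProperty.HasSmallObjectArgument.{u} (genJ boxEmbedding.{u}) :=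
  hasSmallObjectArgument _ injective_of_llp_rlp_genJ

/-- Consequence of the small object argument: membership in `cof` may be checked by lifting against
`rlp`, and no cell decomposition has to be exhibited. -/
theorem cof_genI : cof (genI boxEmbedding.{u}) = (genI boxEmbedding.{u}).rlp.llp :=
  (MorphismProperty.llp_rlp_of_hasSmallObjectArgument _).symm

theorem cof_genJ : cof (genJ boxEmbedding.{u}) = (genJ boxEmbedding.{u}).rlp.llp :=
  (MorphismProperty.llp_rlp_of_hasSmallObjectArgument _).symm

end PsTop

namespace Pseudotopology

theorem IsGluing.of_comp_left {A A' B P : Type*} [Pseudotopology A] [Pseudotopology A']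
    [Pseudotopology B] [Pseudotopology P] {e : A' → A} {i : A → P} {k : B → P} (he : PCont e)
    (h : IsGluing (fun a => i (e a)) k) : IsGluing i k := by
  intro U p hp
  refine (h U p hp).imp_left ?_
  rintro ⟨V, a, ha, h1, h2⟩
  refine ⟨V.map e, e a, he V a ha, ?_, h2⟩
  rw [Ultrafilter.map_map]
  exact h1

end Pseudotopology

namespace PsTop

open Pseudotopology CubeGeom

/-! ## Recognition of colimits -/

section Gluing

variable {X A B P : PsTop.{u}} {f : X ⟶ A} {g : X ⟶ B} {i : A ⟶ P} {k : B ⟶ P}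

/-- The gluing hypothesis gives surjectivity and the final pseudotopology; the others say that
points of `A` and `B` are identified in `P` only when `X` forces it. -/
theorem isPushout_of_isGluing (hw : f ≫ i = g ≫ k) (h : IsGluing (Map.toFun i) (Map.toFun k))
    (hA : ∀ a a', Map.toFun i a = Map.toFun i a' → a = a' ∨ ∃ x x', Map.toFun f x = a ∧
      Map.toFun f x' = a' ∧ Map.toFun g x = Map.toFun g x')
    (hAB : ∀ a b, Map.toFun i a = Map.toFun k b → ∃ x, Map.toFun f x = a ∧ Map.toFun g x = b)
    (hB : Function.Injective (Map.toFun k)) : IsPushout f g i k := by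
  have key : ∀ s : PushoutCocone f g, ∃ d : P ⟶ s.pt, i ≫ d = s.inl ∧ k ≫ d = s.inr := by
    intro s
    have hs := fun x => congr_toFun s.condition x
    obtain ⟨d, hd, h1, h2⟩ := h.exists_desc (f := Map.toFun s.inl) (g := Map.toFun s.inr)
      (pcont_toFun s.inl) (pcont_toFun s.inr) (fun a a' haa => by
        rcases hA a a' haa with rfl | ⟨x, x', rfl, rfl, hx⟩
        · rfl
        · refine (hs x).trans (Eq.trans ?_ (hs x').symm)
          rw [comp_apply', comp_apply', hx])
      (fun a b hab => by
        obtain ⟨x, rfl, rfl⟩ := hAB a b hab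
        exact hs x)
      (fun b b' hbb => by rw [hB hbb])
    exact ⟨mkHom d hd, hom_ext h1, hom_ext h2⟩
  choose d h1 h2 using key
  refine ⟨⟨hw⟩, ⟨PushoutCocone.IsColimit.mk hw d h1 h2 fun s m hm1 hm2 => hom_ext fun p => ?_⟩⟩
  rcases h.exists_eq p with ⟨a, rfl⟩ | ⟨b, rfl⟩
  · exact congr_toFun (hm1.trans (h1 s).symm) a
  · exact congr_toFun (hm2.trans (h2 s).symm) b

theorem nonempty_isColimit_of_isGluing (h : IsGluing (Map.toFun i) (Map.toFun k))
    (hA : Function.Injective (Map.toFun i)) (hB : Function.Injective (Map.toFun k))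
    (hAB : ∀ a b, Map.toFun i a ≠ Map.toFun k b) : Nonempty (IsColimit (BinaryCofan.mk i k)) := by
  have key : ∀ {T : PsTop.{u}} (f : A ⟶ T) (g : B ⟶ T), ∃ d : P ⟶ T, i ≫ d = f ∧ k ≫ d = g := by
    intro T f g
    obtain ⟨d, hd, h1, h2⟩ := h.exists_desc (pcont_toFun f) (pcont_toFun g)
      (fun a a' e => by rw [hA e]) (fun a b e => absurd e (hAB a b)) (fun a a' e => by rw [hB e])
    exact ⟨mkHom d hd, hom_ext h1, hom_ext h2⟩
  choose d h1 h2 using @key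
  refine ⟨BinaryCofan.isColimitMk (fun s => d s.inl s.inr) (fun s => h1 _ _) (fun s => h2 _ _)
    fun s m hm1 hm2 => hom_ext fun p => ?_⟩
  rcases h.exists_eq p with ⟨a, rfl⟩ | ⟨b, rfl⟩
  · exact congr_toFun (hm1.trans (h1 _ _).symm) a
  · exact congr_toFun (hm2.trans (h2 _ _).symm) b

theorem isGluing_prod_map (h : IsGluing (Map.toFun i) (Map.toFun k)) (T : PsTop.{u}) :
    IsGluing (Map.toFun (prod.map (𝟙 T) i)) (Map.toFun (prod.map (𝟙 T) k)) := by
  have aux : ∀ {A : PsTop.{u}} (i : A ⟶ P) (U : Ultrafilter (T ⨯ P : PsTop.{u}))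
      (p : (T ⨯ P : PsTop.{u})),
      (∃ (W : Ultrafilter (T × A)) (z : T × A), z ∈ ulim W ∧
        W.map (fun z : T × A => (z.1, Map.toFun i z.2)) =
          U.map (fun w => (Map.toFun (prod.fst : T ⨯ P ⟶ T) w,
            Map.toFun (prod.snd : T ⨯ P ⟶ P) w)) ∧
        (z.1, Map.toFun i z.2) = (Map.toFun (prod.fst : T ⨯ P ⟶ T) p,
            Map.toFun (prod.snd : T ⨯ P ⟶ P) p)) →
      ∃ (V : Ultrafilter (T ⨯ A : PsTop.{u})) (a : (T ⨯ A : PsTop.{u})), a ∈ ulim V ∧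
        V.map (Map.toFun (prod.map (𝟙 T) i)) = U ∧ Map.toFun (prod.map (𝟙 T) i) a = p := by
    rintro A i U p ⟨W, z, hz, h1, h2⟩
    refine ⟨W.map pmk, pmk z, pcont_pmk W z hz, ?_, ?_⟩
    · have := congrArg (Ultrafilter.map pmk) h1
      rw [Ultrafilter.map_map, Ultrafilter.map_map] at this
      have e1 : (pmk ∘ fun w => (Map.toFun (prod.fst : T ⨯ P ⟶ T) w,
            Map.toFun (prod.snd : T ⨯ P ⟶ P) w)) = id := funext pmk_eta
      have e2 : (pmk ∘ fun z : T × A => (z.1, Map.toFun i z.2)) =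
          Map.toFun (prod.map (𝟙 T) i) ∘ pmk := funext fun z => (map_pmk (𝟙 T) i z).symm
      rw [e1, e2, Ultrafilter.map_id] at this
      rw [Ultrafilter.map_map]
      exact this
    · rw [map_pmk, ← pmk_eta p, ← h2]
      rfl
  intro U p hp
  have hc : PCont (fun w => (Map.toFun (prod.fst : T ⨯ P ⟶ T) w,
      Map.toFun (prod.snd : T ⨯ P ⟶ P) w)) := by fun_prop
  exact (h.prod T _ _ (hc U p hp)).imp (aux i U p) (aux k U p)

theorem isPushout_prod_map (hw : f ≫ i = g ≫ k) (h : IsGluing (Map.toFun i) (Map.toFun k))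
    (hA : Function.Injective (Map.toFun i))
    (hAB : ∀ a b, Map.toFun i a = Map.toFun k b → ∃ x, Map.toFun f x = a ∧ Map.toFun g x = b)
    (hB : Function.Injective (Map.toFun k)) (T : PsTop.{u}) :
    IsPushout (prod.map (𝟙 T) f) (prod.map (𝟙 T) g) (prod.map (𝟙 T) i) (prod.map (𝟙 T) k) := by
  have inj : ∀ {A : PsTop.{u}} (i : A ⟶ P), Function.Injective (Map.toFun i) →
      Function.Injective (Map.toFun (prod.map (𝟙 T) i)) := by
    intro A i hi z w hzw
    obtain ⟨t, a, rfl⟩ := exists_pmk z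
    obtain ⟨s, b, rfl⟩ := exists_pmk w
    rw [map_pmk, map_pmk, pmk_inj, Prod.mk.injEq] at hzw
    rw [pmk_inj]
    exact Prod.ext hzw.1 (hi hzw.2)
  refine isPushout_of_isGluing (by simp [hw]) (isGluing_prod_map h T)
    (fun a a' haa => Or.inl (inj i hA haa)) (fun z w hzw => ?_) (inj k hB)
  obtain ⟨t, a, rfl⟩ := exists_pmk z
  obtain ⟨s, b, rfl⟩ := exists_pmk w
  rw [map_pmk, map_pmk, pmk_inj, Prod.mk.injEq] at hzw
  obtain ⟨x, rfl, rfl⟩ := hAB a b hzw.2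
  refine ⟨pmk (t, x), map_pmk _ _ _, ?_⟩
  rw [map_pmk, pmk_inj]
  exact Prod.ext hzw.1 rfl

end Gluing

theorem nonempty_isInitial {X : PsTop.{u}} (h : IsEmpty X) : Nonempty (IsInitial X) :=
  ⟨IsInitial.ofUniqueHom (fun _ => mkHom (fun x => h.elim x) fun _ x => h.elim x)
    fun _ _ => hom_ext fun x => h.elim x⟩

/-! ## The embedding of cubes -/

instance (b : Box) : CompactSpace (boxEmbedding.{u}.obj b) := by
  have : CompactSpace (BoxShape.toTop b) := by
    cases b with
    | cube n => exact inferInstanceAs (CompactSpace (Cube n))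
    | boundary n => exact inferInstanceAs (CompactSpace (Bd n))
  exact inferInstanceAs (CompactSpace (ULift.{u} (BoxShape.toTop b)))

instance (b : Box) : T2Space (boxEmbedding.{u}.obj b) := by
  have : T2Space (BoxShape.toTop b) := by
    cases b with
    | cube n => exact inferInstanceAs (T2Space (Cube n))
    | boundary n => exact inferInstanceAs (T2Space (Bd n))
  exact inferInstanceAs (T2Space (ULift.{u} (BoxShape.toTop b)))

instance : boxEmbedding.{u}.Full where
  map_surjective {b b'} f := by
    have hf : Continuous (Map.toFun f) := pcont_iff_continuous.1 (pcont_toFun f)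
    refine ⟨InducedCategory.homMk (TopCat.ofHom
      ⟨fun x => ULift.down (Map.toFun f (ULift.up x)), ?_⟩), rfl⟩
    exact continuous_uliftDown.comp (hf.comp continuous_uliftUp)

instance : boxEmbedding.{u}.Faithful where
  map_injective {b b'} f g h := by
    refine InducedCategory.hom_ext (TopCat.hom_ext (ContinuousMap.ext fun x => ?_))
    exact congrArg ULift.down (congr_toFun h (ULift.up x))

theorem isGluing_of_continuous {A B : Type*} {b : Box} [TopologicalSpace A] [Pseudotopology A]
    [IsTopological A] [CompactSpace A] [TopologicalSpace B] [Pseudotopology B]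
    [IsTopological B] [CompactSpace B] {i : A → boxEmbedding.{u}.obj b}
    {k : B → boxEmbedding.{u}.obj b} (hi : PCont i) (hk : PCont k)
    (h : ∀ p, (∃ a, i a = p) ∨ ∃ b, k b = p) : IsGluing i k :=
  .of_compact (pcont_iff_continuous.1 hi) (pcont_iff_continuous.1 hk) h

end PsTop

namespace Pseudotopology

theorem PCont.pi {X : Type*} [Pseudotopology X] {n : ℕ} {f : X → CubeGeom.Cube n}
    (h : ∀ k, PCont fun x => f x k) : PCont f := by
  intro U x hx
  rw [mem_ulim_iff, Ultrafilter.coe_map, nhds_pi]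
  refine Filter.le_pi.2 fun k => ?_
  have := h k U x hx
  rwa [mem_ulim_iff, Ultrafilter.coe_map] at this

end Pseudotopology

namespace PsTop

open Pseudotopology CubeGeom

/-! ## Intervals -/

instance : IsEmpty (boxEmbedding.{u}.obj (Box.bd 0)) := ⟨fun x => isEmptyElim (downBd x)⟩

instance : Subsingleton (boxEmbedding.{u}.obj (Box.cube 0)) :=
  ⟨fun x y => (cube_zero_eq x).trans (cube_zero_eq y).symm⟩

/-- The map `a : I → I` as a morphism. -/
def intervalMap (a : C(unitInterval, unitInterval)) : Box.cube 1 ⟶ Box.cube 1 :=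
  Box.cubeMap ⟨fun x _ => a (x 0), by fun_prop⟩

theorem map_intervalMap (a : C(unitInterval, unitInterval)) (t : unitInterval) :
    Map.toFun (boxEmbedding.{u}.map (intervalMap a)) (upI t) = upI (a t) := rfl

theorem upI_inj {s t : unitInterval} : upI.{u} s = upI t ↔ s = t :=
  ⟨fun h => congrArg downI h, fun h => by rw [h]⟩

theorem e_intervalMap (a : C(unitInterval, unitInterval)) (t : unitInterval) :
    Box.e t ≫ intervalMap a = Box.e (a t) := rfl

theorem lowerHalf_zero : Box.lowerHalf 0 = 0 := Subtype.ext (by simp [Box.lowerHalf])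

theorem upperHalf_one : Box.upperHalf 1 = 1 := Subtype.ext (by simp [Box.upperHalf])

theorem upperHalf_zero : Box.upperHalf 0 = Box.lowerHalf 1 :=
  Subtype.ext (by simp [Box.upperHalf, Box.lowerHalf])

theorem e_zero_lowerHalf : Box.e 0 ≫ intervalMap Box.lowerHalf = Box.e 0 := by
  rw [e_intervalMap, lowerHalf_zero]

theorem e_one_upperHalf : Box.e 1 ≫ intervalMap Box.upperHalf = Box.e 1 := by
  rw [e_intervalMap, upperHalf_one]

theorem e_zero_upperHalf :
    Box.e 0 ≫ intervalMap Box.upperHalf = Box.e 1 ≫ intervalMap Box.lowerHalf := by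
  rw [e_intervalMap, e_intervalMap, upperHalf_zero]

theorem injective_map_intervalMap {a : C(unitInterval, unitInterval)} (ha : Function.Injective a) :
    Function.Injective (Map.toFun (boxEmbedding.{u}.map (intervalMap a))) := by
  intro x y h
  rw [← upI_downI x, ← upI_downI y, map_intervalMap, map_intervalMap, upI_inj] at h
  rw [← upI_downI x, ← upI_downI y, ha h]

theorem injective_lowerHalf : Function.Injective Box.lowerHalf := fun s t h => by
  have h : (s : ℝ) / 2 = t / 2 := congrArg Subtype.val h
  exact Subtype.ext (by linarith)

theorem injective_upperHalf : Function.Injective Box.upperHalf := fun s t h => by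
  have h : (1 + (s : ℝ)) / 2 = (1 + t) / 2 := congrArg Subtype.val h
  exact Subtype.ext (by linarith)

theorem isGluing_halves : IsGluing (Map.toFun (boxEmbedding.{u}.map (intervalMap Box.upperHalf)))
    (Map.toFun (boxEmbedding.{u}.map (intervalMap Box.lowerHalf))) := by
  refine isGluing_of_continuous (pcont_toFun _) (pcont_toFun _) fun p => ?_
  obtain ⟨p, rfl⟩ : ∃ t, upI t = p := ⟨downI p, upI_downI p⟩
  have h0 := p.2.1
  have h1 := p.2.2
  rcases le_total (2⁻¹ : ℝ) p with h | h
  · refine Or.inl ⟨upI ⟨2 * p - 1, by linarith, by linarith⟩, ?_⟩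
    rw [map_intervalMap, upI_inj]
    exact Subtype.ext (by simp [Box.upperHalf])
  · refine Or.inr ⟨upI ⟨2 * p, by linarith, by linarith⟩, ?_⟩
    rw [map_intervalMap, upI_inj]
    exact Subtype.ext (by simp [Box.lowerHalf])

theorem eq_endpoints_of_halves (a b : boxEmbedding.{u}.obj (Box.cube 1))
    (h : Map.toFun (boxEmbedding.{u}.map (intervalMap Box.upperHalf)) a =
      Map.toFun (boxEmbedding.{u}.map (intervalMap Box.lowerHalf)) b) :
    ∃ x, Map.toFun (boxEmbedding.{u}.map (Box.e 0)) x = a ∧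
      Map.toFun (boxEmbedding.{u}.map (Box.e 1)) x = b := by
  rw [← upI_downI a, ← upI_downI b, map_intervalMap, map_intervalMap, upI_inj] at h
  have h' : (1 + (downI a : ℝ)) / 2 = downI b / 2 := congrArg Subtype.val h
  have h0 := (downI a).2.1
  have h1 := (downI b).2.2
  refine ⟨up Fin.elim0, (map_e _ _).trans ?_, (map_e _ _).trans ?_⟩
  · rw [← upI_downI a, upI_inj]
    exact Subtype.ext (by rw [Set.Icc.coe_zero]; linarith)
  · rw [← upI_downI b, upI_inj]
    exact Subtype.ext (by rw [Set.Icc.coe_one]; linarith)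

theorem isPushout_intervals : IsPushout (boxEmbedding.{u}.map (Box.e 0))
    (boxEmbedding.{u}.map (Box.e 1)) (boxEmbedding.{u}.map (intervalMap Box.upperHalf))
    (boxEmbedding.{u}.map (intervalMap Box.lowerHalf)) :=
  isPushout_of_isGluing (by rw [← Functor.map_comp, ← Functor.map_comp, e_zero_upperHalf])
    isGluing_halves
    (fun _ _ h => Or.inl (injective_map_intervalMap injective_upperHalf h))
    eq_endpoints_of_halves (injective_map_intervalMap injective_lowerHalf)

theorem isPushout_prod_intervals (X : PsTop.{u}) :
    IsPushout (prod.map (𝟙 X) (boxEmbedding.{u}.map (Box.e 0)))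
      (prod.map (𝟙 X) (boxEmbedding.{u}.map (Box.e 1)))
      (prod.map (𝟙 X) (boxEmbedding.{u}.map (intervalMap Box.upperHalf)))
      (prod.map (𝟙 X) (boxEmbedding.{u}.map (intervalMap Box.lowerHalf))) :=
  isPushout_prod_map (by rw [← Functor.map_comp, ← Functor.map_comp, e_zero_upperHalf])
    isGluing_halves (injective_map_intervalMap injective_upperHalf)
    eq_endpoints_of_halves (injective_map_intervalMap injective_lowerHalf) X

theorem cube_ext {n : ℕ} {z w : boxEmbedding.{u}.obj (Box.cube n)}
    (h : ∀ k, Map.toFun (boxEmbedding.{u}.map (Box.proj n k)) z =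
      Map.toFun (boxEmbedding.{u}.map (Box.proj n k)) w) : z = w :=
  congrArg up (funext fun k => upI_inj.1 (h k))

/-- The map to a cube with given coordinates. -/
def toCube {X : PsTop.{u}} {n : ℕ} (f : Fin n → (X ⟶ boxEmbedding.{u}.obj (Box.cube 1))) :
    X ⟶ boxEmbedding.{u}.obj (Box.cube n) :=
  mkHom (fun x => up fun k => downI (Map.toFun (f k) x)) (by
    have : PCont (fun x => (fun k => downI (Map.toFun (f k) x) : Cube n)) :=
      .pi fun k => by fun_prop
    exact pcont_up.comp this)

theorem toCube_proj {X : PsTop.{u}} {n : ℕ}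
    (f : Fin n → (X ⟶ boxEmbedding.{u}.obj (Box.cube 1))) (k : Fin n) :
    toCube f ≫ boxEmbedding.{u}.map (Box.proj n k) = f k :=
  hom_ext fun _ => upI_downI _

theorem toCube_uniq {X : PsTop.{u}} {n : ℕ}
    {f : Fin n → (X ⟶ boxEmbedding.{u}.obj (Box.cube 1))} {m : X ⟶ boxEmbedding.{u}.obj (Box.cube n)}
    (h : ∀ k, m ≫ boxEmbedding.{u}.map (Box.proj n k) = f k) : m = toCube f :=
  hom_ext fun x => cube_ext fun k => congr_toFun ((h k).trans (toCube_proj f k).symm) x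

theorem isCategoryWithIntervals :
    IsCategoryWithIntervals (BoxLE2.incl ⋙ boxEmbedding.{u}) where
  full := inferInstance
  faithful := inferInstance
  s1_empty := nonempty_isInitial (inferInstanceAs (IsEmpty (boxEmbedding.{u}.obj (Box.bd 0))))
  s1_point := ⟨IsTerminal.ofUniqueHom
    (fun X => mkHom (fun _ => up.{u} (Fin.elim0 : Cube 0)) (by fun_prop))
    fun X m => hom_ext fun x => cube_zero_eq _⟩
  s2 := ⟨BinaryFan.isLimitMk (fun s => toCube ![s.fst, s.snd])
    (fun s => toCube_proj ![s.fst, s.snd] 0) (fun s => toCube_proj ![s.fst, s.snd] 1)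
    fun s m h0 h1 => toCube_uniq fun k => by
      fin_cases k
      · exact h0
      · exact h1⟩
  s3 := by
    refine ⟨ObjectProperty.homMk (intervalMap Box.lowerHalf),
      ObjectProperty.homMk (intervalMap Box.upperHalf), ?_, ?_, ?_, isPushout_intervals,
      isPushout_prod_intervals⟩
    · exact ObjectProperty.hom_ext _ e_zero_lowerHalf
    · exact ObjectProperty.hom_ext _ e_one_upperHalf
    -- A fully faithful functor reflects pushouts, so the square among cubes follows from its image.
    · exact IsPushout.of_map (BoxLE2.incl ⋙ boxEmbedding.{u})
        (ObjectProperty.hom_ext _ e_zero_upperHalf) isPushout_intervals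
  s4 := fun X => nonempty_isInitial ⟨fun w =>
    isEmptyElim (Map.toFun (prod.fst : boxEmbedding.{u}.obj (Box.bd 0) ⨯ X ⟶ _) w)⟩

end PsTop

namespace PsTop

open Pseudotopology CubeGeom

/-! ## Pushout products -/

/-- A map out of the corner of the pushout product is a pair of continuous functions compatible on
`X × A`, so the lifting problem can be stated without the pushout. -/
theorem hasLiftingProperty_pushoutProduct {X Y A B E D : PsTop.{u}} {f : X ⟶ Y} {g : A ⟶ B}
    {p : E ⟶ D}
    (H : ∀ (a : Y × A → E) (b : X × B → E) (q : Y × B → D), PCont a → PCont b → PCont q →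
      (∀ x s, a (Map.toFun f x, s) = b (x, Map.toFun g s)) →
      (∀ y s, Map.toFun p (a (y, s)) = q (y, Map.toFun g s)) →
      (∀ x t, Map.toFun p (b (x, t)) = q (Map.toFun f x, t)) →
      ∃ h : Y × B → E, PCont h ∧ (∀ y s, h (y, Map.toFun g s) = a (y, s)) ∧
        (∀ x t, h (Map.toFun f x, t) = b (x, t)) ∧ ∀ z, Map.toFun p (h z) = q z) :
    HasLiftingProperty (pushoutProduct f g) p := by
  refine ⟨fun {v w} sq => ?_⟩
  have e1 : pushout.inl (prod.map f (𝟙 A)) (prod.map (𝟙 X) g) ≫ pushoutProduct f g =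
    prod.map (𝟙 Y) g := pushout.inl_desc _ _ _
  have e2 : pushout.inr (prod.map f (𝟙 A)) (prod.map (𝟙 X) g) ≫ pushoutProduct f g =
    prod.map f (𝟙 B) := pushout.inr_desc _ _ _
  have hl : pushout.inl (prod.map f (𝟙 A)) (prod.map (𝟙 X) g) ≫ v ≫ p = prod.map (𝟙 Y) g ≫ w := by
    rw [sq.w, ← Category.assoc, e1]
  have hr : pushout.inr (prod.map f (𝟙 A)) (prod.map (𝟙 X) g) ≫ v ≫ p = prod.map f (𝟙 B) ≫ w := by
    rw [sq.w, ← Category.assoc, e2]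
  obtain ⟨h, hh, h1, h2, h3⟩ := H
    (fun z => Map.toFun (pushout.inl (prod.map f (𝟙 A)) (prod.map (𝟙 X) g) ≫ v) (pmk z))
    (fun z => Map.toFun (pushout.inr (prod.map f (𝟙 A)) (prod.map (𝟙 X) g) ≫ v) (pmk z))
    (fun z => Map.toFun w (pmk z)) (by fun_prop) (by fun_prop) (by fun_prop)
    (fun x s => by
      have := congr_toFun (congrArg (· ≫ v)
        (pushout.condition (f := prod.map f (𝟙 A)) (g := prod.map (𝟙 X) g))) (pmk (x, s))
      simp only [Category.assoc] at this
      rw [comp_apply', comp_apply' (prod.map (𝟙 X) g), map_pmk, map_pmk] at this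
      exact this)
    (fun y s => by
      have := congr_toFun hl (pmk (y, s))
      rw [comp_apply' (prod.map (𝟙 Y) g), map_pmk] at this
      exact this)
    (fun y s => by
      have := congr_toFun hr (pmk (y, s))
      rw [comp_apply' (prod.map f (𝟙 B)), map_pmk] at this
      exact this)
  refine ⟨⟨⟨prodHom h hh, ?_, prod_hom_ext fun y t => ?_⟩⟩⟩
  · refine pushout.hom_ext ?_ ?_
    · rw [← Category.assoc, e1]
      refine prod_hom_ext fun y s => ?_
      rw [comp_apply', map_pmk, prodHom_pmk]
      exact h1 y s
    · rw [← Category.assoc, e2]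
      refine prod_hom_ext fun x t => ?_
      rw [comp_apply', map_pmk, prodHom_pmk]
      exact h2 x t
  · rw [comp_apply', prodHom_pmk]
    exact h3 (y, t)

/-- Under `I^m × I^n ≃ I^(m+n)` the boundary is the union of the closed sets `∂I^m × I^n` and `I^m ×
∂I^n`. Lifting against the pushout product is therefore lifting against `i_(m+n)`. -/
theorem cof_pushoutProduct_i_i (m n : ℕ) : cof (genI boxEmbedding.{u})
    (pushoutProduct (boxEmbedding.{u}.map (Box.i m)) (boxEmbedding.{u}.map (Box.i n))) := by
  rw [cof_genI]
  intro E D p hp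
  rw [rlp_genI_iff] at hp
  refine hasLiftingProperty_pushoutProduct fun a b q ha hb hq h1 h2 h3 => ?_
  have he : PCont (prodHomeo m n) := .of_continuous (prodHomeo m n).continuous
  have he' : PCont (prodHomeo m n).symm := .of_continuous (prodHomeo m n).symm.continuous
  have hbd : ∀ w : Bd (m + n), OnBd ((prodHomeo m n).symm w.1).1 ∨
      OnBd ((prodHomeo m n).symm w.1).2 := fun w =>
    (onBd_prodHomeo _).1 (by rw [Homeomorph.apply_symm_apply]; exact w.2)
  obtain ⟨r, hr, r1, r2⟩ := exists_glue (A := Bd (m + n))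
    (P := fun w => OnBd ((prodHomeo m n).symm w.1).1)
    (Q := fun w => OnBd ((prodHomeo m n).symm w.1).2)
    (F := fun w => b (upBd ⟨_, w.2⟩, up ((prodHomeo m n).symm w.1.1).2))
    (G := fun w => a (up ((prodHomeo m n).symm w.1.1).1, upBd ⟨_, w.2⟩))
    (pclosed_onBd.preimage (f := fun w : Bd (m + n) => ((prodHomeo m n).symm w.1).1) (by fun_prop))
    (pclosed_onBd.preimage (f := fun w : Bd (m + n) => ((prodHomeo m n).symm w.1).2) (by fun_prop))
    hbd (by fun_prop) (by fun_prop)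
    (fun w hw hw' => (h1 (upBd ⟨_, hw⟩) (upBd ⟨_, hw'⟩)).symm)
  obtain ⟨h, hh, e1, e2⟩ := hp (m + n) r
    (fun z => q (up ((prodHomeo m n).symm z).1, up ((prodHomeo m n).symm z).2)) hr (by fun_prop)
    (fun w => by
      rcases hbd w with hw | hw
      · rw [r1 w hw]
        exact h3 (upBd ⟨_, hw⟩) _
      · rw [r2 w hw]
        exact h2 _ (upBd ⟨_, hw⟩))
  refine ⟨fun z => h (prodHomeo m n (down z.1, down z.2)), by fun_prop, fun y s => ?_,
    fun x t => ?_, fun z => ?_⟩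
  · have hw : OnBd ((prodHomeo m n).symm (prodHomeo m n (down y, (downBd s).1))).2 := by
      rw [Homeomorph.symm_apply_apply]
      exact (downBd s).2
    refine (e1 ⟨_, (onBd_prodHomeo (down y, (downBd s).1)).2 (Or.inr (downBd s).2)⟩).trans ?_
    rw [r2 _ hw]
    simp only [Homeomorph.symm_apply_apply]
    rfl
  · have hw : OnBd ((prodHomeo m n).symm (prodHomeo m n ((downBd x).1, down t))).1 := by
      rw [Homeomorph.symm_apply_apply]
      exact (downBd x).2
    refine (e1 ⟨_, (onBd_prodHomeo ((downBd x).1, down t)).2 (Or.inl (downBd x).2)⟩).trans ?_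
    rw [r1 _ hw]
    simp only [Homeomorph.symm_apply_apply]
    rfl
  · rw [e2, Homeomorph.symm_apply_apply]
    rfl

/-- This is box lifting in `I^m × I`, with the remaining cube `I^n` as parameter. -/
theorem cof_pushoutProduct_i_j (m n : ℕ) : cof (genJ boxEmbedding.{u})
    (pushoutProduct (boxEmbedding.{u}.map (Box.i m)) (boxEmbedding.{u}.map (Box.j n))) := by
  rw [cof_genJ]
  intro E D p hp
  rw [rlp_genJ_iff] at hp
  refine hasLiftingProperty_pushoutProduct fun a b q ha hb hq h1 h2 h3 => ?_
  obtain ⟨h, hh, e1, e2, e3⟩ := hp.exists_box_lift (n := m) (T := Cube n)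
    (p := fun z => a (up z.1, up z.2)) (b := fun z => b (upBd z.1.1, up (snoc (z.1.2, z.2))))
    (q := fun z => q (up z.1.1, up (snoc (z.1.2, z.2)))) (by fun_prop) (by fun_prop) (by fun_prop)
    (fun z τ => by
      dsimp only
      rw [← map_j]
      exact (h1 (upBd z) (up τ)).symm)
    (fun z => by
      dsimp only
      rw [← map_j]
      exact h2 _ _)
    (fun z τ t => h3 _ _)
  refine ⟨fun z => h ((down z.1, (unsnoc (down z.2)).1), (unsnoc (down z.2)).2), by fun_prop,
    fun y s => ?_, fun x t => ?_, fun z => ?_⟩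
  · obtain ⟨s, rfl⟩ : ∃ s', up s' = s := ⟨down s, rfl⟩
    rw [map_j]
    simp only [down_up, unsnoc_snoc]
    exact e1 _
  · refine (e2 (downBd x) _ _).trans ?_
    rw [Prod.mk.eta, snoc_unsnoc]
    rfl
  · rw [e3]
    dsimp only
    rw [Prod.mk.eta, snoc_unsnoc]
    rfl

/-! ## Exponentials -/

theorem pcont_uncurry {K X Y : PsTop.{u}} (g : X ⟶ of (Exp K Y)) :
    PCont (fun z : X × K => Exp.eval (K := K) (Y := Y) (Map.toFun g z.1, z.2)) :=
  Exp.pcont_eval.comp ((PCont.comp (pcont_toFun g) PCont.fst').prodMk PCont.snd')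

/-- Currying of morphisms. -/
noncomputable def curryEquiv (K X Y : PsTop.{u}) : (X ⨯ K ⟶ Y) ≃ (X ⟶ of (Exp K Y)) where
  toFun f := mkHom (Exp.curry (fun z : X × K => Map.toFun f (pmk z)) (by fun_prop))
    (Exp.pcont_curry _ _)
  invFun g := prodHom _ (pcont_uncurry g)
  left_inv f := prod_hom_ext fun x y => prodHom_pmk _ _ _
  right_inv g := hom_ext fun x => Exp.ext (K := K) (Y := Y) fun k =>
    prodHom_pmk _ (pcont_uncurry g) (x, k)

theorem isLeftAdjoint_prod (K : PsTop.{u}) :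
    (prod.functor.flip.obj K : PsTop.{u} ⥤ PsTop.{u}).IsLeftAdjoint := by
  have he : ∀ (X' X Y : PsTop.{u}) (f : X' ⟶ X) (g : X ⨯ K ⟶ Y),
      curryEquiv K X' Y (prod.map f (𝟙 K) ≫ g) = f ≫ curryEquiv K X Y g := fun X' X Y f g =>
    hom_ext fun x => Exp.ext (K := K) (Y := Y) fun k => by
      change Map.toFun (prod.map f (𝟙 K) ≫ g) (pmk (x, k)) = Map.toFun g (pmk (Map.toFun f x, k))
      rw [comp_apply', map_pmk]
      rfl
  exact (Adjunction.adjunctionOfEquivRight (F := prod.functor.flip.obj K)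
    (fun X Y => curryEquiv K X Y) he).isLeftAdjoint

/-! ## Cones and spheres -/

theorem isPushout_cone (n : ℕ) :
    ∃ (c : boxEmbedding.{u}.obj (Box.cube 0) ⟶ boxEmbedding.{u}.obj (Box.cube n))
    (ρ : boxEmbedding.{u}.obj (Box.bd n) ⨯ boxEmbedding.{u}.obj (Box.cube 1) ⟶
      boxEmbedding.{u}.obj (Box.cube n)),
    IsPushout (prod.map (𝟙 (boxEmbedding.{u}.obj (Box.bd n))) (boxEmbedding.{u}.map (Box.e 1)))
      (prod.fst ≫ boxEmbedding.{u}.map (Box.toPt n)) ρ c ∧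
    prod.map (𝟙 (boxEmbedding.{u}.obj (Box.bd n))) (boxEmbedding.{u}.map (Box.e 0)) ≫ ρ =
      prod.fst ≫ boxEmbedding.{u}.map (Box.i n) := by
  have hcone : PCont (cone (n := n)) := .of_continuous continuous_cone
  refine ⟨ofCube (fun _ => up (centre n)) (by fun_prop),
    prodHom (fun z => up (cone (downBd z.1, downI z.2))) (by fun_prop), ?_, ?_⟩
  · refine isPushout_of_isGluing (prod_hom_ext fun x y => ?_) ?_ (fun a a' h => ?_)
      (fun a b h => ?_) (fun _ _ _ => Subsingleton.elim _ _)
    · rw [comp_apply', map_pmk, prodHom_pmk, cube_zero_eq y]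
      exact congrArg up (cone_one _)
    -- It suffices that convergence lifts to the set-theoretic product `∂I^n × I`, whose compactness
    -- is known.
    · refine IsGluing.of_comp_left (e := fun z : Bd n × unitInterval => pmk (upBd z.1, upI z.2))
        (by fun_prop) ?_
      refine isGluing_of_continuous (by fun_prop) (by fun_prop) fun x => ?_
      rcases exists_cone_eq (down x) with ⟨z, hz⟩ | hx
      · refine Or.inl ⟨z, ?_⟩
        rw [prodHom_pmk]
        exact congrArg up hz
      · exact Or.inr ⟨up Fin.elim0, (congrArg up hx).symm⟩
    · obtain ⟨x, s, rfl⟩ := exists_pmk a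
      obtain ⟨y, t, rfl⟩ := exists_pmk a'
      rw [prodHom_pmk, prodHom_pmk, up_inj] at h
      rcases cone_inj h with h | ⟨hs, ht⟩
      · refine Or.inl ?_
        rw [pmk_inj, ← upI_downI s, ← upI_downI t]
        exact congrArg (fun z => (upBd z.1, upI z.2)) h
      · refine Or.inr ⟨pmk (x, up Fin.elim0), pmk (y, up Fin.elim0), ?_, ?_,
          Subsingleton.elim _ _⟩
        · rw [map_pmk, pmk_inj, ← upI_downI s]
          exact Prod.ext rfl (congrArg upI hs.symm)
        · rw [map_pmk, pmk_inj, ← upI_downI t]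
          exact Prod.ext rfl (congrArg upI ht.symm)
    · obtain ⟨x, s, rfl⟩ := exists_pmk a
      refine ⟨pmk (x, up Fin.elim0), ?_, Subsingleton.elim _ _⟩
      rw [prodHom_pmk] at h
      rw [map_pmk, pmk_inj, ← upI_downI s]
      exact Prod.ext rfl (congrArg upI (cone_eq_centre (up_inj.1 h)).symm)
  · refine prod_hom_ext fun x y => ?_
    rw [comp_apply', map_pmk, prodHom_pmk, cube_zero_eq y, comp_apply', fst_pmk]
    exact congrArg up (cone_zero _)

theorem isPushout_sphere (n : ℕ) :
    ∃ σ : boxEmbedding.{u}.obj (Box.cube n) ⟶ boxEmbedding.{u}.obj (Box.bd (n + 1)),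
      IsPushout (boxEmbedding.{u}.map (Box.i n)) (boxEmbedding.{u}.map (Box.toPt n)) σ
        (boxEmbedding.{u}.map (Box.vertex n)) := by
  have hsph : PCont (sph (n := n)) := .of_continuous continuous_sph
  refine ⟨ofCube (fun z => upBd (sph z)) (by fun_prop), ?_⟩
  refine isPushout_of_isGluing (bd_hom_ext fun z => congrArg upBd (sph_of_bd z.2)) ?_
    (fun a a' h => ?_) (fun a b h => ?_) (fun _ _ _ => Subsingleton.elim _ _)
  · refine isGluing_of_continuous (by fun_prop) (pcont_toFun _) fun x => ?_
    rcases exists_sph_eq (downBd x) with ⟨z, hz⟩ | hx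
    · exact Or.inl ⟨up z, congrArg upBd hz⟩
    · exact Or.inr ⟨up Fin.elim0, (congrArg upBd hx).symm⟩
  · rcases sph_inj (upBd_inj.1 h) with h | ⟨h1, h2⟩
    · exact Or.inl (congrArg up h)
    · exact Or.inr ⟨upBd ⟨_, h1⟩, upBd ⟨_, h2⟩, rfl, rfl, Subsingleton.elim _ _⟩
  · exact ⟨upBd ⟨_, sph_eq_vtx (upBd_inj.1 h)⟩, rfl, Subsingleton.elim _ _⟩

/-- The sphere `∂I^(n+1)` has two cells: the vertex, attached by `i_0`, and an `n`-cell, since the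
vertex inclusion is a pushout of `i_n` by the sphere square. -/
theorem cof_fromEmpty (n : ℕ) :
    cof (genI boxEmbedding.{u}) (boxEmbedding.{u}.map (Box.fromEmpty n)) := by
  rw [cof_genI]
  cases n with
  | zero =>
    have : Box.fromEmpty 0 = 𝟙 _ := boxEmbedding.{u}.map_injective (hom_ext fun x => isEmptyElim x)
    rw [this, CategoryTheory.Functor.map_id]
    exact MorphismProperty.id_mem _ _
  | succ n =>
    have : boxEmbedding.{u}.map (Box.fromEmpty (n + 1)) =
      boxEmbedding.{u}.map (Box.i 0) ≫ boxEmbedding.{u}.map (Box.vertex n) :=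
        hom_ext fun x => isEmptyElim x
    rw [this]
    have h : ∀ n, (genI boxEmbedding.{u}).rlp.llp (boxEmbedding.{u}.map (Box.i n)) := fun n =>
      MorphismProperty.le_llp_rlp _ _ ⟨n⟩
    obtain ⟨σ, hσ⟩ := isPushout_sphere.{u} n
    exact MorphismProperty.comp_mem _ _ _ (h 0) (MorphismProperty.of_isPushout hσ.flip (h n))

/-! ## The good Q-structure -/

theorem isQStructure : IsQStructure boxEmbedding.{u} where
  full := inferInstance
  faithful := inferInstance
  q1 := isCategoryWithIntervals
  q2 X := by
    have inj : ∀ (t : unitInterval) (ht : t = 0 ∨ t = 1), Function.Injective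
        (Map.toFun (prod.map (𝟙 X) (boxEmbedding.{u}.map (Box.eBd t ht)))) := by
      intro t ht z w h
      obtain ⟨x, a, rfl⟩ := exists_pmk z
      obtain ⟨y, b, rfl⟩ := exists_pmk w
      rw [map_pmk, map_pmk, pmk_inj, Prod.mk.injEq] at h
      rw [pmk_inj]
      exact Prod.ext h.1 (Subsingleton.elim _ _)
    refine nonempty_isColimit_of_isGluing (isGluing_prod_map ?_ X) (inj _ _) (inj _ _)
      fun z w h => ?_
    · refine isGluing_of_continuous (pcont_toFun _) (pcont_toFun _) fun p => ?_
      have hp : p = upBd ⟨fun _ => (downBd p).1 0, 0, by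
          obtain ⟨i, hi⟩ := (downBd p).2
          rwa [Subsingleton.elim i 0] at hi⟩ :=
        congrArg upBd (Subtype.ext (funext fun i => by rw [Subsingleton.elim i 0]; rfl))
      obtain ⟨i, hi⟩ := (downBd p).2
      rw [Subsingleton.elim i 0] at hi
      refine hi.imp (fun hi => ⟨up Fin.elim0, ?_⟩) (fun hi => ⟨up Fin.elim0, ?_⟩)
      · refine Eq.trans ?_ hp.symm
        exact congrArg upBd (Subtype.ext (funext fun _ => hi.symm))
      · refine Eq.trans ?_ hp.symm
        exact congrArg upBd (Subtype.ext (funext fun _ => hi.symm))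
    · obtain ⟨x, a, rfl⟩ := exists_pmk z
      obtain ⟨y, b, rfl⟩ := exists_pmk w
      rw [map_pmk, map_pmk, pmk_inj, Prod.mk.injEq] at h
      have h' := congrFun (congrArg (fun q => (downBd q).1) h.2) 0
      exact zero_ne_one (α := unitInterval) h'
  q3_I := cof_pushoutProduct_i_i
  q3_J := cof_pushoutProduct_i_j
  q4_J := by
    rw [cof_genI]
    exact (MorphismProperty.le_llp_rlp _).trans
      (MorphismProperty.antitone_llp rlp_genI_le_rlp_genJ)
  q4_bd := cof_fromEmpty
  q5_bd _ := isLeftAdjoint_prod _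
  q5_cube _ := isLeftAdjoint_prod _
  q6_bd _ := isSmallRelativeTo_cell injective_of_llp_rlp_genI _
  q6_cube _ := isSmallRelativeTo_cell injective_of_llp_rlp_genJ _

theorem isGoodQStructure : IsGoodQStructure boxEmbedding.{u} where
  toIsQStructure := isQStructure
  q7 _ _ := ⟨Fan.IsLimit.mk _ (fun s => toCube s.proj) (fun s k => toCube_proj s.proj k)
    fun _ _ h => toCube_uniq h⟩
  q8_cone := isPushout_cone
  q8_sphere := isPushout_sphere

end PsTop

namespace PsTop

open Pseudotopology CubeGeom

/-! ## The model structure -/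

theorem rlp_genI_eq :
    (genI boxEmbedding.{u}).rlp = (genJ boxEmbedding.{u}).rlp ⊓ weakRLP boxEmbedding.{u} := by
  ext X Y f
  refine Iff.trans ?_ (and_congr (rlp_genJ_iff f).symm (weakRLP_iff f).symm)
  rw [rlp_genI_iff]
  exact ⟨fun h => ⟨h.rlpj, h.wrlp⟩, fun h => h.2.rlpi h.1⟩

instance : (weakRLP boxEmbedding.{u}).HasTwoOutOfThreeProperty where
  comp_mem f g hf hg := by
    rw [weakRLP_iff] at *
    exact WRLP.comp (f := Map.toFun f) (g := Map.toFun g) hg hf (pcont_toFun f)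
      (pcont_toFun g)
  of_postcomp f g hg hfg := by
    rw [weakRLP_iff] at *
    exact WRLP.of_comp (f := Map.toFun f) (g := Map.toFun g) hg hfg (pcont_toFun f)
      (pcont_toFun g)
  of_precomp f g hf hfg := by
    rw [weakRLP_iff] at *
    exact WRLP.of_precomp (f := Map.toFun f) (g := Map.toFun g) hf hfg (pcont_toFun f)
      (pcont_toFun g)

/-- Lifting the identity of `B` against the endpoint fibration of the mapping path space, relative
to the constant paths on `A`, yields a retraction of `j` and a homotopy from `j` after it to the
identity, stationary on `A`. This strong deformation retraction provides all weak lifts explicitly.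
-/
theorem llp_rlp_genJ_le_weakRLP : (genJ boxEmbedding.{u}).rlp.llp ≤ weakRLP boxEmbedding.{u} := by
  intro A B j hj
  have hc : PCont (Map.toFun j) := pcont_toFun j
  let π : of (PathSpace (Map.toFun j)) ⟶ B := mkHom (fun z => Exp.eval (z.1.2, 1)) (by fun_prop)
  have hπ : (genJ boxEmbedding.{u}).rlp π := (rlp_genJ_iff π).2 (rlpj_path_end hc)
  let κ : A → Exp unitInterval B := Exp.curry (fun z => Map.toFun j z.1) (by fun_prop)
  have hκ : PCont κ := Exp.pcont_curry _ _
  let σ : A ⟶ of (PathSpace (Map.toFun j)) := mkHom (fun a => ⟨(a, κ a), rfl⟩)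
    (PCont.subtypeMk (f := fun a => (a, κ a)) (by fun_prop) fun _ => rfl)
  have := hj _ hπ
  have sq : CommSq σ j π (𝟙 B) := ⟨hom_ext fun a => rfl⟩
  let s : B → PathSpace (Map.toFun j) := Map.toFun sq.lift
  have hs : PCont s := pcont_toFun (Y := of (PathSpace (Map.toFun j))) sq.lift
  have h1 : ∀ a, s (Map.toFun j a) = ⟨(a, κ a), rfl⟩ := fun a => congr_toFun sq.fac_left a
  have h2 : ∀ b, Exp.eval ((s b).1.2, 1) = b := fun b => congr_toFun sq.fac_right b
  rw [weakRLP_iff]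
  intro n p q hp hq hpq
  -- Retract `q` into `A`; the paths recorded by `s` form the homotopy back to `q`, constant
  -- wherever `q` comes from `A`.
  refine ⟨fun z => (s (q z)).1.1, by fun_prop, fun z => ?_,
    fun z => Exp.eval ((s (q z.1)).1.2, z.2), by fun_prop, fun z => (s (q z)).2, fun z => h2 _,
    fun z t hz => ?_⟩
  · dsimp only
    rw [← hpq, h1]
  · have := hpq ⟨z, hz⟩
    dsimp only at this ⊢
    rw [← this, h1]
    rfl

/-- Factor `f` as a map in `cof(J)` followed by a fibration. By two out of three the fibration is a
weak equivalence, hence in `rlp(I)`. So `f` lifts against it and is a retract of the first factor.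
-/
theorem llp_rlp_genJ_eq : (genJ boxEmbedding.{u}).rlp.llp =
    (genI boxEmbedding.{u}).rlp.llp ⊓ weakRLP boxEmbedding.{u} := by
  refine le_antisymm (le_inf (MorphismProperty.antitone_llp rlp_genI_le_rlp_genJ)
    llp_rlp_genJ_le_weakRLP) ?_
  rintro A B f ⟨hf, hw⟩
  let d := MorphismProperty.factorizationData (genJ boxEmbedding.{u}).rlp.llp
    (genJ boxEmbedding.{u}).rlp f
  have hp : (genI boxEmbedding.{u}).rlp d.p := by
    rw [rlp_genI_eq]
    refine ⟨d.hp, (weakRLP boxEmbedding.{u}).of_precomp d.i d.p (llp_rlp_genJ_le_weakRLP _ d.hi) ?_⟩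
    rwa [d.fac]
  have := hf _ hp
  exact MorphismProperty.of_retract (RetractArrow.ofLeftLiftingProperty d.fac) d.hi

/-- The model structure on pseudotopological spaces. -/
@[reducible]
noncomputable def modelCategory : HomotopicalAlgebra.ModelCategory PsTop.{u} :=
  let _ : HomotopicalAlgebra.CategoryWithFibrations PsTop.{u} := ⟨(genJ boxEmbedding.{u}).rlp⟩
  let _ : HomotopicalAlgebra.CategoryWithCofibrations PsTop.{u} :=
    ⟨(genI boxEmbedding.{u}).rlp.llp⟩
  let _ : HomotopicalAlgebra.CategoryWithWeakEquivalences PsTop.{u} := ⟨weakRLP boxEmbedding.{u}⟩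
  have : (HomotopicalAlgebra.weakEquivalences PsTop.{u}).HasTwoOutOfThreeProperty :=
    inferInstanceAs (weakRLP boxEmbedding.{u}).HasTwoOutOfThreeProperty
  have hI : HomotopicalAlgebra.trivialFibrations PsTop.{u} = (genI boxEmbedding.{u}).rlp :=
    rlp_genI_eq.symm
  have hJ : HomotopicalAlgebra.trivialCofibrations PsTop.{u} = (genJ boxEmbedding.{u}).rlp.llp :=
    llp_rlp_genJ_eq.symm
  have : MorphismProperty.IsWeakFactorizationSystem (HomotopicalAlgebra.cofibrations PsTop.{u})
      (HomotopicalAlgebra.trivialFibrations PsTop.{u}) := by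
    rw [hI]
    exact ⟨MorphismProperty.rlp_llp_rlp _, rfl, inferInstanceAs
      (MorphismProperty.HasFactorization (genI boxEmbedding.{u}).rlp.llp
        (genI boxEmbedding.{u}).rlp)⟩
  have : MorphismProperty.IsWeakFactorizationSystem
      (HomotopicalAlgebra.trivialCofibrations PsTop.{u})
      (HomotopicalAlgebra.fibrations PsTop.{u}) := by
    rw [hJ]
    exact ⟨MorphismProperty.rlp_llp_rlp _, rfl, inferInstanceAs
      (MorphismProperty.HasFactorization (genJ boxEmbedding.{u}).rlp.llp
        (genJ boxEmbedding.{u}).rlp)⟩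
  HomotopicalAlgebra.ModelCategory.mk' _

end PsTop

/-- Pseudotopological spaces, with the canonical embedding of the cubes and their boundaries, form a
good Q-structure; and they carry a model structure with the indicated classes of maps. -/
theorem mainTheorem3 :
    IsGoodQStructure PsTop.boxEmbedding.{u} ∧
    (∃ M : HomotopicalAlgebra.ModelCategory PsTop.{u},
      @HomotopicalAlgebra.cofibrations PsTop.{u} _ M.categoryWithCofibrations =
        cof (genI PsTop.boxEmbedding.{u}) ∧
      @HomotopicalAlgebra.fibrations PsTop.{u} _ M.categoryWithFibrations =
        (genJ PsTop.boxEmbedding.{u}).rlp ∧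
      @HomotopicalAlgebra.weakEquivalences PsTop.{u} _ M.categoryWithWeakEquivalences =
        weakRLP PsTop.boxEmbedding.{u}) ∧
    weakRLP PsTop.boxEmbedding.{u} = isoOnHomotopyGroups PsTop.boxEmbedding.{u} :=
  ⟨PsTop.isGoodQStructure, ⟨PsTop.modelCategory, PsTop.cof_genI.symm, rfl, rfl⟩,
    PsTop.weakRLP_eq_isoOnHomotopyGroups⟩
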